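/- Let $n\ge 1$ and let $D(GL_n)=GL_n(\mathbb C)\times GL_n(\mathbb C)$, with points $(X,Y)$ and field of rational functions $\mathbb C(D(GL_n))=\mathbb C(x_{ij},y_{ij})$. *The bracket.* On $\mathfrak{gl}_n$ let $\langle\xi,\xi'\rangle=\operatorname{tr}(\xi\xi')$, $R=\pi_{>0}-\pi_{<0}$ (projections onto strictly upper and strictly lower triangular matrices) and $R_\pm=\frac12(R\pm\mathrm{Id})$. On $\mathfrak{gl}_n\oplus\mathfrak{gl}_n$ let $\langle\langle(\xi,\eta),(\xi',\eta')\rangle\rangle=\langle\xi,\xi'\rangle-\langle\eta,\eta'\rangle$, $\mathfrak d_+=\{(\xi,\xi)\}$, $\mathfrak d_-=\{(R_+\xi,R_-\xi)\}$ and $R_D=\pi_{\mathfrak d_+}-\pi_{\mathfrak d_-}$ (projections along $\mathfrak d_+\oplus\mathfrak d_-$). The left and right gradients of $f$ are defined by $\langle\langle\nabla^Lf,(\xi,\eta)\rangle\rangle=\frac{d}{dt}\big|_{t=0}f(Xe^{t\xi},Ye^{t\eta})$ and $\langle\langle\nabla^Rf,(\xi,\eta)\rangle\rangle=\frac{d}{dt}\big|_{t=0}f(e^{t\xi}X,e^{t\eta}Y)$,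 and the Poisson–Lie bracket is $$\{f_1,f_2\}_D=\tfrac12\big(\langle\langle R_D(\nabla^Lf_1),\nabla^Lf_2\rangle\rangle-\langle\langle R_D(\nabla^Rf_1),\nabla^Rf_2\rangle\rangle\big).$$ *The functions.* Write $A_I^J$ for the submatrix of $A$ with rows $I$ and columns $J$ (all rows or all columns if $I$ or $J$ is omitted), and put $U=X^{-1}Y$. Let - $g_{ij}=\det X_{[i,n]}^{[j,j+n-i]}$ for $1\le j\le i\le n$; - $h_{ij}=\det Y_{[i,i+n-j]}^{[j,n]}$ for $1\le i\le j\le n$; - $f_{kl}=\det\big[X^{[n-k+1,n]}\ \ Y^{[n-l+1,n]}\big]_{[n-k-l+1,n]}$ for $k,l\ge1$, $k+l\le n-1$; - $\varphi_{kl}=s_{kl}(\det X)^{n-k-l+1}\det\big[(U^0)^{[n-k+1,n]}\ \ U^{[n-l+1,n]}\ \ (U^2)^{[n]}\ \cdots\ (U^{n-k-l+1})^{[n]}\big]$ for $k,l\ge1$, $k+l\le n$. Here $(U^m)^{[n]}$ is the last column of $U^m$, and the sign $s_{kl}$ is as follows. For $n$ even it is $1$ if $n-k-l$ is even and $(-1)^{l+1}$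 if $n-k-l$ is odd. For $n$ odd it is $1,\ (-1)^l,\ -1,\ (-1)^{l+1}$ if $n-k-l\equiv 0,1,2,3 \pmod 4$ respectively. Finally, define $c_0,\dots,c_n$ by $\det(X+\lambda Y)=\sum_{i=0}^n\lambda^is_ic_i$, where $s_i=(-1)^i$ for $n$ even and $s_i=1$ for $n$ odd. **Theorem.** There are $2n^2-n+1$ functions $g_{ij},h_{ij},f_{kl},\varphi_{kl}$ in this list, and the family $$F_n=\{g_{ij},h_{ij},f_{kl},\varphi_{kl},c_1,\dots,c_{n-1}\}$$ is a log-canonical coordinate system on $D(GL_n)$ with respect to $\{\cdot,\cdot\}_D$, with $c_1,\dots,c_{n-1}$ Casimirs. That is: 1. the members of $F_n$ are algebraically independent over $\mathbb C$ and generate the field $\mathbb C(D(GL_n))$ over $\mathbb C$; 2. for all $a,b\in F_n$ there is a constant $\omega_{ab}\in\frac12\mathbb Z$ such that $\{a,b\}_D=\omega_{ab}\,ab$; 3. $\{c_i,f\}_D=0$ for every $f\in\mathbb C(D(GL_n))$ and $1\le i\le n-1$. -/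

import Mathlib

noncomputable section

namespace DrinfeldDouble

/-! ### The `r`-matrix data on `gl_n` and on its double `gl_n ⊕ gl_n` -/

/-- Projection of `gl_n` onto the span of the positive root vectors (strictly upper
triangular part). -/
def projPos {n : ℕ} {k : Type*} [Field k] (ξ : Matrix (Fin n) (Fin n) k) :
    Matrix (Fin n) (Fin n) k :=
  Matrix.of fun i j => if i < j then ξ i j else 0

/-- Projection of `gl_n` onto the span of the negative root vectors (strictly lower
triangular part). -/
def projNeg {n : ℕ} {k : Type*} [Field k] (ξ : Matrix (Fin n) (Fin n) k) :
    Matrix (Fin n) (Fin n) k :=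
  Matrix.of fun i j => if j < i then ξ i j else 0

/-- `R = π_{>0} - π_{<0}`. -/
def opR {n : ℕ} {k : Type*} [Field k] (ξ : Matrix (Fin n) (Fin n) k) :
    Matrix (Fin n) (Fin n) k :=
  projPos ξ - projNeg ξ

/-- `R_+ = (R + Id) / 2`. -/
def opRPlus {n : ℕ} {k : Type*} [Field k] (ξ : Matrix (Fin n) (Fin n) k) :
    Matrix (Fin n) (Fin n) k :=
  (2⁻¹ : k) • (opR ξ + ξ)

/-- `R_- = (R - Id) / 2`. -/
def opRMinus {n : ℕ} {k : Type*} [Field k] (ξ : Matrix (Fin n) (Fin n) k) :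
    Matrix (Fin n) (Fin n) k :=
  (2⁻¹ : k) • (opR ξ - ξ)

/-- The underlying space of `D(gl_n) = gl_n ⊕ gl_n` (scalars extended to `k`). -/
abbrev Dbl (n : ℕ) (k : Type*) : Type _ := Matrix (Fin n) (Fin n) k × Matrix (Fin n) (Fin n) k

/-- The form `⟪(ξ,η),(ξ',η')⟫ = ⟨ξ,ξ'⟩ - ⟨η,η'⟩` on the double, where `⟨ξ,ξ'⟩ = tr (ξ ξ')`. -/
def dblForm {n : ℕ} {k : Type*} [Field k] (z w : Dbl n k) : k :=
  (z.1 * w.1).trace - (z.2 * w.2).trace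

/-- `d_+ = {(ξ,ξ)}`. -/
def dPlus (n : ℕ) (k : Type*) [Field k] : Set (Dbl n k) := Set.range fun ξ => (ξ, ξ)

/-- `d_- = {(R_+ ξ, R_- ξ)}`. -/
def dMinus (n : ℕ) (k : Type*) [Field k] : Set (Dbl n k) :=
  Set.range fun ξ => (opRPlus ξ, opRMinus ξ)

/-- The projection of the double onto `d_-` along `d_+`
(see `eq_projDPlus_and_eq_projDMinus`). -/
def projDMinus {n : ℕ} {k : Type*} [Field k] (z : Dbl n k) : Dbl n k :=
  (opRPlus (z.1 - z.2), opRMinus (z.1 - z.2))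

/-- The projection of the double onto `d_+` along `d_-`
(see `eq_projDPlus_and_eq_projDMinus`). -/
def projDPlus {n : ℕ} {k : Type*} [Field k] (z : Dbl n k) : Dbl n k :=
  (z.1 - opRPlus (z.1 - z.2), z.1 - opRPlus (z.1 - z.2))

/-- `R_D = π_{d_+} - π_{d_-}`. -/
def opRD {n : ℕ} {k : Type*} [Field k] (z : Dbl n k) : Dbl n k :=
  projDPlus z - projDMinus z

theorem opRPlus_sub_opRMinus {n : ℕ} {k : Type*} [Field k] [CharZero k]
    (ξ : Matrix (Fin n) (Fin n) k) : opRPlus ξ - opRMinus ξ = ξ := by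
  have h : (opR ξ + ξ) - (opR ξ - ξ) = (2 : k) • ξ := by rw [two_smul]; abel
  rw [opRPlus, opRMinus, ← smul_sub, h, smul_smul, inv_mul_cancel₀ two_ne_zero, one_smul]

theorem projDPlus_mem {n : ℕ} {k : Type*} [Field k] (z : Dbl n k) :
    projDPlus z ∈ dPlus n k := ⟨_, rfl⟩

theorem projDMinus_mem {n : ℕ} {k : Type*} [Field k] (z : Dbl n k) :
    projDMinus z ∈ dMinus n k := ⟨_, rfl⟩

theorem projDPlus_add_projDMinus {n : ℕ} {k : Type*} [Field k] [CharZero k] (z : Dbl n k) :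
    projDPlus z + projDMinus z = z := by
  have h := opRPlus_sub_opRMinus (z.1 - z.2)
  refine Prod.ext (by simp [projDPlus, projDMinus]) ?_
  have h' : opRPlus (z.1 - z.2) = (z.1 - z.2) + opRMinus (z.1 - z.2) := by
    rw [← sub_eq_iff_eq_add]; exact h
  simp only [projDPlus, projDMinus, Prod.snd_add]
  rw [h']; abel

/-- `projDPlus` and `projDMinus` are the components of the (unique) decomposition
of an element of the double along `d_+ ⊕ d_-`. -/
theorem eq_projDPlus_and_eq_projDMinus {n : ℕ} {k : Type*} [Field k] [CharZero k]
    {a b : Dbl n k} (ha : a ∈ dPlus n k) (hb : b ∈ dMinus n k) :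
    a = projDPlus (a + b) ∧ b = projDMinus (a + b) := by
  obtain ⟨ξ, rfl⟩ := ha
  obtain ⟨η, rfl⟩ := hb
  have h : ξ + opRPlus η - (ξ + opRMinus η) = η := by
    rw [add_sub_add_left_eq_sub, opRPlus_sub_opRMinus]
  constructor <;> simp [projDPlus, projDMinus, h]

/-! ### Rational functions on `D(GL_n) = GL_n × GL_n` and the Poisson bracket -/

/-- The matrix entries of a point `(X, Y)`: `inl (i, j)` is `x_{ij}` and `inr (i, j)` is `y_{ij}`. -/
abbrev Coord (n : ℕ) : Type := (Fin n × Fin n) ⊕ (Fin n × Fin n)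

/-- The polynomial functions in the entries of `X` and `Y`. -/
abbrev PolyFun (n : ℕ) : Type := MvPolynomial (Coord n) ℂ

/-- The field `ℂ(D(GL_n))` of rational functions on `GL_n × GL_n`, a Zariski open subset of the
affine space of pairs of matrices. -/
abbrev RatFun (n : ℕ) : Type := FractionRing (PolyFun n)

/-- A matrix entry, as a rational function. -/
def coordFun {n : ℕ} (v : Coord n) : RatFun n :=
  algebraMap (PolyFun n) (RatFun n) (MvPolynomial.X v)

/-- The matrix `X` of coordinate functions. -/
def genX (n : ℕ) : Matrix (Fin n) (Fin n) (RatFun n) := Matrix.of fun i j => coordFun (.inl (i, j))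

/-- The matrix `Y` of coordinate functions. -/
def genY (n : ℕ) : Matrix (Fin n) (Fin n) (RatFun n) := Matrix.of fun i j => coordFun (.inr (i, j))

open Classical in
open scoped TensorProduct in
/-- The partial derivative of rational functions with respect to the matrix entry `v`: the unique
extension of the partial derivative of polynomials to a derivation of the fraction field
(through `Ω[ℂ(V)⁄ℂ] = ℂ(V) ⊗ Ω[ℂ[V]⁄ℂ]`; see `partialD_algebraMap`). -/
def partialD {n : ℕ} (v : Coord n) : Derivation ℂ (RatFun n) (RatFun n) :=
  haveI : Algebra.FormallyEtale (PolyFun n) (RatFun n) :=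
    Algebra.FormallyEtale.of_isLocalization (nonZeroDivisors (PolyFun n))
  LinearMap.compDer
    (((MvPolynomial.mkDerivation ℂ (Pi.single v (1 : RatFun n)) :
          Derivation ℂ (PolyFun n) (RatFun n)).liftKaehlerDifferential.liftBaseChange (RatFun n)).comp
      (KaehlerDifferential.tensorKaehlerEquivOfFormallyEtale ℂ (PolyFun n)
        (RatFun n)).symm.toLinearMap)
    (KaehlerDifferential.D ℂ (RatFun n))

theorem partialD_algebraMap {n : ℕ} (v : Coord n) (p : PolyFun n) :
    partialD v (algebraMap (PolyFun n) (RatFun n) p) =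
      algebraMap (PolyFun n) (RatFun n) (MvPolynomial.pderiv v p) := by
  have : Algebra.FormallyEtale (PolyFun n) (RatFun n) :=
    Algebra.FormallyEtale.of_isLocalization (nonZeroDivisors (PolyFun n))
  have h : (partialD v).compAlgebraMap (PolyFun n) =
      (Algebra.linearMap (PolyFun n) (RatFun n)).compDer (MvPolynomial.pderiv v) := by
    refine MvPolynomial.derivation_ext fun w => ?_
    by_cases hw : w = v
    · subst hw
      simp [partialD, KaehlerDifferential.tensorKaehlerEquivOfFormallyEtale_symm_D_algebraMap,
        MvPolynomial.mkDerivation_X]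
    · simp [partialD, KaehlerDifferential.tensorKaehlerEquivOfFormallyEtale_symm_D_algebraMap,
        MvPolynomial.mkDerivation_X, MvPolynomial.pderiv_X_of_ne hw, Pi.single_eq_of_ne hw]
  exact Derivation.congr_fun h p

/-- The matrix `∇_X f`, with `(i,j)` entry `∂f/∂x_{ji}`. -/
def nablaX {n : ℕ} (f : RatFun n) : Matrix (Fin n) (Fin n) (RatFun n) :=
  Matrix.of fun i j => partialD (.inl (j, i)) f

/-- The matrix `∇_Y f`, with `(i,j)` entry `∂f/∂y_{ji}`. -/
def nablaY {n : ℕ} (f : RatFun n) : Matrix (Fin n) (Fin n) (RatFun n) :=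
  Matrix.of fun i j => partialD (.inr (j, i)) f

/-- The differential of `f` at `(X, Y)` in the direction `(A, B)`. -/
def diffAlong {n : ℕ} (f : RatFun n) (z : Dbl n (RatFun n)) : RatFun n :=
  ∑ i, ∑ j, (partialD (.inl (i, j)) f * z.1 i j + partialD (.inr (i, j)) f * z.2 i j)

/-- The left gradient with respect to `dblForm`:
`⟪∇^L f, (ξ,η)⟫ = d/dt f (X exp (tξ), Y exp (tη))` at `t = 0` (see `dblForm_gradL`). -/
def gradL {n : ℕ} (f : RatFun n) : Dbl n (RatFun n) :=
  (nablaX f * genX n, -(nablaY f * genY n))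

/-- The right gradient with respect to `dblForm`:
`⟪∇^R f, (ξ,η)⟫ = d/dt f (exp (tξ) X, exp (tη) Y)` at `t = 0` (see `dblForm_gradR`). -/
def gradR {n : ℕ} (f : RatFun n) : Dbl n (RatFun n) :=
  (genX n * nablaX f, -(genY n * nablaY f))

theorem diffAlong_eq_trace {n : ℕ} (f : RatFun n) (z : Dbl n (RatFun n)) :
    diffAlong f z = (nablaX f * z.1).trace + (nablaY f * z.2).trace := by
  simp only [diffAlong, Matrix.trace, Matrix.diag, Matrix.mul_apply, nablaX, nablaY, Matrix.of_apply,
    Finset.sum_add_distrib]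
  congr 1 <;> exact Finset.sum_comm

theorem dblForm_gradL {n : ℕ} (f : RatFun n) (z : Dbl n (RatFun n)) :
    dblForm (gradL f) z = diffAlong f (genX n * z.1, genY n * z.2) := by
  simp [diffAlong_eq_trace, dblForm, gradL, Matrix.mul_assoc]

theorem dblForm_gradR {n : ℕ} (f : RatFun n) (z : Dbl n (RatFun n)) :
    dblForm (gradR f) z = diffAlong f (z.1 * genX n, z.2 * genY n) := by
  simp only [diffAlong_eq_trace, dblForm, gradR, Matrix.neg_mul, Matrix.trace_neg, sub_neg_eq_add]
  congr 1 <;> rw [Matrix.mul_assoc, Matrix.trace_mul_comm, Matrix.mul_assoc]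

/-- The Poisson–Lie bracket on `D(GL_n)`,
`{f₁,f₂}_D = (⟪R_D (∇^L f₁), ∇^L f₂⟫ - ⟪R_D (∇^R f₁), ∇^R f₂⟫) / 2`. -/
def bracketD {n : ℕ} (f₁ f₂ : RatFun n) : RatFun n :=
  2⁻¹ * (dblForm (opRD (gradL f₁)) (gradL f₂) - dblForm (opRD (gradR f₁)) (gradR f₂))

/-! ### The functions `g_{ij}`, `h_{ij}`, `f_{kl}`, `φ_{kl}`, `c_i`

Elements of `Fin n` are numbered from `0`, so the row or column with number `m` in `1, …, n` has
index `m - 1`. -/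

/-- `g_{ij} = det X_{[i,n]}^{[j,j+n-i]}` for `j ≤ i`. -/
def funG {n : ℕ} {k : Type*} [Field k] (X : Matrix (Fin n) (Fin n) k)
    (i j : Fin n) (hij : j ≤ i) : k :=
  (Matrix.of fun a b : Fin (n - i) =>
    X ⟨i + a, by omega⟩ ⟨j + b, by have := Fin.le_def.mp hij; omega⟩).det

/-- `h_{ij} = det Y_{[i,i+n-j]}^{[j,n]}` for `i ≤ j`. -/
def funH {n : ℕ} {k : Type*} [Field k] (Y : Matrix (Fin n) (Fin n) k)
    (i j : Fin n) (hij : i ≤ j) : k :=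
  (Matrix.of fun a b : Fin (n - j) =>
    Y ⟨i + a, by have := Fin.le_def.mp hij; omega⟩ ⟨j + b, by omega⟩).det

/-- `f_{kl} = det [X^{[n-k+1,n]} Y^{[n-l+1,n]}]_{[n-k-l+1,n]}`, for `k + l ≤ n - 1`. -/
def funF {n : ℕ} {k : Type*} [Field k] (X Y : Matrix (Fin n) (Fin n) k)
    (p q : ℕ) (hpq : p + q < n) : k :=
  (Matrix.of fun a b : Fin (p + q) =>
    if h : (b : ℕ) < p then X ⟨n - p - q + a, by omega⟩ ⟨n - p + b, by omega⟩
    else Y ⟨n - p - q + a, by omega⟩ ⟨n - q + (b - p), by omega⟩).det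

/-- The matrix `Φ_{kl} = [(U^0)^{[n-k+1,n]} U^{[n-l+1,n]} (U^2)^{[n]} … (U^{n-k-l+1})^{[n]}]`,
for `k, l ≥ 1` and `k + l ≤ n`. -/
def matPhi {n : ℕ} {k : Type*} [Field k] (U : Matrix (Fin n) (Fin n) k)
    (p q : ℕ) (hpq : p + q ≤ n) : Matrix (Fin n) (Fin n) k :=
  Matrix.of fun a b : Fin n =>
    if h₁ : (b : ℕ) < p then (1 : Matrix (Fin n) (Fin n) k) a ⟨n - p + b, by omega⟩
    else if h₂ : (b : ℕ) < p + q then U a ⟨n - q + (b - p), by omega⟩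
    else (U ^ (b - (p + q) + 2)) a ⟨n - 1, by omega⟩

/-- The sign `s_{kl}`. It is determined by `n - k - l` modulo `4` and by the parity of `l`. -/
def signS (n k l : ℕ) : ℤ :=
  if Even n then
    if Even (n - k - l) then 1 else (-1) ^ (l + 1)
  else
    if (n - k - l) % 4 = 0 then 1
    else if (n - k - l) % 4 = 1 then (-1) ^ l
    else if (n - k - l) % 4 = 2 then -1
    else (-1) ^ (l + 1)

/-- `φ_{kl} = s_{kl} (det X)^{n-k-l+1} det Φ_{kl}` with `U = X⁻¹ Y`. -/
def funPhi {n : ℕ} {k : Type*} [Field k] (X Y : Matrix (Fin n) (Fin n) k)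
    (p q : ℕ) (hpq : p + q ≤ n) : k :=
  (signS n p q : k) * X.det ^ (n - p - q + 1) * (matPhi (X⁻¹ * Y) p q hpq).det

/-- `c_i`, defined by `det (X + λ Y) = ∑ i, λ^i s_i c_i`, where `s_i = (-1)^i` for `n` even
and `s_i = 1` for `n` odd (so that `s_i⁻¹ = s_i`). -/
def funC {n : ℕ} {k : Type*} [Field k] (X Y : Matrix (Fin n) (Fin n) k) (i : ℕ) : k :=
  (if Even n then (-1) ^ i else 1) *
    (X.map Polynomial.C + (Polynomial.X : Polynomial k) • Y.map Polynomial.C).det.coeff i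

/-- Labels of the functions `g_{ij}`, `h_{ij}`, `f_{kl}`, `φ_{kl}`. -/
inductive MainIndex (n : ℕ) : Type
  | g (i j : Fin n) (hij : j ≤ i) : MainIndex n
  | h (i j : Fin n) (hij : i ≤ j) : MainIndex n
  | f (k l : ℕ) (hk : 1 ≤ k) (hl : 1 ≤ l) (hkl : k + l < n) : MainIndex n
  | φ (k l : ℕ) (hk : 1 ≤ k) (hl : 1 ≤ l) (hkl : k + l ≤ n) : MainIndex n

/-- Labels of the functions `c_1, …, c_{n-1}`. -/
abbrev CasimirIndex (n : ℕ) : Type := {i : ℕ // 1 ≤ i ∧ i < n}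

/-- The functions `g_{ij}`, `h_{ij}`, `f_{kl}`, `φ_{kl}` on `D(GL_n)`. -/
def mainFun {n : ℕ} : MainIndex n → RatFun n
  | .g i j hij => funG (genX n) i j hij
  | .h i j hij => funH (genY n) i j hij
  | .f k l _ _ hkl => funF (genX n) (genY n) k l hkl
  | .φ k l _ _ hkl => funPhi (genX n) (genY n) k l hkl

/-- The functions `c_i` on `D(GL_n)`. -/
def casimirFun {n : ℕ} (i : ℕ) : RatFun n := funC (genX n) (genY n) i

/-- The family `F_n = {g_{ij}, h_{ij}, f_{kl}, φ_{kl}, c_1, …, c_{n-1}}`. -/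
def familyF (n : ℕ) : MainIndex n ⊕ CasimirIndex n → RatFun n :=
  Sum.elim mainFun fun i => casimirFun i.1

/-- A (birational) coordinate system on `D(GL_n)`: a family of algebraically independent rational
functions that generates the field of rational functions. -/
def IsCoordinateSystem {n : ℕ} {ι : Type*} (F : ι → RatFun n) : Prop :=
  AlgebraicIndependent ℂ F ∧ IntermediateField.adjoin ℂ (Set.range F) = ⊤

/-- `{F_a, F_b}_D = (ω_{ab} / 2) F_a F_b` for integers `ω_{ab}`. -/
def IsLogCanonical {n : ℕ} {ι : Type*} (F : ι → RatFun n) : Prop :=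
  ∃ ω : ι → ι → ℤ, ∀ a b, bracketD (F a) (F b) = (ω a b : RatFun n) / 2 * (F a * F b)

/-- A Casimir function: it Poisson commutes with every function. -/
def IsCasimir {n : ℕ} (c : RatFun n) : Prop := ∀ f : RatFun n, bracketD c f = 0

end DrinfeldDouble

end

/-!
The bracket only involves the gradients of its two arguments: if `A = ∇_X f` and `B = ∇_Y f`, it is
a combination of the pairing `⟨R_+ ξ, η⟩` on the right gradients `X A + Y B`, the same pairing on
the left gradients `A X + B Y`, and a cross term (`bracketD_eq_bracketForm`). By Jacobi's formula
the logarithmic gradients of the functions in the family are explicit. For the minors `g`, `h`, `f`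
and for `φ` the left gradient is lower triangular, or the function depends on `X` only; the right
gradient is upper triangular, or the function depends on `Y` only; the diagonal entries are
integers. The pairing with such a matrix only sees the diagonals, so that it is a half-integer; for
two `g` or two `h` this follows from the idempotent shape of the gradients
(`IsRowProj.rPlusForm_mem`). There remain the cross terms: for two minors they reduce to traces of
products of triangular matrices (`IsMinorGrad.trace_mem`), and for the `φ`, whose right gradient is
scalar, to the trace of `[∇₁, U] ∇₂ U`, with `∇` the logarithmic gradient in `U = X⁻¹ Y`. That trace
is an integer because the columns of the Krylov matrix `Φ_{kl}` are dual to the rows of its inverse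
(`trace_commutator_mul_mem`). The gradients of the coefficients of `det (X + λ Y)` are coefficients
of the adjugate of `X + λ Y`, so that both gradients of `c_i` are the same scalar matrix, which
makes the bracket with anything vanish (`isCasimir_casimirFun`).

For the generation of the field, let `K` be the subfield generated by the family. Let `R` be the
unipotent lower triangular matrix with `Y R` upper triangular. The `h_{ij}` and `f_{kl}` do not
change if `Y` is replaced by `Y R`, and expanding minors along their first rows yields the entries
of `Y R` and then those of `X` in `K`, one at a time, from the last row to the first and from right
to left (`mul_lowerUni_mem`, `genX_mem`). Let `Q = [U eₙ, U² eₙ, …, Uⁿ eₙ]`. Its companion matrix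
`C`, with `U Q = Q C`, is known from the Casimir functions. Write `H = Q T` with `H` unipotent lower
and `T` upper triangular. In the basis `Q`, the functions `φ_{kl}` become minors built from the last
columns of `T` and of `T` moved by one row (`det_matPhi`, `det_phiReduced`), and the same method
puts `T` in `K` (`triangularFactor_mem`). Now `U H = H W` with `W = T⁻¹ C T` over `K`, and so is `V
= U R`, being `X⁻¹ (Y R)`, so that `P = R⁻¹ H` and `H` solve the linear system `V P = H W` over `K`
in unipotent lower triangular matrices. Its solution is unique because `U` is generic: conjugation
by `U` is, up to triangular factors, conjugation by the longest permutation (`strictLower_eq_zero`).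
Hence `P`, `H` and `Y = (Y R) P H⁻¹` are over `K` (`lowerUni_mem_of_mul_eq`). The minors by which
one divides are nonzero because they are so at suitable matrices with entries `0` and `1`
(`exists_specialization`).

The family has `2 n²` members, as many as there are coordinates, so that a generating family is a
transcendence basis (`algebraicIndependent_familyF`).
-/

namespace DrinfeldDouble

open Matrix

/-! ### Derivations and determinants -/

theorem derivation_prod {R A ι : Type*} [CommRing R] [CommRing A] [Algebra R A] [DecidableEq ι]
    (D : Derivation R A A) (s : Finset ι) (f : ι → A) :
    D (∏ i ∈ s, f i) = ∑ i ∈ s, (∏ j ∈ s.erase i, f j) * D (f i) := by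
  induction s using Finset.induction_on with
  | empty => simp
  | insert a s ha ih =>
    rw [Finset.prod_insert ha, D.leibniz, ih, Finset.sum_insert ha, Finset.erase_insert ha,
      add_comm, smul_eq_mul, smul_eq_mul, Finset.mul_sum]
    refine congrArg₂ _ rfl (Finset.sum_congr rfl fun i hi => ?_)
    have hia : a ≠ i := fun h => ha (h ▸ hi)
    rw [Finset.erase_insert_of_ne hia, Finset.prod_insert (by simp [ha]), mul_assoc]

/-- Jacobi's formula for the derivative of a determinant. -/
theorem derivation_det {R A m : Type*} [CommRing R] [CommRing A] [Algebra R A] [Fintype m]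
    [DecidableEq m] (D : Derivation R A A) (M : Matrix m m A) :
    D M.det = (M.adjugate * M.map D).trace := by
  have h : ∀ i, (M.adjugate * M.map D) i i = (M.updateCol i fun a => D (M a i)).det := by
    intro i
    rw [← cramer_apply, cramer_eq_adjugate_mulVec]
    rfl
  simp only [trace, diag, h, det_apply', map_sum]
  rw [Finset.sum_comm]
  refine Finset.sum_congr rfl fun σ _ => ?_
  rw [← zsmul_eq_mul, D.map_smul_of_tower, derivation_prod, zsmul_eq_mul, Finset.mul_sum]
  refine Finset.sum_congr rfl fun i _ => congrArg _ ?_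
  rw [← Finset.prod_erase_mul _ _ (Finset.mem_univ i), updateCol_self]
  refine congrArg₂ _ (Finset.prod_congr rfl fun j hj => ?_) rfl
  rw [updateCol_ne (Finset.ne_of_mem_erase hj)]

theorem map_derivation_mul {R A l m n : Type*} [CommRing R] [CommRing A] [Algebra R A] [Fintype m]
    (D : Derivation R A A) (M : Matrix l m A) (N : Matrix m n A) :
    (M * N).map D = M.map D * N + M * N.map D := by
  ext i j
  simp only [map_apply, mul_apply, Matrix.add_apply, map_sum, D.leibniz, smul_eq_mul,
    ← Finset.sum_add_distrib]
  exact Finset.sum_congr rfl fun x _ => by ring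

theorem derivation_det_of_field {R k m : Type*} [CommRing R] [Field k] [Algebra R k] [Fintype m]
    [DecidableEq m] (D : Derivation R k k) (M : Matrix m m k) (hM : M.det ≠ 0) :
    D M.det = M.det * (M⁻¹ * M.map D).trace := by
  rw [derivation_det, inv_def, smul_mul_assoc, trace_smul, smul_eq_mul, Ring.inverse_eq_inv',
    mul_inv_cancel_left₀ hM]

/-! ### The bracket in terms of gradients -/

/-- The pairing `⟨R_+ ξ, η⟩`. -/
def rPlusForm {n : ℕ} {k : Type*} [Field k] (ξ η : Matrix (Fin n) (Fin n) k) : k :=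
  (opRPlus ξ * η).trace

/-- The value of the Poisson–Lie bracket at `(X, Y)` on two functions whose gradients
`(∇_X, ∇_Y)` are `(A₁, B₁)` and `(A₂, B₂)`. -/
def bracketForm {n : ℕ} {k : Type*} [Field k] (X Y A₁ B₁ A₂ B₂ : Matrix (Fin n) (Fin n) k) : k :=
  rPlusForm (X * A₁ + Y * B₁) (X * A₂ + Y * B₂) - rPlusForm (A₁ * X + B₁ * Y) (A₂ * X + B₂ * Y)
    + (A₁ * X * (B₂ * Y)).trace - (X * A₁ * (Y * B₂)).trace

section
variable {n : ℕ} {k : Type*} [Field k]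

theorem opRMinus_eq (ξ : Matrix (Fin n) (Fin n) k) [CharZero k] :
    opRMinus ξ = opRPlus ξ - ξ :=
  eq_sub_of_add_eq' (sub_eq_iff_eq_add.1 (opRPlus_sub_opRMinus ξ)).symm

theorem dblForm_opRD (a b a' b' : Matrix (Fin n) (Fin n) k) [CharZero k] :
    dblForm (opRD (a, -b)) (a', -b') =
      (a * a').trace + (b * b').trace + 2 * (a * b').trace - 2 * rPlusForm (a + b) (a' + b') := by
  simp only [dblForm, opRD, projDPlus, projDMinus, opRMinus_eq, sub_neg_eq_add, Prod.fst_sub,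
    Prod.snd_sub, rPlusForm, sub_mul, mul_neg, trace_neg, trace_sub, mul_add, trace_add, add_mul]
  ring

end

theorem bracketD_eq_bracketForm {n : ℕ} (f g : RatFun n) :
    bracketD f g =
      bracketForm (genX n) (genY n) (nablaX f) (nablaY f) (nablaX g) (nablaY g) := by
  have h₁ : (nablaX f * genX n * (nablaX g * genX n)).trace =
      (genX n * nablaX f * (genX n * nablaX g)).trace := by
    rw [Matrix.mul_assoc (genX n), trace_mul_comm (genX n)]; simp only [Matrix.mul_assoc]
  have h₂ : (nablaY f * genY n * (nablaY g * genY n)).trace =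
      (genY n * nablaY f * (genY n * nablaY g)).trace := by
    rw [Matrix.mul_assoc (genY n), trace_mul_comm (genY n)]; simp only [Matrix.mul_assoc]
  rw [bracketD, gradL, gradL, gradR, gradR, dblForm_opRD, dblForm_opRD, bracketForm, h₁, h₂]
  ring

/-- `(A, B)` is the gradient `(∇_X f, ∇_Y f)`: every derivation `D` satisfies
`D f = tr (A D(X)) + tr (B D(Y))`. -/
def HasGrad {n : ℕ} (f : RatFun n) (A B : Matrix (Fin n) (Fin n) (RatFun n)) : Prop :=
  ∀ D : Derivation ℂ (RatFun n) (RatFun n),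
    D f = (A * (genX n).map D).trace + (B * (genY n).map D).trace

theorem partialD_coordFun {n : ℕ} (v w : Coord n) [Decidable (w = v)] :
    partialD v (coordFun w) = if w = v then 1 else 0 := by
  rw [coordFun, partialD_algebraMap]
  split_ifs with h
  · subst h; simp
  · rw [MvPolynomial.pderiv_X_of_ne h, map_zero]

section
variable {n : ℕ} {f g : RatFun n} {A B A' B' : Matrix (Fin n) (Fin n) (RatFun n)}

theorem HasGrad.nablaX_eq (h : HasGrad f A B) : nablaX f = A := by
  classical
  ext i j
  rw [nablaX, of_apply, h]
  simp [trace, mul_apply, genX, genY, partialD_coordFun, ite_and]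

theorem HasGrad.nablaY_eq (h : HasGrad f A B) : nablaY f = B := by
  classical
  ext i j
  rw [nablaY, of_apply, h]
  simp [trace, mul_apply, genX, genY, partialD_coordFun, ite_and]

/-- The bracket of two functions in terms of logarithmic gradients. -/
theorem HasGrad.bracketD_eq (hf : HasGrad f (f • A) (f • B)) (hg : HasGrad g (g • A') (g • B')) :
    bracketD f g = bracketForm (genX n) (genY n) A B A' B' * (f * g) := by
  have hR : ∀ (c : RatFun n) (ξ : Matrix (Fin n) (Fin n) (RatFun n)),
      opRPlus (c • ξ) = c • opRPlus ξ := by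
    intro c ξ
    ext i j
    simp only [opRPlus, opR, projPos, projNeg, Matrix.smul_apply, Matrix.add_apply,
      Matrix.sub_apply, of_apply, smul_eq_mul]
    split_ifs <;> ring
  rw [bracketD_eq_bracketForm, hf.nablaX_eq, hf.nablaY_eq, hg.nablaX_eq, hg.nablaY_eq]
  simp only [bracketForm, rPlusForm, smul_mul_assoc, mul_smul_comm, ← smul_add, hR, trace_smul,
    smul_eq_mul]
  ring

end

/-! ### Triangular matrices and the pairing `⟨R_+ ξ, η⟩` -/

/-- The image of `ℤ` in a field. -/
def intSubring (k : Type*) [Field k] : Subring k := (Int.castRingHom k).range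

/-- The additive subgroup `½ ℤ` of a field. -/
def halfInts (k : Type*) [Field k] : AddSubgroup k := AddSubgroup.zmultiples 2⁻¹

/-- Lower triangular matrices with integers on the diagonal. -/
def LowInt {n : ℕ} {k : Type*} [Field k] (ξ : Matrix (Fin n) (Fin n) k) : Prop :=
  (∀ i j, i < j → ξ i j = 0) ∧ ∀ i, ξ i i ∈ intSubring k

/-- Upper triangular matrices with integers on the diagonal. -/
def UpInt {n : ℕ} {k : Type*} [Field k] (ξ : Matrix (Fin n) (Fin n) k) : Prop :=
  (∀ i j, j < i → ξ i j = 0) ∧ ∀ i, ξ i i ∈ intSubring k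

section
variable {n : ℕ} {k : Type*} [Field k]

theorem LowInt.trace_mem {ξ : Matrix (Fin n) (Fin n) k} (h : LowInt ξ) :
    ξ.trace ∈ intSubring k := sum_mem fun i _ => h.2 i

theorem LowInt.trace_mul_mem {ξ η : Matrix (Fin n) (Fin n) k} (hξ : LowInt ξ) (hη : LowInt η) :
    (ξ * η).trace ∈ intSubring k := by
  simp only [trace, diag, mul_apply]
  refine sum_mem fun i _ => sum_mem fun j _ => ?_
  rcases lt_trichotomy i j with h | rfl | h
  · simp [hξ.1 i j h]
  · exact mul_mem (hξ.2 _) (hη.2 _)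
  · simp [hη.1 j i h]

theorem LowInt.add {ξ η : Matrix (Fin n) (Fin n) k} (hξ : LowInt ξ) (hη : LowInt η) :
    LowInt (ξ + η) :=
  ⟨fun i j h => by simp [hξ.1 i j h, hη.1 i j h], fun i => add_mem (hξ.2 i) (hη.2 i)⟩

theorem half_mul_mem_halfInts {x : k} (hx : x ∈ intSubring k) : 2⁻¹ * x ∈ halfInts k := by
  obtain ⟨z, rfl⟩ := hx
  exact ⟨z, by simp [mul_comm]⟩

theorem trace_mul_mul_comm (X A A' : Matrix (Fin n) (Fin n) k) :
    (X * A * (X * A')).trace = (A * X * (A' * X)).trace := by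
  rw [Matrix.mul_assoc X, trace_mul_comm X]; simp only [Matrix.mul_assoc]

/-- When `X A' + Y B'` is a scalar matrix, the cross terms of the bracket reduce to a pairing of
left gradients. -/
theorem cross_terms_eq_of_scalar {X Y A A' B' : Matrix (Fin n) (Fin n) k} {e : k}
    (hR' : X * A' + Y * B' = e • 1) :
    (A * X * (B' * Y)).trace - (X * A * (Y * B')).trace =
      (A * X * (A' * X + B' * Y)).trace - e * (A * X).trace := by
  have h : Y * B' = e • 1 - X * A' := eq_sub_of_add_eq' hR'
  rw [h, mul_sub, mul_add, trace_sub, trace_add, trace_mul_mul_comm, mul_smul_comm, mul_one,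
    trace_smul, smul_eq_mul, trace_mul_comm X A]
  ring

variable [CharZero k]

theorem mem_halfInts_of_mem_intSubring {x : k} (hx : x ∈ intSubring k) : x ∈ halfInts k := by
  have h := half_mul_mem_halfInts (add_mem hx hx)
  rwa [← two_mul, inv_mul_cancel_left₀ two_ne_zero] at h

theorem rPlusForm_eq_sum (ξ η : Matrix (Fin n) (Fin n) k) :
    rPlusForm ξ η =
      ∑ i, ∑ j, (if i < j then ξ i j * η j i else if i = j then 2⁻¹ * (ξ i j * η j i) else 0) := by
  simp only [rPlusForm, trace, diag, mul_apply]
  refine Finset.sum_congr rfl fun i _ => Finset.sum_congr rfl fun j _ => ?_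
  simp only [opRPlus, opR, projPos, projNeg, Matrix.smul_apply, Matrix.add_apply,
    Matrix.sub_apply, of_apply, smul_eq_mul]
  rcases lt_trichotomy i j with h | rfl | h
  · rw [if_pos h, if_neg h.not_gt, if_pos h]; field_simp; ring
  · simp [mul_assoc]
  · rw [if_neg h.not_gt, if_pos h, if_neg h.not_gt, if_neg h.ne']; ring

theorem rPlusForm_add_swap (ξ η : Matrix (Fin n) (Fin n) k) :
    rPlusForm ξ η + rPlusForm η ξ = (ξ * η).trace := by
  have h : rPlusForm η ξ = ∑ i, ∑ j,
      (if j < i then η j i * ξ i j else if j = i then 2⁻¹ * (η j i * ξ i j) else 0) := by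
    rw [rPlusForm_eq_sum, Finset.sum_comm]
  rw [rPlusForm_eq_sum, h, ← Finset.sum_add_distrib]
  simp only [trace, diag, mul_apply]
  refine Finset.sum_congr rfl fun i _ => ?_
  rw [← Finset.sum_add_distrib]
  refine Finset.sum_congr rfl fun j _ => ?_
  rcases lt_trichotomy i j with h | rfl | h
  · rw [if_pos h, if_neg h.not_gt, if_neg h.ne', add_zero]
  · simp only [lt_irrefl, if_false, if_true]; field_simp; ring
  · rw [if_neg h.not_gt, if_neg h.ne', if_pos h, zero_add, mul_comm]

theorem rPlusForm_mem_halfInts {ξ η : Matrix (Fin n) (Fin n) k}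
    (h : ∀ i j, i < j → ξ i j * η j i = 0) (hξ : ∀ i, ξ i i ∈ intSubring k)
    (hη : ∀ i, η i i ∈ intSubring k) : rPlusForm ξ η ∈ halfInts k := by
  rw [rPlusForm_eq_sum]
  refine sum_mem fun i _ => sum_mem fun j _ => ?_
  split_ifs with h₁ h₂
  · rw [h i j h₁]; exact zero_mem _
  · subst h₂
    exact half_mul_mem_halfInts (mul_mem (hξ i) (hη i))
  · exact zero_mem _

theorem rPlusForm_mem_of_lowInt {ξ η : Matrix (Fin n) (Fin n) k} (hξ : LowInt ξ)
    (hη : ∀ i, η i i ∈ intSubring k) : rPlusForm ξ η ∈ halfInts k :=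
  rPlusForm_mem_halfInts (fun i j h => by rw [hξ.1 i j h, zero_mul]) hξ.2 hη

theorem rPlusForm_mem_of_upInt {ξ η : Matrix (Fin n) (Fin n) k} (hη : UpInt η)
    (hξ : ∀ i, ξ i i ∈ intSubring k) : rPlusForm ξ η ∈ halfInts k :=
  rPlusForm_mem_halfInts (fun i j h => by rw [hη.1 j i h, mul_zero]) hξ hη.2

/-! ### Brackets of functions with triangular gradients -/

variable {X Y A B A' B' : Matrix (Fin n) (Fin n) k}

theorem bracketForm_swap (X Y A B A' B' : Matrix (Fin n) (Fin n) k) :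
    bracketForm X Y A' B' A B = -bracketForm X Y A B A' B' := by
  have h₁ := rPlusForm_add_swap (X * A + Y * B) (X * A' + Y * B')
  have h₂ := rPlusForm_add_swap (A * X + B * Y) (A' * X + B' * Y)
  have h₃ := trace_mul_mul_comm X A A'
  have h₄ := trace_mul_mul_comm Y B B'
  have h₅ := trace_mul_comm (X * A') (Y * B)
  have h₆ := trace_mul_comm (A' * X) (B * Y)
  simp only [add_mul, mul_add, trace_add] at h₁ h₂
  simp only [bracketForm]
  linear_combination h₁ - h₂ + h₃ + h₄ - h₅ + h₆

/-- The cross terms of the bracket vanish when one function depends on `Y` only. -/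
theorem bracketForm_mem_of_depends_on_Y (hL : LowInt (B * Y))
    (hR : ∀ i, (Y * B) i i ∈ intSubring k) (hL' : ∀ i, (A' * X + B' * Y) i i ∈ intSubring k)
    (hR' : UpInt (X * A' + Y * B')) : bracketForm X Y 0 B A' B' ∈ halfInts k := by
  simp only [bracketForm, mul_zero, zero_mul, zero_add, trace_zero, add_zero, sub_zero]
  exact sub_mem (rPlusForm_mem_of_upInt hR' hR) (rPlusForm_mem_of_lowInt hL hL')

/-- The cross terms of the bracket vanish when one function depends on `X` only. -/
theorem bracketForm_mem_of_depends_on_X (hL : LowInt (A * X + B * Y))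
    (hR : UpInt (X * A + Y * B)) (hL' : ∀ i, (A' * X) i i ∈ intSubring k)
    (hR' : UpInt (X * A')) : bracketForm X Y A B A' 0 ∈ halfInts k := by
  simp only [bracketForm, mul_zero, zero_mul, trace_zero, add_zero, sub_zero]
  exact sub_mem (rPlusForm_mem_of_upInt hR' hR.2) (rPlusForm_mem_of_lowInt hL hL')

theorem bracketForm_mem_of_cross_terms (hL : LowInt (A * X + B * Y)) (hR : UpInt (X * A + Y * B))
    (hL' : LowInt (A' * X + B' * Y)) (hR' : UpInt (X * A' + Y * B'))
    (h : (A * X * (B' * Y)).trace - (X * A * (Y * B')).trace ∈ intSubring k) :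
    bracketForm X Y A B A' B' ∈ halfInts k := by
  rw [bracketForm, add_sub_assoc]
  exact add_mem (sub_mem (rPlusForm_mem_of_upInt hR' hR.2) (rPlusForm_mem_of_lowInt hL hL'.2))
    (mem_halfInts_of_mem_intSubring h)

end

/-! ### Gradients of minors built from columns of `X` and columns of `Y` -/

/-- The coordinate projection onto the indices satisfying `p`. -/
def coordProj {n : ℕ} (k : Type*) [Field k] (p : Fin n → Prop) [DecidablePred p] :
    Matrix (Fin n) (Fin n) k :=
  diagonal fun i => if p i then 1 else 0

/-- The matrix whose column `b` is the basis vector `c + b` if `q b` holds, and `0` otherwise. -/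
def selector (n : ℕ) {m : ℕ} (k : Type*) [Field k] (c : ℕ) (q : Fin m → Prop) [DecidablePred q] :
    Matrix (Fin n) (Fin m) k :=
  of fun i b => if q b ∧ (i : ℕ) = c + b then 1 else 0

section
variable {n m : ℕ} {k : Type*} [Field k]

theorem coordProj_mul_apply (p : Fin n → Prop) [DecidablePred p] (ξ : Matrix (Fin n) (Fin n) k)
    (i j : Fin n) : (coordProj k p * ξ) i j = if p i then ξ i j else 0 := by
  simp [coordProj, diagonal_mul]

theorem mul_coordProj_apply (p : Fin n → Prop) [DecidablePred p] (ξ : Matrix (Fin n) (Fin n) k)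
    (i j : Fin n) : (ξ * coordProj k p) i j = if p j then ξ i j else 0 := by
  simp [coordProj, mul_diagonal]

theorem coordProj_mul_of_imp {p q : Fin n → Prop} [DecidablePred p] [DecidablePred q]
    (h : ∀ i, p i → q i) : coordProj k p * coordProj k q = coordProj k p := by
  ext i j
  rw [mul_coordProj_apply]
  by_cases hij : i = j
  · subst hij
    by_cases hp : p i
    · rw [if_pos (h i hp)]
    · simp [coordProj, hp]
  · simp [coordProj, diagonal_apply_ne _ hij]

theorem selector_transpose_mul_self (c : ℕ) (q : Fin m → Prop) [DecidablePred q]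
    (h : ∀ b, q b → c + (b : ℕ) < n) :
    (selector n k c q)ᵀ * selector n k c q = diagonal fun b => if q b then 1 else 0 := by
  ext a b
  simp only [mul_apply, transpose_apply, selector, of_apply, mul_ite, mul_one, mul_zero]
  by_cases hab : a = b
  · subst hab
    rw [diagonal_apply_eq]
    by_cases hq : q a
    · rw [Finset.sum_eq_single ⟨c + a, h a hq⟩]
      · simp [hq]
      · intro i _ hi
        have : ¬ (i : ℕ) = c + a := fun h => hi (Fin.ext h)
        simp [this]
      · simp
    · simp [hq]
  · rw [diagonal_apply_ne _ hab]
    refine Finset.sum_eq_zero fun i _ => ?_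
    have := Fin.val_ne_of_ne hab
    split_ifs with h₁ h₂
    · omega
    · rfl
    · rfl

theorem selector_mul_transpose_self (c : ℕ) (q : Fin m → Prop) [DecidablePred q]
    (p : Fin n → Prop) [DecidablePred p]
    (h : ∀ i : Fin n, p i ↔ ∃ b, q b ∧ (i : ℕ) = c + b) :
    selector n k c q * (selector n k c q)ᵀ = coordProj k p := by
  ext i j
  simp only [mul_apply, transpose_apply, selector, of_apply, mul_ite, mul_one, mul_zero]
  by_cases hij : i = j
  · subst hij
    rw [coordProj, diagonal_apply_eq]
    by_cases hp : p i
    · obtain ⟨b, hb, hib⟩ := (h i).1 hp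
      rw [Finset.sum_eq_single b]
      · simp [hp, hb, hib]
      · intro b' _ hb'
        have := Fin.val_ne_of_ne hb'
        have : ¬ (i : ℕ) = c + b' := by omega
        simp [this]
      · simp
    · rw [if_neg hp]
      refine Finset.sum_eq_zero fun b _ => ?_
      have : ¬ (q b ∧ (i : ℕ) = c + b) := fun hb => hp ((h i).2 ⟨b, hb⟩)
      simp [this]
  · rw [coordProj, diagonal_apply_ne _ hij]
    refine Finset.sum_eq_zero fun b _ => ?_
    have := Fin.val_ne_of_ne hij
    split_ifs with h₁ h₂
    · omega
    · rfl
    · rfl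

theorem selector_mul_diagonal (c : ℕ) (q : Fin m → Prop) [DecidablePred q] (v : Fin m → k) :
    selector n k c q * diagonal v = of fun i b => selector n k c q i b * v b := by
  ext i b; simp [mul_diagonal]

theorem selector_map_derivation {R : Type*} [CommRing R] [Algebra R k] (D : Derivation R k k)
    (c : ℕ) (q : Fin m → Prop) [DecidablePred q] : (selector n k c q).map D = 0 := by
  ext i b
  simp only [map_apply, selector, of_apply]
  split_ifs <;> simp

theorem selector_mul_apply {m' : ℕ} (c : ℕ) (q : Fin m → Prop) [DecidablePred q]
    (Z : Matrix (Fin m') (Fin n) k) (a : Fin m') (b : Fin m) (h : q b → c + (b : ℕ) < n) :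
    (Z * selector n k c q) a b = if hq : q b then Z a ⟨c + b, h hq⟩ else 0 := by
  simp only [mul_apply, selector, of_apply, mul_ite, mul_one, mul_zero]
  split_ifs with hq
  · rw [Finset.sum_eq_single ⟨c + b, h hq⟩]
    · simp [hq]
    · intro i _ hi
      have : ¬ (i : ℕ) = c + b := fun h => hi (Fin.ext h)
      simp [this]
    · simp
  · simp [hq]

theorem selector_transpose_mul_apply {m' : ℕ} (c : ℕ) (q : Fin m → Prop) [DecidablePred q]
    (Z : Matrix (Fin n) (Fin m') k) (a : Fin m) (b : Fin m') (h : q a → c + (a : ℕ) < n) :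
    ((selector n k c q)ᵀ * Z) a b = if hq : q a then Z ⟨c + a, h hq⟩ b else 0 := by
  rw [← transpose_transpose Z, ← transpose_mul, transpose_apply, selector_mul_apply c q _ _ _ h]
  rfl

end

/-- The coordinate projection onto the indices `a, …, b - 1`. -/
abbrev intervalProj (n : ℕ) (k : Type*) [Field k] (a b : ℕ) : Matrix (Fin n) (Fin n) k :=
  coordProj k fun i => a ≤ i.1 ∧ i.1 < b

/-- The algebraic relations satisfied by the logarithmic gradient `(A, B)` of a minor with rows
`r, …, r' - 1`, columns `s₁, …, t₁ - 1` of `X` and columns `s₂, …, t₂ - 1` of `Y`. -/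
structure IsMinorGrad {n : ℕ} {k : Type*} [Field k] (X Y A B : Matrix (Fin n) (Fin n) k)
    (r r' s₁ t₁ s₂ t₂ : ℕ) : Prop where
  projX_mul : intervalProj n k s₁ t₁ * A = A
  projY_mul : intervalProj n k s₂ t₂ * B = B
  mulX_proj : A * intervalProj n k r r' = A
  mulY_proj : B * intervalProj n k r r' = B
  left_X : A * X * intervalProj n k s₁ t₁ = intervalProj n k s₁ t₁
  left_Y : B * Y * intervalProj n k s₂ t₂ = intervalProj n k s₂ t₂
  right : intervalProj n k r r' * (X * A + Y * B) = intervalProj n k r r'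

/-- The minor with rows `r, …, r + m - 1` whose first `p` columns are the columns
`c₁, …, c₁ + p - 1` of `X`, followed by the columns `c₂ + p, …, c₂ + m - 1` of `Y`. -/
def mixedMinor {n : ℕ} (m : ℕ) {k : Type*} [Field k] (X Y : Matrix (Fin n) (Fin n) k)
    (r c₁ c₂ p : ℕ) : Matrix (Fin m) (Fin m) k :=
  (selector n k r fun _ : Fin m => True)ᵀ *
    (X * selector n k c₁ (fun b : Fin m => (b : ℕ) < p) +
      Y * selector n k c₂ fun b : Fin m => p ≤ (b : ℕ))

/-- A nonzero mixed minor has a logarithmic gradient, with the relations of `IsMinorGrad`. -/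
theorem exists_isMinorGrad {n m : ℕ} {R k : Type*} [CommRing R] [Field k] [Algebra R k]
    (X Y : Matrix (Fin n) (Fin n) k) (r c₁ c₂ p : ℕ) (hr : r + m ≤ n) (hp : p ≤ m)
    (hc₁ : c₁ + p ≤ n) (hc₂ : p < m → c₂ + m ≤ n)
    (hf : (mixedMinor m X Y r c₁ c₂ p).det ≠ 0) :
    ∃ A B, (∀ D : Derivation R k k, D (mixedMinor m X Y r c₁ c₂ p).det =
        (mixedMinor m X Y r c₁ c₂ p).det * ((A * X.map D).trace + (B * Y.map D).trace)) ∧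
      IsMinorGrad X Y A B r (r + m) c₁ (c₁ + p) (c₂ + p) (c₂ + m) := by
  set M := mixedMinor m X Y r c₁ c₂ p with hM
  set S₁ : Matrix (Fin n) (Fin m) k := selector n k c₁ fun b : Fin m => (b : ℕ) < p with hS₁
  set S₂ : Matrix (Fin n) (Fin m) k := selector n k c₂ fun b : Fin m => p ≤ (b : ℕ) with hS₂
  set P : Matrix (Fin n) (Fin m) k := selector n k r fun _ : Fin m => True with hP
  set E : Matrix (Fin m) (Fin m) k := diagonal fun b => if (b : ℕ) < p then 1 else 0 with hE
  have hMdef : M = Pᵀ * (X * S₁ + Y * S₂) := rfl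
  have hPP : Pᵀ * P = 1 := by
    rw [selector_transpose_mul_self r _ (fun b _ => by omega)]; simp
  have hPP' : P * Pᵀ = intervalProj n k r (r + m) :=
    selector_mul_transpose_self r _ _ fun i =>
      ⟨fun h => ⟨⟨i - r, by omega⟩, trivial, by simp; omega⟩, by rintro ⟨b, -, h⟩; omega⟩
  have h₁ : S₁ᵀ * S₁ = E := selector_transpose_mul_self c₁ _ fun b hb => by omega
  have h₁' : S₁ * S₁ᵀ = intervalProj n k c₁ (c₁ + p) :=
    selector_mul_transpose_self c₁ _ _ fun i =>
      ⟨fun h => ⟨⟨i - c₁, by omega⟩, by simp; omega, by simp; omega⟩,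
        by rintro ⟨b, hb, h⟩; omega⟩
  have h₂ : S₂ᵀ * S₂ = 1 - E := by
    rw [selector_transpose_mul_self c₂ _ fun b hb => by omega, hE, ← diagonal_one, diagonal_sub]
    congr 1
    ext b
    by_cases hb : (b : ℕ) < p
    · simp [hb]
    · simp [hb, not_lt.1 hb]
  have h₂' : S₂ * S₂ᵀ = intervalProj n k (c₂ + p) (c₂ + m) :=
    selector_mul_transpose_self c₂ _ _ fun i =>
      ⟨fun h => ⟨⟨i - c₂, by omega⟩, by simp; omega, by simp; omega⟩,
        by rintro ⟨b, hb, h⟩; omega⟩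
  have e₁ : S₁ * E = S₁ := by
    ext i b
    rw [hS₁, hE, selector_mul_diagonal]
    by_cases hb : (b : ℕ) < p <;> simp [selector, hb]
  have e₂ : S₂ * E = 0 := by
    ext i b
    rw [hS₂, hE, selector_mul_diagonal]
    by_cases hb : (b : ℕ) < p
    · simp [selector, hb.not_ge]
    · simp [hb]
  have hMM : M⁻¹ * M = 1 := nonsing_inv_mul _ (isUnit_iff_ne_zero.2 hf)
  have hMM' : M * M⁻¹ = 1 := mul_nonsing_inv _ (isUnit_iff_ne_zero.2 hf)
  have hX : M⁻¹ * (Pᵀ * (X * S₁)) = E := by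
    have : Pᵀ * (X * S₁) = M * E := by
      rw [hMdef, Matrix.mul_assoc, Matrix.add_mul, Matrix.mul_assoc X, Matrix.mul_assoc Y, e₁, e₂,
        Matrix.mul_zero, add_zero]
    rw [this, ← Matrix.mul_assoc, hMM, Matrix.one_mul]
  have hY : M⁻¹ * (Pᵀ * (Y * S₂)) = 1 - E := by
    rw [eq_sub_iff_add_eq', ← hX, ← Matrix.mul_add, ← Matrix.mul_add, ← hMdef, hMM]
  refine ⟨S₁ * M⁻¹ * Pᵀ, S₂ * M⁻¹ * Pᵀ, ?_, ?_⟩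
  · intro D
    have hDP : Pᵀ.map D = 0 := by
      rw [transpose_map, selector_map_derivation]; exact transpose_zero
    have hDM : M.map D = Pᵀ * (X.map D * S₁ + Y.map D * S₂) := by
      have hadd : ∀ Z W : Matrix (Fin n) (Fin m) k, (Z + W).map D = Z.map D + W.map D :=
        fun Z W => Matrix.map_add _ (fun a b => map_add D a b) Z W
      rw [hMdef, map_derivation_mul, hDP, Matrix.zero_mul, zero_add, hadd, map_derivation_mul,
        map_derivation_mul, selector_map_derivation, selector_map_derivation, Matrix.mul_zero,
        Matrix.mul_zero, add_zero, add_zero]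
    rw [derivation_det_of_field D M hf, hDM, Matrix.mul_add, Matrix.mul_add, trace_add]
    congr 2
    · rw [trace_mul_comm, trace_mul_comm _ (X.map D), Matrix.mul_assoc, trace_mul_comm Pᵀ]
      simp only [Matrix.mul_assoc]
    · rw [trace_mul_comm, trace_mul_comm _ (Y.map D), Matrix.mul_assoc, trace_mul_comm Pᵀ]
      simp only [Matrix.mul_assoc]
  · have f₁ : S₁ * S₁ᵀ * S₁ = S₁ := by rw [Matrix.mul_assoc, h₁, e₁]
    have f₂ : S₂ * S₂ᵀ * S₂ = S₂ := by
      rw [Matrix.mul_assoc, h₂, Matrix.mul_sub, Matrix.mul_one, e₂, sub_zero]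
    have fP : Pᵀ * (P * Pᵀ) = Pᵀ := by rw [← Matrix.mul_assoc, hPP, Matrix.one_mul]
    constructor
    · rw [← h₁', ← Matrix.mul_assoc, ← Matrix.mul_assoc, f₁]
    · rw [← h₂', ← Matrix.mul_assoc, ← Matrix.mul_assoc, f₂]
    · rw [← hPP', Matrix.mul_assoc, fP]
    · rw [← hPP', Matrix.mul_assoc, fP]
    · calc S₁ * M⁻¹ * Pᵀ * X * intervalProj n k _ _ = S₁ * (M⁻¹ * (Pᵀ * (X * S₁))) * S₁ᵀ := by
            rw [← h₁']; simp only [Matrix.mul_assoc]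
        _ = _ := by rw [hX, e₁, h₁']
    · calc S₂ * M⁻¹ * Pᵀ * Y * intervalProj n k _ _ = S₂ * (M⁻¹ * (Pᵀ * (Y * S₂))) * S₂ᵀ := by
            rw [← h₂']; simp only [Matrix.mul_assoc]
        _ = _ := by rw [hY, Matrix.mul_sub, Matrix.mul_one, e₂, sub_zero, h₂']
    · calc intervalProj n k _ _ * (X * (S₁ * M⁻¹ * Pᵀ) + Y * (S₂ * M⁻¹ * Pᵀ))
          = P * (Pᵀ * (X * S₁ + Y * S₂)) * M⁻¹ * Pᵀ := by
            rw [← hPP']; simp only [Matrix.mul_assoc, Matrix.mul_add, Matrix.add_mul]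
        _ = _ := by rw [← hMdef, Matrix.mul_assoc P, hMM', Matrix.mul_one, hPP']

theorem mixedMinor_apply {n m : ℕ} {k : Type*} [Field k] (X Y : Matrix (Fin n) (Fin n) k)
    (r c₁ c₂ p : ℕ) (hr : r + m ≤ n) (hc₁ : c₁ + p ≤ n) (hc₂ : p < m → c₂ + m ≤ n)
    (a b : Fin m) :
    mixedMinor m X Y r c₁ c₂ p a b =
      if h : (b : ℕ) < p then X ⟨r + a, by omega⟩ ⟨c₁ + b, by omega⟩
      else Y ⟨r + a, by omega⟩ ⟨c₂ + b, by omega⟩ := by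
  rw [mixedMinor, selector_transpose_mul_apply r _ _ _ _ (fun _ => by omega), dif_pos trivial,
    Matrix.add_apply, selector_mul_apply c₁ _ _ _ _ (fun _ => by omega),
    selector_mul_apply c₂ _ _ _ _ (fun _ => by omega)]
  by_cases h : (b : ℕ) < p
  · simp [h, h.not_ge]
  · simp [h, not_lt.1 h]

/-! ### Gradients of determinants with columns of powers of `U` -/

section
variable {n : ℕ} {k : Type*} [Field k]

/-- The matrix whose column `b` is column `c b` of `U ^ d b`. -/
def krylovMat (U : Matrix (Fin n) (Fin n) k) (c : Fin n → Fin n) (d : Fin n → ℕ) :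
    Matrix (Fin n) (Fin n) k :=
  of fun a b => (U ^ d b) a (c b)

/-- The product of the basis vector `c b` and of row `b` of the inverse of `krylovMat U c d`. -/
noncomputable def dualRow (U : Matrix (Fin n) (Fin n) k) (c : Fin n → Fin n) (d : Fin n → ℕ)
    (b : Fin n) : Matrix (Fin n) (Fin n) k :=
  vecMulVec (Pi.single (c b) 1) ((krylovMat U c d)⁻¹ b)

/-- The logarithmic gradient of `det (krylovMat U c d)` as a function of `U`. -/
noncomputable def krylovGrad (U : Matrix (Fin n) (Fin n) k) (c : Fin n → Fin n) (d : Fin n → ℕ) :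
    Matrix (Fin n) (Fin n) k :=
  ∑ b, ∑ s ∈ Finset.range (d b), U ^ s * dualRow U c d b * U ^ (d b - 1 - s)

variable {U : Matrix (Fin n) (Fin n) k} {c c' : Fin n → Fin n} {d d' : Fin n → ℕ}

theorem trace_dualRow_mul (b : Fin n) (Z : Matrix (Fin n) (Fin n) k) :
    (dualRow U c d b * Z).trace = ((krylovMat U c d)⁻¹ * Z) b (c b) := by
  rw [trace_mul_comm, dualRow, mul_vecMulVec, trace_vecMulVec, mulVec_single_one, dotProduct_comm]
  rfl

theorem dualRow_apply (b i j : Fin n) :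
    dualRow U c d b i j = if i = c b then (krylovMat U c d)⁻¹ b j else 0 := by
  rw [dualRow, vecMulVec_apply, Pi.single_apply]
  split_ifs <;> simp

theorem map_derivation_pow {R : Type*} [CommRing R] [Algebra R k] (D : Derivation R k k)
    (U : Matrix (Fin n) (Fin n) k) (m : ℕ) :
    (U ^ m).map D = ∑ s ∈ Finset.range m, U ^ (m - 1 - s) * U.map D * U ^ s := by
  induction m with
  | zero =>
    ext i j
    rw [pow_zero, map_apply, one_apply]
    split_ifs <;> simp
  | succ m ih =>
    rw [pow_succ', map_derivation_mul, ih, Finset.sum_range_succ, Finset.mul_sum, add_comm]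
    refine congrArg₂ _ (Finset.sum_congr rfl fun s hs => ?_) (by simp)
    have := Finset.mem_range.1 hs
    rw [← Matrix.mul_assoc, ← Matrix.mul_assoc, ← pow_succ',
      show m - 1 - s + 1 = m + 1 - 1 - s by omega]

theorem trace_krylovGrad_mul (Z : Matrix (Fin n) (Fin n) k) :
    (krylovGrad U c d * Z).trace = ∑ b, ∑ s ∈ Finset.range (d b),
      ((krylovMat U c d)⁻¹ * (U ^ (d b - 1 - s) * Z * U ^ s)) b (c b) := by
  simp only [krylovGrad, Finset.sum_mul, trace_sum]
  refine Finset.sum_congr rfl fun b _ => Finset.sum_congr rfl fun s _ => ?_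
  rw [← trace_dualRow_mul, Matrix.mul_assoc, Matrix.mul_assoc, trace_mul_comm]
  simp only [Matrix.mul_assoc]

theorem trace_inv_mul_map_krylovMat {R : Type*} [CommRing R] [Algebra R k]
    (D : Derivation R k k) :
    ((krylovMat U c d)⁻¹ * (krylovMat U c d).map D).trace = (krylovGrad U c d * U.map D).trace := by
  rw [trace_krylovGrad_mul]
  refine Finset.sum_congr rfl fun b _ => ?_
  have h : ((krylovMat U c d)⁻¹ * (krylovMat U c d).map D) b b =
      ((krylovMat U c d)⁻¹ * (U ^ d b).map D) b (c b) := rfl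
  rw [diag_apply, h, map_derivation_pow, Finset.mul_sum, Matrix.sum_apply]

theorem inv_mul_pow_apply (hΦ : (krylovMat U c d).det ≠ 0) (b b' : Fin n) :
    ((krylovMat U c d)⁻¹ * U ^ d b') b (c b') = if b = b' then 1 else 0 := by
  have h : ((krylovMat U c d)⁻¹ * U ^ d b') b (c b') =
    ((krylovMat U c d)⁻¹ * krylovMat U c d) b b' := rfl
  rw [h, nonsing_inv_mul _ (isUnit_iff_ne_zero.2 hΦ), one_apply]

/-- The sums for `∇ U` and `U ∇` telescope. -/
theorem krylovGrad_commutator (hΦ : (krylovMat U c d).det ≠ 0) :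
    krylovGrad U c d * U - U * krylovGrad U c d = ∑ b, dualRow U c d b * U ^ d b - 1 := by
  have h₁ : ∑ b, U ^ d b * dualRow U c d b = 1 := by
    rw [← mul_nonsing_inv _ (isUnit_iff_ne_zero.2 hΦ)]
    ext i j
    rw [Matrix.sum_apply, mul_apply]
    refine Finset.sum_congr rfl fun b _ => ?_
    rw [dualRow, mul_vecMulVec, mulVec_single_one, vecMulVec_apply]
    rfl
  rw [← h₁, ← Finset.sum_sub_distrib, krylovGrad, Finset.sum_mul, Finset.mul_sum,
    ← Finset.sum_sub_distrib]
  refine Finset.sum_congr rfl fun b _ => ?_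
  have h := Finset.sum_range_sub' (fun s => U ^ s * dualRow U c d b * U ^ (d b - s)) (d b)
  rw [pow_zero, one_mul, Nat.sub_zero, Nat.sub_self, pow_zero, mul_one] at h
  rw [← h, Finset.sum_mul, Finset.mul_sum, ← Finset.sum_sub_distrib]
  refine Finset.sum_congr rfl fun s hs => ?_
  have := Finset.mem_range.1 hs
  rw [Matrix.mul_assoc, ← pow_succ, ← Matrix.mul_assoc, ← Matrix.mul_assoc, ← pow_succ',
    show d b - 1 - s + 1 = d b - s by omega, show d b - (s + 1) = d b - 1 - s by omega]

/-- Shape of the columns of `Φ_{kl}`: the columns with a given exponent are trailing ones, and all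
exponents `1, …, D` occur together with the last column, which is the only one to occur with
exponents above `1`. -/
structure IsKrylovShape (c : Fin n → Fin n) (d : Fin n → ℕ) (D : ℕ) : Prop where
  trailing : ∀ b j, c b ≤ j → ∃ b', c b' = j ∧ d b' = d b
  last : ∀ t, 1 ≤ t → t ≤ D → ∃ b, (c b : ℕ) = n - 1 ∧ d b = t
  le : ∀ b, d b ≤ D
  eq_last : ∀ b, 2 ≤ d b → (c b : ℕ) = n - 1
  inj : ∀ b b', c b = c b' → d b = d b' → b = b'

theorem IsKrylovShape.inv_mul_pow_apply {D : ℕ} (h : IsKrylovShape c d D)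
    (hΦ : (krylovMat U c d).det ≠ 0) (b j : Fin n) (hj : c b ≤ j) :
    ((krylovMat U c d)⁻¹ * U ^ d b) b j = if j = c b then 1 else 0 := by
  obtain ⟨b', rfl, hd⟩ := h.trailing b j hj
  rw [← hd, DrinfeldDouble.inv_mul_pow_apply hΦ]
  by_cases hb : b = b'
  · subst hb; simp
  · rw [if_neg hb, if_neg fun hc => hb (h.inj _ _ hc.symm hd.symm)]

theorem IsKrylovShape.inv_mul_pow_last {D : ℕ} (h : IsKrylovShape c d D)
    (hΦ : (krylovMat U c d).det ≠ 0) (b j : Fin n) (hj : (j : ℕ) = n - 1) (t : ℕ) (ht : 1 ≤ t)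
    (htD : t ≤ D) (hdt : d b ≠ t) : ((krylovMat U c d)⁻¹ * U ^ t) b j = 0 := by
  obtain ⟨b', hc, rfl⟩ := h.last t ht htD
  obtain rfl : c b' = j := Fin.ext (hc.trans hj.symm)
  rw [DrinfeldDouble.inv_mul_pow_apply hΦ, if_neg]
  rintro rfl
  exact hdt rfl

theorem IsKrylovShape.lowInt {D : ℕ} (h : IsKrylovShape c d D)
    (hΦ : (krylovMat U c d).det ≠ 0) :
    LowInt (krylovGrad U c d * U - U * krylovGrad U c d) := by
  have key : ∀ i j, i ≤ j → (∑ b, dualRow U c d b * U ^ d b) i j =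
      ∑ b, if i = c b ∧ j = c b then 1 else 0 := by
    intro i j hij
    rw [Matrix.sum_apply]
    refine Finset.sum_congr rfl fun b _ => ?_
    have h₁ : (dualRow U c d b * U ^ d b) i j =
        if i = c b then ((krylovMat U c d)⁻¹ * U ^ d b) b j else 0 := by
      simp only [mul_apply, dualRow_apply]
      split_ifs <;> simp
    rw [h₁]
    by_cases hi : i = c b
    · rw [if_pos hi, h.inv_mul_pow_apply hΦ b j (hi ▸ hij)]
      simp [hi]
    · simp [hi]
  rw [krylovGrad_commutator hΦ]
  constructor
  · intro i j hij
    rw [Matrix.sub_apply, key i j hij.le, one_apply_ne hij.ne, sub_zero]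
    refine Finset.sum_eq_zero fun b _ => if_neg ?_
    rintro ⟨rfl, rfl⟩
    exact lt_irrefl _ hij
  · intro i
    rw [Matrix.sub_apply, key i i le_rfl, one_apply_eq]
    refine sub_mem (sum_mem fun b _ => ?_) (one_mem _)
    split_ifs
    exacts [one_mem _, zero_mem _]

theorem trace_krylovGrad_mul_mem
    (hΦ : (krylovMat U c d).det ≠ 0) :
    (krylovGrad U c d * U).trace ∈ intSubring k := by
  rw [trace_krylovGrad_mul]
  refine sum_mem fun b _ => sum_mem fun s hs => ?_
  have := Finset.mem_range.1 hs
  rw [← pow_succ, ← pow_add, show d b - 1 - s + 1 + s = d b by omega,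
    DrinfeldDouble.inv_mul_pow_apply hΦ, if_pos rfl]
  exact one_mem _

/-- The integrality behind the log-canonicity of the functions `φ_{kl}`: in the expansion of the
trace, the terms with `s = 0` only involve diagonal entries of the triangular matrix `[∇, U]`, and
in those with `s ≥ 1` the duality between the columns of a Krylov matrix and the rows of its inverse
leaves nothing but the identity part of `[∇, U]`. -/
theorem trace_commutator_mul_mem {D D' : ℕ} (h : IsKrylovShape c d D) (h' : IsKrylovShape c' d' D')
    (hD : D' ≤ D) (hΦ : (krylovMat U c d).det ≠ 0) (hΦ' : (krylovMat U c' d').det ≠ 0) :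
    ((krylovGrad U c d * U - U * krylovGrad U c d) * (krylovGrad U c' d' * U)).trace ∈
      intSubring k := by
  have hV := h.lowInt hΦ
  set V := krylovGrad U c d * U - U * krylovGrad U c d with hVdef
  rw [trace_mul_comm, Matrix.mul_assoc, trace_krylovGrad_mul]
  refine sum_mem fun b _ => sum_mem fun s hs => ?_
  have hs := Finset.mem_range.1 hs
  have e : (krylovMat U c' d')⁻¹ * (U ^ (d' b - 1 - s) * (U * V) * U ^ s) =
      (krylovMat U c' d')⁻¹ * U ^ (d' b - s) * V * U ^ s := by
    rw [show d' b - s = d' b - 1 - s + 1 by omega, pow_succ]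
    simp only [Matrix.mul_assoc]
  rw [e]
  rcases Nat.eq_zero_or_pos s with rfl | hs0
  · rw [pow_zero, mul_one, Nat.sub_zero, mul_apply]
    refine sum_mem fun j _ => ?_
    rcases lt_trichotomy j (c' b) with hj | hj | hj
    · rw [hV.1 _ _ hj, mul_zero]; exact zero_mem _
    · rw [← hj]
      refine mul_mem ?_ (hV.2 _)
      rw [h'.inv_mul_pow_apply hΦ' b j hj.ge, if_pos hj]
      exact one_mem _
    · rw [h'.inv_mul_pow_apply hΦ' b j hj.le, if_neg hj.ne', zero_mul]
      exact zero_mem _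
  · have hc' := h'.eq_last b (by omega)
    have hdD := h'.le b
    rw [hVdef, krylovGrad_commutator hΦ, mul_sub, sub_mul, mul_one,
      Matrix.mul_assoc _ (U ^ (d' b - s)) (U ^ s),
      ← pow_add, show d' b - s + s = d' b by omega, Matrix.sub_apply,
      DrinfeldDouble.inv_mul_pow_apply hΦ', if_pos rfl]
    refine sub_mem ?_ (one_mem _)
    rw [Finset.mul_sum, Finset.sum_mul, Matrix.sum_apply]
    refine sum_mem fun a _ => ?_
    have e₂ : ((krylovMat U c' d')⁻¹ * U ^ (d' b - s) * (dualRow U c d a * U ^ d a) * U ^ s) b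
        (c' b) = ((krylovMat U c' d')⁻¹ * U ^ (d' b - s)) b (c a) *
          ((krylovMat U c d)⁻¹ * U ^ (d a + s)) a (c' b) := by
      rw [← Matrix.mul_assoc, Matrix.mul_assoc _ (U ^ d a), ← pow_add, Matrix.mul_assoc, dualRow,
        vecMulVec_mul, mul_vecMulVec, vecMulVec_apply, mulVec_single_one]
      rfl
    rw [e₂]
    by_cases ha : (c a : ℕ) = n - 1 ∧ 1 ≤ d a
    · rw [h'.inv_mul_pow_last hΦ' b (c a) ha.1 _ (by omega) (by omega) (by omega), zero_mul]
      exact zero_mem _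
    · have hda : d a ≤ 1 := by
        by_contra hlt
        exact ha ⟨h.eq_last a (by omega), by omega⟩
      rw [h.inv_mul_pow_last hΦ a (c' b) hc' _ (by omega) (by omega) (by omega), mul_zero]
      exact zero_mem _

end

/-! ### Brackets between the families -/

/-- The algebraic relations satisfied by the logarithmic gradient `(A, B)` of a function `φ_{kl}`:
`G` is the logarithmic gradient of a Krylov determinant in `U = X⁻¹ Y`, and `D` the highest
exponent in it. -/
structure IsKrylovGrad {n : ℕ} {k : Type*} [Field k] (X Y A B U G : Matrix (Fin n) (Fin n) k)
    (e : ℤ) (c : Fin n → Fin n) (d : Fin n → ℕ) (D : ℕ) : Prop where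
  shape : IsKrylovShape c d D
  det_ne_zero : (krylovMat U c d).det ≠ 0
  eq_grad : G = krylovGrad U c d
  left_X : A * X = (e : k) • (1 : Matrix (Fin n) (Fin n) k) - U * G
  left_Y : B * Y = G * U
  right : X * A + Y * B = (e : k) • (1 : Matrix (Fin n) (Fin n) k)

section
variable {n : ℕ} {k : Type*} [Field k]

theorem UpInt.trace_mul_mem {ξ η : Matrix (Fin n) (Fin n) k} (hξ : UpInt ξ) (hη : UpInt η) :
    (ξ * η).trace ∈ intSubring k := by
  simp only [trace, diag, mul_apply]
  refine sum_mem fun i _ => sum_mem fun j _ => ?_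
  rcases lt_trichotomy i j with h | rfl | h
  · simp [hη.1 j i h]
  · exact mul_mem (hξ.2 _) (hη.2 _)
  · simp [hξ.1 i j h]

theorem upInt_intCast_smul_one (e : ℤ) :
    UpInt ((e : k) • (1 : Matrix (Fin n) (Fin n) k)) :=
  ⟨fun i j h => by simp [one_apply_ne h.ne'], fun i => ⟨e, by simp⟩⟩

theorem lowInt_intCast_smul_one (e : ℤ) :
    LowInt ((e : k) • (1 : Matrix (Fin n) (Fin n) k)) :=
  ⟨fun i j h => by simp [one_apply_ne h.ne], fun i => ⟨e, by simp⟩⟩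

/-- `ξ` has its nonzero rows in the interval `[a, b)`, and is the identity in the columns of that
interval. -/
def IsRowProj (ξ : Matrix (Fin n) (Fin n) k) (a b : ℕ) : Prop :=
  ∀ i j : Fin n, (¬(a ≤ i.1 ∧ i.1 < b) → ξ i j = 0) ∧
    (a ≤ j.1 ∧ j.1 < b → ξ i j = if i = j then 1 else 0)

theorem isRowProj_of_mul {ξ : Matrix (Fin n) (Fin n) k} {a b : ℕ}
    (h₁ : intervalProj n k a b * ξ = ξ)
    (h₂ : ξ * intervalProj n k a b = intervalProj n k a b) : IsRowProj ξ a b := by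
  intro i j
  constructor
  · intro hi
    rw [← h₁, coordProj_mul_apply, if_neg hi]
  · intro hj
    have := congrFun₂ h₂ i j
    rw [mul_coordProj_apply, if_pos hj] at this
    rw [this]
    simp only [coordProj, diagonal_apply]
    by_cases hij : i = j
    · subst hij; simp [hj]
    · simp [hij]

theorem IsRowProj.diag_mem {ξ : Matrix (Fin n) (Fin n) k} {a b : ℕ} (h : IsRowProj ξ a b)
    (i : Fin n) : ξ i i ∈ intSubring k := by
  by_cases hi : a ≤ i.1 ∧ i.1 < b
  · rw [(h i i).2 hi, if_pos rfl]; exact one_mem _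
  · rw [(h i i).1 hi]; exact zero_mem _

theorem IsRowProj.lowInt {ξ : Matrix (Fin n) (Fin n) k} {a b : ℕ} (h : IsRowProj ξ a b)
    (hb : n ≤ b) : LowInt ξ := by
  refine ⟨fun i j hij => ?_, h.diag_mem⟩
  by_cases hi : a ≤ i.1
  · rw [(h i j).2 ⟨hi.trans (Fin.le_def.1 hij.le), by omega⟩, if_neg hij.ne]
  · exact (h i j).1 fun h => hi h.1

variable {X Y A B A' B' U U' G G' : Matrix (Fin n) (Fin n) k} {r r' s₁ t₁ s₂ t₂ : ℕ}
  {q q' u₁ v₁ u₂ v₂ : ℕ} {e e' : ℤ} {c c' : Fin n → Fin n} {d d' : Fin n → ℕ} {D D' : ℕ}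

namespace IsMinorGrad

theorem eq_zero_X (h : IsMinorGrad X Y A B r r' s₁ t₁ s₂ t₂) (hs : t₁ ≤ s₁) : A = 0 := by
  rw [← h.projX_mul]
  ext i j
  rw [coordProj_mul_apply, if_neg (by omega)]
  rfl

theorem eq_zero_Y (h : IsMinorGrad X Y A B r r' s₁ t₁ s₂ t₂) (hs : t₂ ≤ s₂) : B = 0 := by
  rw [← h.projY_mul]
  ext i j
  rw [coordProj_mul_apply, if_neg (by omega)]
  rfl

theorem isRowProj_X (h : IsMinorGrad X Y A B r r' s₁ t₁ s₂ t₂) : IsRowProj (A * X) s₁ t₁ :=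
  isRowProj_of_mul (by rw [← Matrix.mul_assoc, h.projX_mul]) h.left_X

theorem isRowProj_Y (h : IsMinorGrad X Y A B r r' s₁ t₁ s₂ t₂) : IsRowProj (B * Y) s₂ t₂ :=
  isRowProj_of_mul (by rw [← Matrix.mul_assoc, h.projY_mul]) h.left_Y

theorem isRowProj_right (h : IsMinorGrad X Y A B r r' s₁ t₁ s₂ t₂) :
    IsRowProj (X * A + Y * B)ᵀ r r' := by
  have hI : (intervalProj n k r r')ᵀ = intervalProj n k r r' := diagonal_transpose _
  refine isRowProj_of_mul ?_ ?_
  · rw [← hI, ← transpose_mul, add_mul, Matrix.mul_assoc, Matrix.mul_assoc, h.mulX_proj,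
      h.mulY_proj]
  · rw [← hI, ← transpose_mul, h.right]

theorem upInt_right (h : IsMinorGrad X Y A B r r' s₁ t₁ s₂ t₂) (hr : n ≤ r') :
    UpInt (X * A + Y * B) :=
  let h' := h.isRowProj_right.lowInt hr
  ⟨fun i j hij => h'.1 j i hij, fun i => h'.2 i⟩

theorem lowInt_left (h : IsMinorGrad X Y A B r r' s₁ t₁ s₂ t₂) (h₁ : n ≤ t₁) (h₂ : n ≤ t₂) :
    LowInt (A * X + B * Y) :=
  (h.isRowProj_X.lowInt h₁).add (h.isRowProj_Y.lowInt h₂)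

/-- The cross term of two minors with trailing rows and columns. The row sets are nested, and the
relation `right` for the larger one replaces a product by one of triangular matrices. -/
theorem trace_mem (h : IsMinorGrad X Y A B r r' s₁ t₁ s₂ t₂)
    (h' : IsMinorGrad X Y A' B' q q' u₁ v₁ u₂ v₂) (h₁ : n ≤ t₁) (h₂ : n ≤ t₂) (h₁' : n ≤ v₁)
    (h₂' : n ≤ v₂) (hr : n ≤ r') (hq : n ≤ q') :
    (X * A * (Y * B')).trace ∈ intSubring k := by
  have hX := h.isRowProj_X.lowInt h₁
  have hX' := h'.isRowProj_X.lowInt h₁'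
  have hY := h.isRowProj_Y.lowInt h₂
  have hY' := h'.isRowProj_Y.lowInt h₂'
  rcases le_total q r with hqr | hqr
  · have e₀ : intervalProj n k r r' * intervalProj n k q q' = intervalProj n k r r' :=
      coordProj_mul_of_imp fun i hi => ⟨hqr.trans hi.1, by omega⟩
    have e₁ : X * A * (X * A' + Y * B') = X * A := by
      conv_lhs => rw [← h.mulX_proj, ← e₀]
      rw [Matrix.mul_assoc, Matrix.mul_assoc, Matrix.mul_assoc, h'.right, e₀, h.mulX_proj]
    have e₂ : X * A * (Y * B') = X * A - X * A * (X * A') := by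
      rw [eq_sub_iff_add_eq', ← mul_add, e₁]
    rw [e₂, trace_sub, trace_mul_mul_comm, trace_mul_comm]
    exact sub_mem hX.trace_mem (hX.trace_mul_mem hX')
  · have e₀ : intervalProj n k q q' * intervalProj n k r r' = intervalProj n k q q' :=
      coordProj_mul_of_imp fun i hi => ⟨hqr.trans hi.1, by omega⟩
    have e₁ : Y * B' * (X * A + Y * B) = Y * B' := by
      conv_lhs => rw [← h'.mulY_proj, ← e₀]
      rw [Matrix.mul_assoc, Matrix.mul_assoc, Matrix.mul_assoc, h.right, e₀, h'.mulY_proj]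
    have e₂ : Y * B' * (X * A) = Y * B' - Y * B' * (Y * B) := by
      rw [eq_sub_iff_add_eq, ← mul_add, e₁]
    rw [trace_mul_comm, e₂, trace_sub, trace_mul_mul_comm, trace_mul_comm]
    exact sub_mem hY'.trace_mem (hY'.trace_mul_mem hY)

end IsMinorGrad

namespace IsKrylovGrad

theorem eq_commutator (h : IsKrylovGrad X Y A B U G e c d D) :
    A * X + B * Y = (krylovGrad U c d * U - U * krylovGrad U c d) +
      (e : k) • (1 : Matrix (Fin n) (Fin n) k) := by
  rw [h.left_X, h.left_Y, h.eq_grad]; abel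

theorem lowInt_left (h : IsKrylovGrad X Y A B U G e c d D) : LowInt (A * X + B * Y) := by
  rw [h.eq_commutator]
  exact (h.shape.lowInt h.det_ne_zero).add (lowInt_intCast_smul_one e)

theorem upInt_right (h : IsKrylovGrad X Y A B U G e c d D) : UpInt (X * A + Y * B) := by
  rw [h.right]
  exact upInt_intCast_smul_one e

theorem trace_left_Y_mem (h : IsKrylovGrad X Y A B U G e c d D) :
    (B * Y).trace ∈ intSubring k := by
  rw [h.left_Y, h.eq_grad]
  exact trace_krylovGrad_mul_mem h.det_ne_zero

theorem trace_left_X_mem (h : IsKrylovGrad X Y A B U G e c d D) :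
    (A * X).trace ∈ intSubring k := by
  have := sub_mem h.lowInt_left.trace_mem h.trace_left_Y_mem
  rwa [trace_add, add_sub_cancel_right] at this

end IsKrylovGrad

variable [CharZero k]

theorem rPlusForm_transpose (ξ η : Matrix (Fin n) (Fin n) k) :
    rPlusForm ξᵀ ηᵀ = rPlusForm η ξ := by
  simp only [rPlusForm_eq_sum, transpose_apply, mul_comm]

/-- Two intervals are nested, or one of them lies to the left of the other up to their
intersection; in the last case only one of `⟨R_+ ξ, η⟩`, `⟨R_+ η, ξ⟩` has off-diagonal terms. -/
theorem IsRowProj.rPlusForm_mem {ξ η : Matrix (Fin n) (Fin n) k} {a b a' b' : ℕ}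
    (hξ : IsRowProj ξ a b) (hη : IsRowProj η a' b') (ht : (ξ * η).trace ∈ intSubring k) :
    rPlusForm ξ η ∈ halfInts k := by
  have key : ∀ i j : Fin n, i ≠ j → ξ i j * η j i ≠ 0 →
      (a ≤ i.1 ∧ i.1 < b) ∧ ¬(a ≤ j.1 ∧ j.1 < b) ∧ (a' ≤ j.1 ∧ j.1 < b') ∧
        ¬(a' ≤ i.1 ∧ i.1 < b') := by
    intro i j hij h0
    have h₁ := left_ne_zero_of_mul h0
    have h₂ := right_ne_zero_of_mul h0
    refine ⟨?_, fun hj => ?_, ?_, fun hi => ?_⟩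
    · by_contra hi; exact h₁ ((hξ i j).1 hi)
    · exact h₁ (by rw [(hξ i j).2 hj, if_neg hij])
    · by_contra hi; exact h₂ ((hη j i).1 hi)
    · exact h₂ (by rw [(hη j i).2 hi, if_neg hij.symm])
  by_cases hc : a' ≤ a ∧ b' ≤ b
  · refine rPlusForm_mem_halfInts (fun i j hij => ?_) hξ.diag_mem hη.diag_mem
    by_contra h0
    have := key i j hij.ne h0
    have := Fin.lt_def.1 hij
    omega
  · rw [eq_sub_of_add_eq (rPlusForm_add_swap ξ η)]
    refine sub_mem (mem_halfInts_of_mem_intSubring ht)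
      (rPlusForm_mem_halfInts (fun i j hij => ?_) hη.diag_mem hξ.diag_mem)
    by_contra h0
    have := key j i hij.ne' (by rwa [mul_comm])
    have := Fin.lt_def.1 hij
    omega

/-- Two functions of `X` alone: minors with trailing rows. -/
theorem bracketForm_X_X (h : IsMinorGrad X Y A 0 r r' s₁ t₁ s₂ t₂)
    (h' : IsMinorGrad X Y A' 0 q q' u₁ v₁ u₂ v₂) (hr : n ≤ r') (hq : n ≤ q') :
    bracketForm X Y A 0 A' 0 ∈ halfInts k := by
  have hU := h.upInt_right hr
  have hU' := h'.upInt_right hq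
  simp only [bracketForm, mul_zero, zero_mul, trace_zero, add_zero, sub_zero] at hU hU' ⊢
  refine sub_mem (rPlusForm_mem_of_upInt hU' hU.2) (h.isRowProj_X.rPlusForm_mem h'.isRowProj_X ?_)
  rw [← trace_mul_mul_comm]
  exact hU.trace_mul_mem hU'

/-- Two functions of `Y` alone: minors with trailing columns. -/
theorem bracketForm_Y_Y (h : IsMinorGrad X Y 0 B r r' s₁ t₁ s₂ t₂)
    (h' : IsMinorGrad X Y 0 B' q q' u₁ v₁ u₂ v₂) (ht : n ≤ t₂) (hv : n ≤ v₂) :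
    bracketForm X Y 0 B 0 B' ∈ halfInts k := by
  have hL := h.isRowProj_Y.lowInt ht
  have hL' := h'.isRowProj_Y.lowInt hv
  have hR := h.isRowProj_right
  have hR' := h'.isRowProj_right
  simp only [bracketForm, mul_zero, zero_mul, trace_zero, add_zero, zero_add, sub_zero] at hR hR' ⊢
  refine sub_mem ?_ (rPlusForm_mem_of_lowInt hL hL'.2)
  rw [← rPlusForm_transpose]
  refine hR'.rPlusForm_mem hR ?_
  rw [← transpose_mul, trace_transpose, trace_mul_mul_comm]
  exact hL.trace_mul_mem hL'

theorem bracketForm_minor_minor (h : IsMinorGrad X Y A B r r' s₁ t₁ s₂ t₂)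
    (h' : IsMinorGrad X Y A' B' q q' u₁ v₁ u₂ v₂) (h₁ : n ≤ t₁) (h₂ : n ≤ t₂) (h₁' : n ≤ v₁)
    (h₂' : n ≤ v₂) (hr : n ≤ r') (hq : n ≤ q') :
    bracketForm X Y A B A' B' ∈ halfInts k :=
  bracketForm_mem_of_cross_terms (h.lowInt_left h₁ h₂) (h.upInt_right hr)
    (h'.lowInt_left h₁' h₂') (h'.upInt_right hq)
    (sub_mem ((h.isRowProj_X.lowInt h₁).trace_mul_mem (h'.isRowProj_Y.lowInt h₂'))
      (h.trace_mem h' h₁ h₂ h₁' h₂' hr hq))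

theorem bracketForm_minor_krylov (h : IsMinorGrad X Y A B r r' s₁ t₁ s₂ t₂)
    (h' : IsKrylovGrad X Y A' B' U G e c d D) (h₁ : n ≤ t₁) (h₂ : n ≤ t₂) (hr : n ≤ r') :
    bracketForm X Y A B A' B' ∈ halfInts k := by
  have hX := h.isRowProj_X.lowInt h₁
  refine bracketForm_mem_of_cross_terms (h.lowInt_left h₁ h₂) (h.upInt_right hr)
    h'.lowInt_left h'.upInt_right ?_
  rw [cross_terms_eq_of_scalar h'.right]
  exact sub_mem (hX.trace_mul_mem h'.lowInt_left) (mul_mem ⟨e, by simp⟩ hX.trace_mem)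

theorem bracketForm_krylov_krylov_of_le (h : IsKrylovGrad X Y A B U G e c d D)
    (h' : IsKrylovGrad X Y A' B' U G' e' c' d' D') (hD : D ≤ D') :
    bracketForm X Y A B A' B' ∈ halfInts k := by
  refine bracketForm_mem_of_cross_terms h.lowInt_left h.upInt_right
    h'.lowInt_left h'.upInt_right ?_
  rw [cross_terms_eq_of_scalar h'.right]
  refine sub_mem ?_ (mul_mem ⟨e', by simp⟩ h.trace_left_X_mem)
  have e₁ : A * X * (A' * X + B' * Y) =
      (A * X + B * Y) * (A' * X + B' * Y) - B * Y * (A' * X + B' * Y) := by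
    rw [add_mul, add_sub_cancel_right]
  have e₂ : (B * Y * (A' * X + B' * Y)).trace =
      ((krylovGrad U c' d' * U - U * krylovGrad U c' d') * (krylovGrad U c d * U)).trace +
        e' * (B * Y).trace := by
    rw [trace_mul_comm, h'.eq_commutator, add_mul, trace_add, smul_mul_assoc, one_mul,
      trace_smul, smul_eq_mul, h.left_Y, h.eq_grad]
  rw [e₁, trace_sub, e₂]
  exact sub_mem (h.lowInt_left.trace_mul_mem h'.lowInt_left)
    (add_mem (trace_commutator_mul_mem h'.shape h.shape hD h'.det_ne_zero h.det_ne_zero)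
      (mul_mem ⟨e', by simp⟩ h.trace_left_Y_mem))

theorem bracketForm_krylov_krylov (h : IsKrylovGrad X Y A B U G e c d D)
    (h' : IsKrylovGrad X Y A' B' U G' e' c' d' D') :
    bracketForm X Y A B A' B' ∈ halfInts k := by
  rcases le_total D D' with hD | hD
  · exact bracketForm_krylov_krylov_of_le h h' hD
  · rw [bracketForm_swap]
    exact neg_mem (bracketForm_krylov_krylov_of_le h' h hD)

end

/-! ### Log-canonicity of the functions `g_{ij}`, `h_{ij}`, `f_{kl}`, `φ_{kl}` -/

section
variable {n : ℕ} {k : Type*} [Field k]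

theorem funG_eq (X Y : Matrix (Fin n) (Fin n) k) (i j : Fin n) (hij : j ≤ i) :
    funG X i j hij = (mixedMinor (n - i) X Y i j 0 (n - i)).det := by
  have := Fin.le_def.1 hij
  refine congrArg det (Matrix.ext fun a b => ?_)
  rw [mixedMinor_apply _ _ _ _ _ _ (by omega) (by omega) (by omega), dif_pos b.2]
  rfl

theorem funH_eq (X Y : Matrix (Fin n) (Fin n) k) (i j : Fin n) (hij : i ≤ j) :
    funH Y i j hij = (mixedMinor (n - j) X Y i 0 j 0).det := by
  have := Fin.le_def.1 hij
  refine congrArg det (Matrix.ext fun a b => ?_)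
  rw [mixedMinor_apply _ _ _ _ _ _ (by omega) (by omega) (by omega), dif_neg (by omega)]
  rfl

theorem funF_eq (X Y : Matrix (Fin n) (Fin n) k) (p q : ℕ) (hpq : p + q < n) :
    funF X Y p q hpq =
      (mixedMinor (p + q) X Y (n - p - q) (n - p) (n - p - q) p).det := by
  refine congrArg det (Matrix.ext fun a b => ?_)
  rw [mixedMinor_apply _ _ _ _ _ _ (by omega) (by omega) (by omega), of_apply]
  split_ifs with h
  · rfl
  · congr 1
    exact Fin.ext (by simp; omega)

/-- The column of the power of `U` used as column `b` of `Φ_{kl}`. -/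
def phiCol {n : ℕ} (p q : ℕ) (hpq : p + q ≤ n) (b : Fin n) : Fin n :=
  if h₁ : (b : ℕ) < p then ⟨n - p + b, by omega⟩
  else if h₂ : (b : ℕ) < p + q then ⟨n - q + (b - p), by omega⟩
  else ⟨n - 1, by omega⟩

/-- The exponent of the power of `U` whose column is column `b` of `Φ_{kl}`. -/
def phiExp {n : ℕ} (p q : ℕ) (b : Fin n) : ℕ :=
  if (b : ℕ) < p then 0 else if (b : ℕ) < p + q then 1 else b - (p + q) + 2

theorem matPhi_eq (U : Matrix (Fin n) (Fin n) k) (p q : ℕ) (hpq : p + q ≤ n) :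
    matPhi U p q hpq = krylovMat U (phiCol p q hpq) (phiExp p q) := by
  ext a b
  simp only [matPhi, krylovMat, of_apply, phiCol, phiExp]
  split_ifs <;> simp

theorem isKrylovShape_phi {p q : ℕ} (hpq : p + q ≤ n) (hp : 1 ≤ p) (hq : 1 ≤ q) :
    IsKrylovShape (phiCol p q hpq) (phiExp p q) (n - p - q + 1) where
  trailing b j hj := by
    rw [Fin.le_def] at hj
    by_cases h₁ : (b : ℕ) < p
    · simp only [phiCol, phiExp, h₁, dif_pos, if_pos] at hj ⊢
      refine ⟨⟨j - (n - p), by omega⟩, ?_, ?_⟩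
      · have : (j : ℕ) - (n - p) < p := by omega
        rw [dif_pos this]; exact Fin.ext (by simp; omega)
      · rw [if_pos (by simp; omega)]
    · by_cases h₂ : (b : ℕ) < p + q
      · simp only [phiCol, phiExp, h₁, h₂, dif_pos, if_pos, dif_neg, if_neg, not_false_eq_true]
          at hj ⊢
        refine ⟨⟨j - (n - q) + p, by omega⟩, ?_, ?_⟩
        · have h₃ : ¬ (j : ℕ) - (n - q) + p < p := by omega
          have h₄ : (j : ℕ) - (n - q) + p < p + q := by omega
          rw [dif_neg h₃, dif_pos h₄]; exact Fin.ext (by simp; omega)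
        · rw [if_neg (by simp), if_pos (by simp; omega)]
      · refine ⟨b, ?_, rfl⟩
        simp only [phiCol, h₁, h₂, dif_neg, not_false_eq_true] at hj ⊢
        exact Fin.ext (by simp; omega)
  last t ht htD := by
    by_cases h1 : t = 1
    · refine ⟨⟨p + q - 1, by omega⟩, ?_, ?_⟩
      · simp only [phiCol]
        rw [dif_neg (by simp; omega), dif_pos (by simp; omega)]
        simp; omega
      · simp only [phiExp]
        rw [if_neg (by omega), if_pos (by omega), h1]
    · refine ⟨⟨p + q + (t - 2), by omega⟩, ?_, ?_⟩
      · simp only [phiCol]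
        rw [dif_neg (by omega), dif_neg (by omega)]
      · simp only [phiExp]
        rw [if_neg (by omega), if_neg (by omega)]
        omega
  le b := by
    simp only [phiExp]
    split_ifs <;> omega
  eq_last b hb := by
    simp only [phiExp] at hb
    simp only [phiCol]
    split_ifs at hb ⊢ <;> first | omega | rfl
  inj b b' hc hd := by
    simp only [phiExp] at hd
    have hc := congrArg Fin.val hc
    simp only [phiCol] at hc
    refine Fin.ext ?_
    split_ifs at hc hd <;> simp only at hc <;> omega

end

/-- `{f, g} = ω f g` for a half-integer `ω`. -/
def IsLogCanonicalPair {n : ℕ} (f g : RatFun n) : Prop :=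
  ∃ ω : ℤ, bracketD f g = (ω : RatFun n) / 2 * (f * g)

section
variable {n : ℕ} {f g : RatFun n} {A B A' B' : Matrix (Fin n) (Fin n) (RatFun n)}

theorem bracketD_swap (f g : RatFun n) : bracketD g f = -bracketD f g := by
  rw [bracketD_eq_bracketForm, bracketD_eq_bracketForm, bracketForm_swap]

theorem IsLogCanonicalPair.symm (h : IsLogCanonicalPair f g) : IsLogCanonicalPair g f := by
  obtain ⟨ω, h⟩ := h
  exact ⟨-ω, by rw [bracketD_swap, h]; push_cast; ring⟩

theorem IsLogCanonicalPair.of_hasGrad (hf : HasGrad f (f • A) (f • B))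
    (hg : HasGrad g (g • A') (g • B'))
    (h : bracketForm (genX n) (genY n) A B A' B' ∈ halfInts (RatFun n)) :
    IsLogCanonicalPair f g := by
  obtain ⟨ω, hω⟩ := h
  refine ⟨ω, ?_⟩
  rw [hf.bracketD_eq hg, ← hω]
  simp [div_eq_mul_inv]

theorem hasGrad_zero : HasGrad (0 : RatFun n) 0 0 := fun D => by simp

theorem isLogCanonicalPair_zero_left : IsLogCanonicalPair 0 g := by
  refine ⟨0, ?_⟩
  rw [bracketD_eq_bracketForm, hasGrad_zero.nablaX_eq, hasGrad_zero.nablaY_eq]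
  simp [bracketForm, rPlusForm, opRPlus, opR, projPos, projNeg]

theorem hasGrad_smul_iff : HasGrad f (f • A) (f • B) ↔
    ∀ D : Derivation ℂ (RatFun n) (RatFun n),
      D f = f * ((A * (genX n).map D).trace + (B * (genY n).map D).trace) := by
  simp only [HasGrad, smul_mul_assoc, trace_smul, smul_eq_mul, mul_add]

end

section
variable {n : ℕ} {f g : RatFun n}

/-- `f` has the logarithmic gradient of a minor of `X` with trailing rows. -/
def HasGradG (f : RatFun n) : Prop :=
  ∃ A r s t s', HasGrad f (f • A) (f • 0) ∧ IsMinorGrad (genX n) (genY n) A 0 r n s t s' s'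

/-- `f` has the logarithmic gradient of a minor of `Y` with trailing columns. -/
def HasGradH (f : RatFun n) : Prop :=
  ∃ B r r' s s', HasGrad f (f • 0) (f • B) ∧ IsMinorGrad (genX n) (genY n) 0 B r r' s s s' n

/-- `f` has the logarithmic gradient of a minor with trailing rows built from trailing columns of
`X` and of `Y`. -/
def HasGradF (f : RatFun n) : Prop :=
  ∃ A B r s s', HasGrad f (f • A) (f • B) ∧ IsMinorGrad (genX n) (genY n) A B r n s n s' n

/-- `f` has the logarithmic gradient of one of the functions `φ_{kl}`. -/
def HasGradPhi (f : RatFun n) : Prop :=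
  ∃ A B G e c d D, HasGrad f (f • A) (f • B) ∧
    IsKrylovGrad (genX n) (genY n) A B ((genX n)⁻¹ * genY n) G e c d D

theorem hasGradG_funG (i j : Fin n) (hij : j ≤ i) (hf : funG (genX n) i j hij ≠ 0) :
    HasGradG (funG (genX n) i j hij) := by
  have := Fin.le_def.1 hij
  rw [funG_eq _ (genY n)] at hf ⊢
  obtain ⟨A, B, h₁, h₂⟩ := exists_isMinorGrad (R := ℂ) (genX n) (genY n) i j 0 (n - i)
    (by omega) le_rfl (by omega) (by omega) hf
  obtain rfl := h₂.eq_zero_Y le_rfl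
  rw [zero_add, show (i : ℕ) + (n - i) = n by omega] at h₂
  exact ⟨A, _, _, _, _, hasGrad_smul_iff.2 h₁, h₂⟩

theorem hasGradH_funH (i j : Fin n) (hij : i ≤ j) (hf : funH (genY n) i j hij ≠ 0) :
    HasGradH (funH (genY n) i j hij) := by
  have := Fin.le_def.1 hij
  rw [funH_eq (genX n)] at hf ⊢
  obtain ⟨A, B, h₁, h₂⟩ := exists_isMinorGrad (R := ℂ) (genX n) (genY n) i 0 j 0
    (by omega) (Nat.zero_le _) (by omega) (by omega) hf
  obtain rfl := h₂.eq_zero_X le_rfl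
  rw [show (j : ℕ) + (n - j) = n by omega] at h₂
  exact ⟨B, _, _, _, _, hasGrad_smul_iff.2 h₁, h₂⟩

theorem hasGradF_funF (p q : ℕ) (hpq : p + q < n) (hf : funF (genX n) (genY n) p q hpq ≠ 0) :
    HasGradF (funF (genX n) (genY n) p q hpq) := by
  rw [funF_eq] at hf ⊢
  obtain ⟨A, B, h₁, h₂⟩ := exists_isMinorGrad (R := ℂ) (genX n) (genY n) (n - p - q) (n - p)
    (n - p - q) p (by omega) (by omega) (by omega) (by omega) hf
  rw [show n - p - q + (p + q) = n by omega, show n - p + p = n by omega] at h₂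
  exact ⟨A, B, _, _, _, hasGrad_smul_iff.2 h₁, h₂⟩

theorem map_derivation_inv_mul (D : Derivation ℂ (RatFun n) (RatFun n))
    (hX : (genX n).det ≠ 0) :
    ((genX n)⁻¹ * genY n).map D =
      (genX n)⁻¹ * ((genY n).map D - (genX n).map D * ((genX n)⁻¹ * genY n)) := by
  have hu := isUnit_iff_ne_zero.2 hX
  have h : (genY n).map D = (genX n).map D * ((genX n)⁻¹ * genY n) +
      genX n * ((genX n)⁻¹ * genY n).map D := by
    rw [← map_derivation_mul, mul_nonsing_inv_cancel_left _ _ hu]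
  rw [h, add_sub_cancel_left, nonsing_inv_mul_cancel_left _ _ hu]

theorem hasGradPhi_funPhi {p q : ℕ} (hpq : p + q ≤ n) (hp : 1 ≤ p) (hq : 1 ≤ q)
    (hf : funPhi (genX n) (genY n) p q hpq ≠ 0) :
    HasGradPhi (funPhi (genX n) (genY n) p q hpq) := by
  rw [funPhi] at hf
  have hΦ := right_ne_zero_of_mul hf
  have hX : (genX n).det ≠ 0 := (pow_ne_zero_iff (by omega)).1
    (right_ne_zero_of_mul (left_ne_zero_of_mul hf))
  have hu := isUnit_iff_ne_zero.2 hX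
  set X := genX n with hXdef
  set Y := genY n with hYdef
  set U := X⁻¹ * Y with hU
  set e := n - p - q + 1 with he
  rw [matPhi_eq] at hΦ
  set c := phiCol p q hpq
  set d : Fin n → ℕ := phiExp p q
  set G := krylovGrad U c d with hG
  have hXU : X * U = Y := mul_nonsing_inv_cancel_left _ _ hu
  have hXA : X * (((e : ℤ) : RatFun n) • X⁻¹ - U * G * X⁻¹) =
      ((e : ℤ) : RatFun n) • (1 : Matrix (Fin n) (Fin n) (RatFun n)) - Y * G * X⁻¹ := by
    rw [mul_sub, mul_smul_comm, mul_nonsing_inv _ hu, ← Matrix.mul_assoc, ← Matrix.mul_assoc, hXU]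
  refine ⟨((e : ℤ) : RatFun n) • X⁻¹ - U * G * X⁻¹, G * X⁻¹, G, e, c, d, n - p - q + 1, ?_,
    isKrylovShape_phi hpq hp hq, hΦ, rfl, ?_, ?_, ?_⟩
  · rw [hasGrad_smul_iff]
    intro D
    have hs : D (signS n p q : RatFun n) = 0 := D.map_intCast _
    have hDdet := derivation_det_of_field D X hX
    have hDΦ := derivation_det_of_field D (krylovMat U c d) hΦ
    rw [trace_inv_mul_map_krylovMat, ← hG, map_derivation_inv_mul D hX, ← hU, ← hXdef,
      ← hYdef] at hDΦ
    have h₁ : (G * (X⁻¹ * (Y.map D - X.map D * U))).trace =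
        (G * X⁻¹ * Y.map D).trace - (U * G * X⁻¹ * X.map D).trace := by
      rw [mul_sub, mul_sub, trace_sub]
      congr 1
      · simp only [Matrix.mul_assoc]
      · rw [← Matrix.mul_assoc, ← Matrix.mul_assoc, trace_mul_comm _ U]
        simp only [Matrix.mul_assoc]
    have hpow : D (X.det ^ e) = e * X.det ^ e * (X⁻¹ * X.map D).trace := by
      rw [D.leibniz_pow, hDdet, nsmul_eq_mul, smul_eq_mul, he, Nat.add_sub_cancel, pow_succ]
      ring
    rw [funPhi, matPhi_eq, D.leibniz, D.leibniz, hs, hpow, hDΦ, h₁, sub_mul, trace_sub,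
      smul_mul_assoc, trace_smul]
    simp only [smul_eq_mul, Int.cast_natCast, mul_zero, add_zero]
    ring
  · rw [sub_mul, smul_mul_assoc, nonsing_inv_mul _ hu, Matrix.mul_assoc, nonsing_inv_mul _ hu,
      mul_one]
  · rw [Matrix.mul_assoc]
  · rw [hXA, Matrix.mul_assoc, sub_add_cancel]

theorem HasGradH.pair_H (hf : HasGradH f) (hg : HasGradH g) : IsLogCanonicalPair f g := by
  obtain ⟨B, r, r', s, s', h₁, h₂⟩ := hf
  obtain ⟨B', q, q', u, u', h₁', h₂'⟩ := hg
  exact .of_hasGrad h₁ h₁' (bracketForm_Y_Y h₂ h₂' le_rfl le_rfl)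

theorem HasGradH.pair_F (hf : HasGradH f) (hg : HasGradF g) : IsLogCanonicalPair f g := by
  obtain ⟨B, r, r', s, s', h₁, h₂⟩ := hf
  obtain ⟨A', B', q, u, u', h₁', h₂'⟩ := hg
  have hR := h₂.isRowProj_right.diag_mem
  rw [mul_zero, zero_add] at hR
  exact .of_hasGrad h₁ h₁' (bracketForm_mem_of_depends_on_Y (h₂.isRowProj_Y.lowInt le_rfl) hR
    (h₂'.lowInt_left le_rfl le_rfl).2 (h₂'.upInt_right le_rfl))

theorem HasGradH.pair_Phi (hf : HasGradH f) (hg : HasGradPhi g) : IsLogCanonicalPair f g := by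
  obtain ⟨B, r, r', s, s', h₁, h₂⟩ := hf
  obtain ⟨A', B', G, e, c, d, D, h₁', h₂'⟩ := hg
  have hR := h₂.isRowProj_right.diag_mem
  rw [mul_zero, zero_add] at hR
  exact .of_hasGrad h₁ h₁' (bracketForm_mem_of_depends_on_Y (h₂.isRowProj_Y.lowInt le_rfl) hR
    h₂'.lowInt_left.2 h₂'.upInt_right)

theorem HasGradH.pair_G (hf : HasGradH f) (hg : HasGradG g) : IsLogCanonicalPair f g := by
  obtain ⟨B, r, r', s, s', h₁, h₂⟩ := hf
  obtain ⟨A', q, u, v, u', h₁', h₂'⟩ := hg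
  have hR := h₂.isRowProj_right.diag_mem
  have hL := h₂'.isRowProj_X.diag_mem
  rw [mul_zero, zero_add] at hR
  exact .of_hasGrad h₁ h₁' (bracketForm_mem_of_depends_on_Y (h₂.isRowProj_Y.lowInt le_rfl) hR
    (by simpa using hL) (h₂'.upInt_right le_rfl))

theorem HasGradF.pair_F (hf : HasGradF f) (hg : HasGradF g) : IsLogCanonicalPair f g := by
  obtain ⟨A, B, r, s, s', h₁, h₂⟩ := hf
  obtain ⟨A', B', q, u, u', h₁', h₂'⟩ := hg
  exact .of_hasGrad h₁ h₁'
    (bracketForm_minor_minor h₂ h₂' le_rfl le_rfl le_rfl le_rfl le_rfl le_rfl)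

theorem HasGradF.pair_Phi (hf : HasGradF f) (hg : HasGradPhi g) : IsLogCanonicalPair f g := by
  obtain ⟨A, B, r, s, s', h₁, h₂⟩ := hf
  obtain ⟨A', B', G, e, c, d, D, h₁', h₂'⟩ := hg
  exact .of_hasGrad h₁ h₁' (bracketForm_minor_krylov h₂ h₂' le_rfl le_rfl le_rfl)

theorem HasGradF.pair_G (hf : HasGradF f) (hg : HasGradG g) : IsLogCanonicalPair f g := by
  obtain ⟨A, B, r, s, s', h₁, h₂⟩ := hf
  obtain ⟨A', q, u, v, u', h₁', h₂'⟩ := hg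
  have hR := h₂'.upInt_right le_rfl
  rw [mul_zero, add_zero] at hR
  exact .of_hasGrad h₁ h₁' (bracketForm_mem_of_depends_on_X (h₂.lowInt_left le_rfl le_rfl)
    (h₂.upInt_right le_rfl) h₂'.isRowProj_X.diag_mem hR)

theorem HasGradPhi.pair_Phi (hf : HasGradPhi f) (hg : HasGradPhi g) :
    IsLogCanonicalPair f g := by
  obtain ⟨A, B, G, e, c, d, D, h₁, h₂⟩ := hf
  obtain ⟨A', B', G', e', c', d', D', h₁', h₂'⟩ := hg
  exact .of_hasGrad h₁ h₁' (bracketForm_krylov_krylov h₂ h₂')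

theorem HasGradPhi.pair_G (hf : HasGradPhi f) (hg : HasGradG g) : IsLogCanonicalPair f g := by
  obtain ⟨A, B, G, e, c, d, D, h₁, h₂⟩ := hf
  obtain ⟨A', q, u, v, u', h₁', h₂'⟩ := hg
  have hR := h₂'.upInt_right le_rfl
  rw [mul_zero, add_zero] at hR
  exact .of_hasGrad h₁ h₁' (bracketForm_mem_of_depends_on_X h₂.lowInt_left
    h₂.upInt_right h₂'.isRowProj_X.diag_mem hR)

theorem HasGradG.pair_G (hf : HasGradG f) (hg : HasGradG g) : IsLogCanonicalPair f g := by
  obtain ⟨A, r, s, t, s', h₁, h₂⟩ := hf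
  obtain ⟨A', q, u, v, u', h₁', h₂'⟩ := hg
  exact .of_hasGrad h₁ h₁' (bracketForm_X_X h₂ h₂' le_rfl le_rfl)

end

theorem mainFun_hasGrad {n : ℕ} (a : MainIndex n) (ha : mainFun a ≠ 0) :
    HasGradH (mainFun a) ∨ HasGradF (mainFun a) ∨ HasGradPhi (mainFun a) ∨
      HasGradG (mainFun a) := by
  cases a with
  | g i j hij => exact .inr (.inr (.inr (hasGradG_funG i j hij ha)))
  | h i j hij => exact .inl (hasGradH_funH i j hij ha)
  | f p q hp hq hpq => exact .inr (.inl (hasGradF_funF p q hpq ha))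
  | φ p q hp hq hpq => exact .inr (.inr (.inl (hasGradPhi_funPhi hpq hp hq ha)))

theorem isLogCanonicalPair_mainFun {n : ℕ} (a b : MainIndex n) :
    IsLogCanonicalPair (mainFun a) (mainFun b) := by
  by_cases ha : mainFun a = 0
  · rw [ha]; exact isLogCanonicalPair_zero_left
  by_cases hb : mainFun b = 0
  · rw [hb]; exact isLogCanonicalPair_zero_left.symm
  rcases mainFun_hasGrad a ha with ha | ha | ha | ha <;>
    rcases mainFun_hasGrad b hb with hb | hb | hb | hb
  · exact ha.pair_H hb
  · exact ha.pair_F hb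
  · exact ha.pair_Phi hb
  · exact ha.pair_G hb
  · exact (hb.pair_F ha).symm
  · exact ha.pair_F hb
  · exact ha.pair_Phi hb
  · exact ha.pair_G hb
  · exact (hb.pair_Phi ha).symm
  · exact (hb.pair_Phi ha).symm
  · exact ha.pair_Phi hb
  · exact ha.pair_G hb
  · exact (hb.pair_G ha).symm
  · exact (hb.pair_G ha).symm
  · exact (hb.pair_G ha).symm
  · exact ha.pair_G hb

/-! ### The Casimir functions -/

/-- The derivation of `k[λ]` that applies `D` to the coefficients. -/
noncomputable def coeffDerivation {R k : Type*} [CommRing R] [CommRing k] [Algebra R k]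
    (D : Derivation R k k) : Derivation R (Polynomial k) (Polynomial k) :=
  (PolynomialModule.equivPolynomialSelf (R := k)).toLinearMap.compDer D.mapCoeffs

section
variable {n : ℕ} {k : Type*} [Field k]

theorem coeff_coeffDerivation {R : Type*} [CommRing R] [Algebra R k]
    (D : Derivation R k k) (p : Polynomial k) (i : ℕ) :
    (coeffDerivation D p).coeff i = D (p.coeff i) := rfl

/-- The pencil `X + λ Y`. -/
noncomputable def pencil (X Y : Matrix (Fin n) (Fin n) k) : Matrix (Fin n) (Fin n) (Polynomial k) :=
  X.map Polynomial.C + (Polynomial.X : Polynomial k) • Y.map Polynomial.C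

theorem map_coeff_mul_pencil (X Y : Matrix (Fin n) (Fin n) k)
    (M : Matrix (Fin n) (Fin n) (Polynomial k)) (i : ℕ) :
    (M * pencil X Y).map (fun p => p.coeff (i + 1)) =
      M.map (fun p => p.coeff (i + 1)) * X + M.map (fun p => p.coeff i) * Y := by
  ext a b
  simp only [pencil, map_apply, mul_apply, Matrix.add_apply, Matrix.smul_apply, smul_eq_mul,
    Polynomial.finsetSum_coeff, ← Finset.sum_add_distrib]
  refine Finset.sum_congr rfl fun j _ => ?_
  rw [mul_add, ← mul_assoc, Polynomial.coeff_add, Polynomial.coeff_mul_C, Polynomial.coeff_mul_C,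
    Polynomial.coeff_mul_X]

theorem map_coeff_pencil_mul (X Y : Matrix (Fin n) (Fin n) k)
    (M : Matrix (Fin n) (Fin n) (Polynomial k)) (i : ℕ) :
    (pencil X Y * M).map (fun p => p.coeff (i + 1)) =
      X * M.map (fun p => p.coeff (i + 1)) + Y * M.map (fun p => p.coeff i) := by
  ext a b
  simp only [pencil, map_apply, mul_apply, Matrix.add_apply, Matrix.smul_apply, smul_eq_mul,
    Polynomial.finsetSum_coeff, ← Finset.sum_add_distrib]
  refine Finset.sum_congr rfl fun j _ => ?_
  rw [add_mul, mul_assoc, Polynomial.coeff_add, Polynomial.coeff_C_mul, Polynomial.coeff_X_mul,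
    Polynomial.coeff_C_mul]

theorem map_coeff_smul_one (p : Polynomial k) (i : ℕ) :
    (p • (1 : Matrix (Fin n) (Fin n) (Polynomial k))).map (fun p => p.coeff i) =
      p.coeff i • (1 : Matrix (Fin n) (Fin n) k) := by
  ext a b
  by_cases h : a = b
  · subst h; simp
  · simp [h]

theorem trace_map_coeff (M : Matrix (Fin n) (Fin n) (Polynomial k)) (i : ℕ) :
    M.trace.coeff i = (M.map fun p => p.coeff i).trace := by
  simp [trace, Polynomial.finsetSum_coeff]

theorem derivation_coeff_det_pencil {R : Type*} [CommRing R] [Algebra R k]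
    (D : Derivation R k k) (X Y : Matrix (Fin n) (Fin n) k) (i : ℕ) :
    D ((pencil X Y).det.coeff (i + 1)) =
      ((pencil X Y).adjugate.map (fun p => p.coeff (i + 1)) * X.map D).trace +
        ((pencil X Y).adjugate.map (fun p => p.coeff i) * Y.map D).trace := by
  have h : (pencil X Y).map (coeffDerivation D) = pencil (X.map D) (Y.map D) := by
    ext a b j
    rw [map_apply, coeff_coeffDerivation]
    simp only [pencil, Matrix.add_apply, Matrix.smul_apply, map_apply, smul_eq_mul]
    cases j with
    | zero => simp
    | succ j => simp [Polynomial.coeff_C, apply_ite D]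
  rw [← coeff_coeffDerivation, derivation_det, h, trace_map_coeff, map_coeff_mul_pencil, trace_add]

/-- A function whose left and right gradients are the same scalar matrix Poisson commutes with
everything. -/
theorem bracketForm_eq_zero_of_scalar [CharZero k] {X Y A B : Matrix (Fin n) (Fin n) k} {c : k}
    (hR : X * A + Y * B = c • (1 : Matrix (Fin n) (Fin n) k))
    (hL : A * X + B * Y = c • (1 : Matrix (Fin n) (Fin n) k)) (A' B' : Matrix (Fin n) (Fin n) k) :
    bracketForm X Y A B A' B' = 0 := by
  have hP : ∀ η : Matrix (Fin n) (Fin n) k, rPlusForm (c • 1) η = 2⁻¹ * c * η.trace := by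
    intro η
    have : opRPlus (c • (1 : Matrix (Fin n) (Fin n) k)) = (2⁻¹ * c) • 1 := by
      ext i j
      rcases lt_trichotomy i j with h | rfl | h
      · simp [opRPlus, opR, projPos, projNeg, h, h.ne]
      · simp [opRPlus, opR, projPos, projNeg]
      · simp [opRPlus, opR, projPos, projNeg, h, h.ne']
    rw [rPlusForm, this, smul_mul_assoc, one_mul, trace_smul, smul_eq_mul]
  have h₁ : (A * X * (B' * Y)).trace = c * (B' * Y).trace - (B * Y * (B' * Y)).trace := by
    rw [eq_sub_of_add_eq hL, sub_mul, trace_sub, smul_mul_assoc, one_mul, trace_smul, smul_eq_mul]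
  have h₂ : (X * A * (Y * B')).trace = c * (Y * B').trace - (Y * B * (Y * B')).trace := by
    rw [eq_sub_of_add_eq hR, sub_mul, trace_sub, smul_mul_assoc, one_mul, trace_smul, smul_eq_mul]
  rw [bracketForm, hR, hL, hP, hP, h₁, h₂, trace_mul_mul_comm, trace_add, trace_add,
    trace_mul_comm X, trace_mul_comm Y]
  ring

end

/-- The gradients of `c_i` are coefficients of the adjugate of `X + λ Y`, and the product of a
matrix with its adjugate is scalar. -/
theorem isCasimir_casimirFun {n i : ℕ} (hi : 1 ≤ i) : IsCasimir (casimirFun (n := n) i) := by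
  intro f
  obtain ⟨i, rfl⟩ := Nat.exists_eq_add_of_le' hi
  set X := genX n
  set Y := genY n
  obtain ⟨s, hs⟩ : ∃ s : ℤ, casimirFun (n := n) (i + 1) = s * (pencil X Y).det.coeff (i + 1) := by
    by_cases h : Even n
    · exact ⟨(-1) ^ (i + 1), by simp [casimirFun, funC, h, pencil, X, Y]⟩
    · exact ⟨1, by simp [casimirFun, funC, h, pencil, X, Y]⟩
  set A := (pencil X Y).adjugate.map (fun p => p.coeff (i + 1))
  set B := (pencil X Y).adjugate.map (fun p => p.coeff i)
  have hg : HasGrad (casimirFun (n := n) (i + 1)) ((s : RatFun n) • A) ((s : RatFun n) • B) := by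
    intro D
    rw [hs, D.leibniz, derivation_coeff_det_pencil, D.map_intCast, smul_zero, add_zero,
      smul_mul_assoc, smul_mul_assoc, trace_smul, trace_smul]
    simp only [smul_eq_mul]
    ring
  have hR : X * A + Y * B = (pencil X Y).det.coeff (i + 1) • 1 := by
    rw [← map_coeff_pencil_mul, mul_adjugate, map_coeff_smul_one]
  have hL : A * X + B * Y = (pencil X Y).det.coeff (i + 1) • 1 := by
    rw [← map_coeff_mul_pencil, adjugate_mul, map_coeff_smul_one]
  rw [bracketD_eq_bracketForm, hg.nablaX_eq, hg.nablaY_eq]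
  refine bracketForm_eq_zero_of_scalar (c := s * (pencil X Y).det.coeff (i + 1)) ?_ ?_ _ _
  · rw [mul_smul_comm, mul_smul_comm, ← smul_add, hR, smul_smul]
  · rw [smul_mul_assoc, smul_mul_assoc, ← smul_add, hL, smul_smul]

theorem isLogCanonical_familyF (n : ℕ) : IsLogCanonical (familyF n) := by
  have h : ∀ a b, IsLogCanonicalPair (familyF n a) (familyF n b) := by
    have hc : ∀ (c : CasimirIndex n) (g : RatFun n),
        IsLogCanonicalPair (casimirFun (n := n) c.1) g := fun c g =>
      ⟨0, by rw [isCasimir_casimirFun c.2.1 g]; simp⟩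
    rintro (a | a) (b | b)
    · exact isLogCanonicalPair_mainFun a b
    · exact (hc b _).symm
    · exact hc a _
    · exact hc a _
  choose ω hω using h
  exact ⟨ω, hω⟩

/-! ### Specialization of rational functions -/

/-- For a point of affine space, the local ring at that point maps to the field of rational
functions and to the residue field. -/
theorem exists_specialization {n : ℕ} (pt : Coord n → ℂ) :
    ∃ (A : Type) (_ : CommRing A) (ι : A →+* RatFun n) (ev : A →+* ℂ) (x : Coord n → A),
      (∀ v, ι (x v) = coordFun v) ∧ (∀ v, ev (x v) = pt v) ∧ (∀ a, ev a ≠ 0 → ι a ≠ 0) ∧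
        ∀ a, ev a ≠ 0 → IsUnit a := by
  set ev₀ : PolyFun n →+* ℂ := MvPolynomial.eval pt
  have hprime : (RingHom.ker ev₀).IsPrime := RingHom.ker_isPrime ev₀
  set S := (RingHom.ker ev₀).primeCompl
  have hS : ∀ p : S, ev₀ p ≠ 0 := fun p hp => p.2 hp
  have hι : ∀ p : S, IsUnit (algebraMap (PolyFun n) (RatFun n) p) := fun p => by
    rw [isUnit_iff_ne_zero]
    intro h
    have : (p : PolyFun n) = 0 :=
      IsFractionRing.injective (PolyFun n) (RatFun n) (by simpa using h)
    exact hS p (by rw [this, map_zero])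
  have hev : ∀ p : S, IsUnit (ev₀ p) := fun p => isUnit_iff_ne_zero.2 (hS p)
  have hunit : ∀ a : Localization S, IsLocalization.lift (M := S) hev a ≠ 0 → IsUnit a := by
    intro a ha
    obtain ⟨p, s, rfl⟩ := IsLocalization.exists_mk'_eq S a
    have hp : p ∈ S := by
      intro hp
      refine ha ?_
      rw [IsLocalization.lift_mk'_spec, mul_zero]
      exact hp
    exact (IsLocalization.AtPrime.isUnit_mk'_iff _ (RingHom.ker ev₀) p s).2 hp
  refine ⟨Localization S, inferInstance, IsLocalization.lift (M := S) hι,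
    IsLocalization.lift (M := S) hev,
    fun v => algebraMap (PolyFun n) (Localization S) (MvPolynomial.X v), fun v => ?_,
    fun v => ?_, fun a ha => ?_, hunit⟩
  · rw [IsLocalization.lift_eq]; rfl
  · rw [IsLocalization.lift_eq]; exact MvPolynomial.eval_X v
  · exact ((hunit a ha).map _).ne_zero

/-- Simultaneous specialization of `X`, `Y` and `U = X⁻¹ Y` at a point `(X₀, Y₀)` with `X₀`
invertible. -/
theorem exists_specialization_matrix {n : ℕ} (X₀ Y₀ : Matrix (Fin n) (Fin n) ℂ) :
    ∃ (A : Type) (_ : CommRing A) (ι : A →+* RatFun n) (ev : A →+* ℂ)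
      (X Y U : Matrix (Fin n) (Fin n) A), (∀ a, ev a ≠ 0 → ι a ≠ 0) ∧
      X.map ι = genX n ∧ Y.map ι = genY n ∧ X.map ev = X₀ ∧ Y.map ev = Y₀ ∧
      (X₀.det ≠ 0 → U.map ι = (genX n)⁻¹ * genY n ∧ U.map ev = X₀⁻¹ * Y₀) := by
  obtain ⟨A, hA, ι, ev, x, h₁, h₂, h₃, h₄⟩ := exists_specialization
    (fun v : Coord n => Sum.elim (fun p => X₀ p.1 p.2) (fun p => Y₀ p.1 p.2) v)
  set X : Matrix (Fin n) (Fin n) A := of fun i j => x (.inl (i, j))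
  set Y : Matrix (Fin n) (Fin n) A := of fun i j => x (.inr (i, j))
  have hX : X.map ι = genX n := Matrix.ext fun i j => h₁ _
  have hY : Y.map ι = genY n := Matrix.ext fun i j => h₁ _
  have hX₀ : X.map ev = X₀ := Matrix.ext fun i j => h₂ _
  have hY₀ : Y.map ev = Y₀ := Matrix.ext fun i j => h₂ _
  refine ⟨A, hA, ι, ev, X, Y, X⁻¹ * Y, h₃, hX, hY, hX₀, hY₀, fun hdet => ?_⟩
  have hu : IsUnit X.det := h₄ _ (by rw [RingHom.map_det, RingHom.mapMatrix_apply, hX₀]; exact hdet)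
  have hXX : X⁻¹ * X = 1 := nonsing_inv_mul _ hu
  have hinv : ∀ {k : Type} [Field k] (φ : A →+* k), (X⁻¹).map φ = (X.map φ)⁻¹ := by
    intro k _ φ
    refine (inv_eq_left_inv ?_).symm
    rw [← Matrix.map_mul, hXX, Matrix.map_one _ φ.map_zero φ.map_one]
  rw [Matrix.map_mul, Matrix.map_mul, hinv, hinv, hX, hY, hX₀, hY₀]
  exact ⟨rfl, rfl⟩

section
variable {n : ℕ}

/-- The matrix sending the basis vector `c` to the basis vector `τ c`. -/
def funMat (k : Type*) [CommRing k] (τ : Fin n → Fin n) : Matrix (Fin n) (Fin n) k :=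
  (1 : Matrix (Fin n) (Fin n) k).submatrix id τ

theorem funMat_pow (k : Type*) [CommRing k] (τ : Fin n → Fin n) (s : ℕ) :
    funMat k τ ^ s = funMat k τ^[s] := by
  induction s with
  | zero => simp [funMat]
  | succ s ih =>
    rw [pow_succ, ih]
    ext i j
    simp [funMat, mul_apply, one_apply]

theorem det_funMat_ne_zero {k : Type*} [Field k] {τ : Fin n → Fin n} (hτ : Function.Injective τ) :
    (funMat k τ).det ≠ 0 := by
  have h := det_permute' (Equiv.ofBijective τ (Finite.injective_iff_bijective.1 hτ))
    (1 : Matrix (Fin n) (Fin n) k)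
  rw [det_one, mul_one] at h
  have e : funMat k τ = (1 : Matrix (Fin n) (Fin n) k).submatrix id
    (Equiv.ofBijective τ (Finite.injective_iff_bijective.1 hτ)) := rfl
  rw [e, h]
  rcases Int.units_eq_one_or (Equiv.Perm.sign
    (Equiv.ofBijective τ (Finite.injective_iff_bijective.1 hτ))) with h | h <;> rw [h] <;> simp

end

/-! ### Unipotent triangular decompositions -/

/-- If the principal minors of `M` on the indices above each `i` are nonzero, then a unipotent upper
triangular `N` makes `N * M` lower triangular. -/
theorem exists_unipotent_mul_lower {ι k : Type*} [Fintype ι] [LinearOrder ι] [Field k]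
    (M : Matrix ι ι k)
    (h : ∀ i, (M.submatrix (Subtype.val : {p // i < p} → ι) Subtype.val).det ≠ 0) :
    ∃ N : Matrix ι ι k, (∀ i j, j < i → N i j = 0) ∧ (∀ i, N i i = 1) ∧
      ∀ i j, i < j → (N * M) i j = 0 := by
  set v : ∀ i, {p // i < p} → k := fun i =>
    vecMul (fun q : {p // i < p} => -M i q) (M.submatrix Subtype.val Subtype.val)⁻¹ with hv
  have hv' : ∀ i (q : {p // i < p}), ∑ p, v i p * M p q = -M i q := by
    intro i
    have := vecMul_vecMul (fun q : {p // i < p} => -M i q)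
      (M.submatrix (Subtype.val : {p // i < p} → ι) (Subtype.val : {p // i < p} → ι))⁻¹
      (M.submatrix (Subtype.val : {p // i < p} → ι) (Subtype.val : {p // i < p} → ι))
    rw [nonsing_inv_mul _ (isUnit_iff_ne_zero.2 (h i)), vecMul_one] at this
    exact fun q => congrFun this q
  refine ⟨of fun i j => if hij : i < j then v i ⟨j, hij⟩ else if i = j then 1 else 0,
    fun i j hij => ?_, fun i => ?_, fun i j hij => ?_⟩
  · simp [hij.not_gt, hij.ne']
  · simp
  · have hs := hv' i ⟨j, hij⟩
    rw [← sub_eq_zero, sub_neg_eq_add] at hs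
    refine Eq.trans ?_ hs
    rw [mul_apply, ← Fintype.sum_subtype_add_sum_subtype (fun p => i < p)]
    refine congrArg₂ _ (Finset.sum_congr rfl fun p _ => ?_) ?_
    · rw [of_apply, dif_pos p.2]
    · rw [Finset.sum_eq_single ⟨i, lt_irrefl i⟩]
      · simp
      · rintro ⟨p, hp⟩ _ hne
        have : i ≠ p := fun h => hne (Subtype.ext h.symm)
        simp [hp, this]
      · simp

/-! ### Functions that do not vanish identically -/

section
variable {n : ℕ}

theorem funG_genX_ne_zero (i j : Fin n) (hij : j ≤ i) : funG (genX n) i j hij ≠ 0 := by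
  have hle := Fin.le_def.1 hij
  obtain ⟨A, _, ι, ev, X, Y, U, h, hX, -, hX₀, -, -⟩ := exists_specialization_matrix
    (of fun a b : Fin n => if (a : ℕ) = b + (i - j) then (1 : ℂ) else 0) 0
  have e : funG (genX n) i j hij = ι (of fun a b : Fin (n - i) =>
      X ⟨i + a, by omega⟩ ⟨j + b, by omega⟩).det := by
    rw [RingHom.map_det, funG, ← hX]; rfl
  rw [e]
  refine h _ ?_
  rw [RingHom.map_det]
  convert one_ne_zero (α := ℂ)
  rw [← det_one (n := Fin (n - i))]
  congr 1
  ext a b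
  have := congrFun₂ hX₀ ⟨i + a, by omega⟩ ⟨j + b, by omega⟩
  simp only [map_apply, of_apply] at this
  simp only [RingHom.mapMatrix_apply, map_apply, of_apply, this, one_apply, Fin.ext_iff]
  congr 1
  exact propext (by omega)

theorem funH_genY_ne_zero (i j : Fin n) (hij : i ≤ j) : funH (genY n) i j hij ≠ 0 := by
  have hle := Fin.le_def.1 hij
  obtain ⟨A, _, ι, ev, X, Y, U, h, -, hY, -, hY₀, -⟩ := exists_specialization_matrix
    0 (of fun a b : Fin n => if (b : ℕ) = a + (j - i) then (1 : ℂ) else 0)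
  have e : funH (genY n) i j hij = ι (of fun a b : Fin (n - j) =>
      Y ⟨i + a, by omega⟩ ⟨j + b, by omega⟩).det := by
    rw [RingHom.map_det, funH, ← hY]; rfl
  rw [e]
  refine h _ ?_
  rw [RingHom.map_det]
  convert one_ne_zero (α := ℂ)
  rw [← det_one (n := Fin (n - j))]
  congr 1
  ext a b
  have := congrFun₂ hY₀ ⟨i + a, by omega⟩ ⟨j + b, by omega⟩
  simp only [map_apply, of_apply] at this
  simp only [RingHom.mapMatrix_apply, map_apply, of_apply, this, one_apply, Fin.ext_iff]
  congr 1
  exact propext (by omega)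

theorem funF_ne_zero (p q : ℕ) (hpq : p + q < n) : funF (genX n) (genY n) p q hpq ≠ 0 := by
  obtain ⟨A, _, ι, ev, X, Y, U, h, hX, hY, hX₀, hY₀, -⟩ := exists_specialization_matrix
    (1 : Matrix (Fin n) (Fin n) ℂ)
    (of fun a b : Fin n => if (b : ℕ) = a + p then (1 : ℂ) else 0)
  have e : funF (genX n) (genY n) p q hpq = ι (of fun a b : Fin (p + q) =>
      if h : (b : ℕ) < p then X ⟨n - p - q + a, by omega⟩ ⟨n - p + b, by omega⟩
      else Y ⟨n - p - q + a, by omega⟩ ⟨n - q + (b - p), by omega⟩).det := by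
    rw [RingHom.map_det, funF, ← hX, ← hY]
    congr 1
    ext a b
    simp only [of_apply, RingHom.mapMatrix_apply, map_apply]
    split_ifs <;> rfl
  rw [e]
  refine h _ ?_
  rw [RingHom.map_det]
  set τ : Fin (p + q) → Fin (p + q) := fun b =>
    if h : (b : ℕ) < p then ⟨b + q, by omega⟩ else ⟨b - p, by omega⟩ with hτ
  have hinj : Function.Injective τ := by
    intro b b' hb
    simp only [hτ] at hb
    refine Fin.ext ?_
    split_ifs at hb <;> rw [Fin.ext_iff] at hb <;> simp only at hb <;> omega
  have e' : ev.mapMatrix (of fun a b : Fin (p + q) =>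
      if h : (b : ℕ) < p then X ⟨n - p - q + a, by omega⟩ ⟨n - p + b, by omega⟩
      else Y ⟨n - p - q + a, by omega⟩ ⟨n - q + (b - p), by omega⟩) = funMat ℂ τ := by
    ext a b
    simp only [RingHom.mapMatrix_apply, map_apply, of_apply, funMat, submatrix_apply, id, hτ,
      one_apply]
    split_ifs with h₁ h₂ h₂
    all_goals first
      | have := congrFun₂ hX₀ ⟨n - p - q + a, by omega⟩ ⟨n - p + b, by omega⟩
        simp only [map_apply, one_apply, Fin.ext_iff] at this h₂
        rw [this]
        first | rw [if_pos (by omega)] | rw [if_neg (by omega)]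
      | have := congrFun₂ hY₀ ⟨n - p - q + a, by omega⟩ ⟨n - q + (b - p), by omega⟩
        simp only [map_apply, of_apply, Fin.ext_iff] at this h₂
        rw [this]
        first | rw [if_pos (by omega)] | rw [if_neg (by omega)]
  rw [e']
  exact det_funMat_ne_zero hinj

theorem det_genX_ne_zero : (genX n).det ≠ 0 := by
  obtain ⟨A, _, ι, ev, X, Y, U, h, hX, -, hX₀, -, -⟩ :=
    exists_specialization_matrix (1 : Matrix (Fin n) (Fin n) ℂ) 0
  rw [← hX, ← RingHom.mapMatrix_apply, ← RingHom.map_det]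
  refine h _ ?_
  rw [RingHom.map_det, RingHom.mapMatrix_apply, hX₀, det_one]
  exact one_ne_zero

theorem det_genY_ne_zero : (genY n).det ≠ 0 := by
  obtain ⟨A, _, ι, ev, X, Y, U, h, -, hY, -, hY₀, -⟩ :=
    exists_specialization_matrix 0 (1 : Matrix (Fin n) (Fin n) ℂ)
  rw [← hY, ← RingHom.mapMatrix_apply, ← RingHom.map_det]
  refine h _ ?_
  rw [RingHom.map_det, RingHom.mapMatrix_apply, hY₀, det_one]
  exact one_ne_zero

/-- The principal minors of `Y` do not vanish identically. -/
theorem det_submatrix_genY_ne_zero {m : Type} [Fintype m] [DecidableEq m] {f : m → Fin n}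
    (hf : Function.Injective f) : ((genY n).submatrix f f).det ≠ 0 := by
  obtain ⟨A, _, ι, ev, X, Y, U, h, -, hY, -, hY₀, -⟩ :=
    exists_specialization_matrix 0 (1 : Matrix (Fin n) (Fin n) ℂ)
  rw [← hY, submatrix_map, ← RingHom.mapMatrix_apply, ← RingHom.map_det]
  refine h _ ?_
  rw [RingHom.map_det, RingHom.mapMatrix_apply, ← submatrix_map, hY₀, submatrix_one _ hf, det_one]
  exact one_ne_zero

theorem map_krylovMat {A k : Type*} [CommRing A] [Field k] (φ : A →+* k)
    (U : Matrix (Fin n) (Fin n) A) (c : Fin n → Fin n) (d : Fin n → ℕ) :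
    (of fun a b => (U ^ d b) a (c b)).map φ = krylovMat (U.map φ) c d := by
  ext a b
  have h : (U ^ d b).map φ = U.map φ ^ d b := map_pow φ.mapMatrix U (d b)
  rw [krylovMat, of_apply, ← h]
  rfl

/-- The principal minors of a Krylov matrix of `U = X⁻¹ Y` do not vanish identically if the matrix
specializes to the identity when `U` permutes the basis vectors. -/
theorem det_submatrix_krylovMat_ne_zero {m : Type} [Fintype m] [DecidableEq m] {f : m → Fin n}
    (hf : Function.Injective f) (τ : Fin n → Fin n) (c : Fin n → Fin n) (d : Fin n → ℕ)
    (hτ : ∀ b, τ^[d b] (c b) = b) :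
    ((krylovMat ((genX n)⁻¹ * genY n) c d).submatrix f f).det ≠ 0 := by
  obtain ⟨A, _, ι, ev, X, Y, U, h, -, -, -, -, hU⟩ :=
    exists_specialization_matrix (1 : Matrix (Fin n) (Fin n) ℂ) (funMat ℂ τ)
  obtain ⟨hU, hU₀⟩ := hU (by simp)
  rw [← hU, ← map_krylovMat, submatrix_map, ← RingHom.mapMatrix_apply, ← RingHom.map_det]
  refine h _ ?_
  rw [RingHom.map_det, RingHom.mapMatrix_apply, ← submatrix_map, map_krylovMat, hU₀, inv_one,
    one_mul]
  have e : krylovMat (funMat ℂ τ) c d = 1 := by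
    ext a b
    rw [krylovMat, of_apply, funMat_pow, funMat, submatrix_apply, hτ]
    rfl
  rw [e, submatrix_one _ hf, det_one]
  exact one_ne_zero

theorem det_krylovMat_ne_zero (τ : Fin n → Fin n) (c : Fin n → Fin n) (d : Fin n → ℕ)
    (hτ : Function.Injective fun b => τ^[d b] (c b)) :
    (krylovMat ((genX n)⁻¹ * genY n) c d).det ≠ 0 := by
  obtain ⟨A, _, ι, ev, X, Y, U, h, -, -, -, -, hU⟩ :=
    exists_specialization_matrix (1 : Matrix (Fin n) (Fin n) ℂ) (funMat ℂ τ)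
  obtain ⟨hU, hU₀⟩ := hU (by simp)
  rw [← hU, ← map_krylovMat, ← RingHom.mapMatrix_apply, ← RingHom.map_det]
  refine h _ ?_
  rw [RingHom.map_det, RingHom.mapMatrix_apply, map_krylovMat, hU₀, inv_one, one_mul]
  have e : krylovMat (funMat ℂ τ) c d = funMat ℂ fun b => τ^[d b] (c b) := by
    ext a b
    rw [krylovMat, of_apply, funMat_pow]
    rfl
  rw [e]
  exact det_funMat_ne_zero hτ

/-- `Φ_{kl}` specializes to a permutation matrix when `U` sends `e_n` to `e_1`, `e_j` to `e_{j+1}`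
for `j ≤ n - k - l`, and `e_{n-l+1}, …, e_{n-1}` to `e_{n-k-l+2}, …, e_{n-k}`. -/
theorem funPhi_ne_zero {p q : ℕ} (hpq : p + q ≤ n) (hp : 1 ≤ p) (hq : 1 ≤ q) :
    funPhi (genX n) (genY n) p q hpq ≠ 0 := by
  have hs : (signS n p q : RatFun n) ≠ 0 := by
    rw [signS]
    split_ifs <;> simp
  rw [funPhi, matPhi_eq]
  refine mul_ne_zero (mul_ne_zero hs (pow_ne_zero _ det_genX_ne_zero)) ?_
  set τ : Fin n → Fin n := fun c =>
    if (c : ℕ) = n - 1 then ⟨0, by omega⟩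
    else if h : (c : ℕ) < n - p - q then ⟨c + 1, by omega⟩
    else ⟨c - (n - q) + (n - p - q) + 1, by omega⟩ with hτ
  refine det_krylovMat_ne_zero τ _ _ ?_
  have hlast : ∀ s, s ≤ n - p - q → ∀ c : Fin n, (c : ℕ) = n - 1 → (τ^[s + 1] c : ℕ) = s := by
    intro s
    induction s with
    | zero => intro _ c hc; simp [hτ, hc]
    | succ s ih =>
      intro hs c hc
      have := ih (by omega) c hc
      rw [Function.iterate_succ_apply']
      simp only [hτ] at this ⊢
      rw [if_neg (by omega), dif_pos (by omega)]
      simp only [this]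
  have hval : ∀ b : Fin n, (τ^[phiExp p q b] (phiCol p q hpq b) : ℕ) =
      if (b : ℕ) < p then n - p + b else if (b : ℕ) < p + q - 1 then n - p - q + 1 + (b - p)
        else b - (p + q - 1) := by
    intro b
    by_cases h₁ : (b : ℕ) < p
    · simp [phiExp, phiCol, h₁]
    · by_cases h₂ : (b : ℕ) < p + q - 1
      · have h₃ : (b : ℕ) < p + q := by omega
        simp only [phiExp, phiCol, h₁, h₂, h₃, if_true, if_false, dif_pos, dif_neg,
          not_false_eq_true, Function.iterate_one, hτ]
        rw [if_neg (by omega), dif_neg (by omega)]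
        simp only
        omega
      · obtain ⟨s, hs, hs'⟩ : ∃ s, phiExp p q b = s + 1 ∧ s = b - (p + q - 1) := by
          refine ⟨_, ?_, rfl⟩
          simp only [phiExp]
          split_ifs <;> omega
        have hc : (phiCol p q hpq b : ℕ) = n - 1 := by
          simp only [phiCol]
          split_ifs <;> first | rfl | (simp only; omega)
        rw [hs, hlast s (by omega) _ hc, if_neg h₁, if_neg h₂, hs']
  intro b b' hb
  have h := congrArg Fin.val hb
  simp only [hval] at h
  refine Fin.ext ?_
  split_ifs at h <;> omega

/-- The principal minors of `U w₀`, with `w₀` the longest permutation, do not vanish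
identically. -/
theorem det_submatrix_rev_ne_zero {m : Type} [Fintype m] [DecidableEq m] {f : m → Fin n}
    (hf : Function.Injective f) :
    ((((genX n)⁻¹ * genY n).submatrix id Fin.rev).submatrix f f).det ≠ 0 := by
  obtain ⟨A, _, ι, ev, X, Y, U, h, -, -, -, -, hU⟩ :=
    exists_specialization_matrix (1 : Matrix (Fin n) (Fin n) ℂ) (funMat ℂ Fin.rev)
  obtain ⟨hU, hU₀⟩ := hU (by simp)
  rw [← hU, submatrix_map, submatrix_map, ← RingHom.mapMatrix_apply, ← RingHom.map_det]
  refine h _ ?_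
  rw [RingHom.map_det, RingHom.mapMatrix_apply, ← submatrix_map, ← submatrix_map, hU₀,
    inv_one, one_mul]
  have e : (funMat ℂ (Fin.rev (n := n))).submatrix id Fin.rev = 1 := by
    ext a b
    rw [submatrix_apply, funMat, submatrix_apply, Fin.rev_rev, id, id]
  rw [e, submatrix_one _ hf, det_one]
  exact one_ne_zero

/-! ### Decompositions of generic matrices -/

/-- A lower triangular matrix with ones on the diagonal. -/
def IsLowerUni {n : ℕ} {k : Type*} [Field k] (N : Matrix (Fin n) (Fin n) k) : Prop :=
  (∀ i j, i < j → N i j = 0) ∧ ∀ i, N i i = 1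

theorem exists_lowerUni_mul_upper {k : Type*} [Field k] (M : Matrix (Fin n) (Fin n) k)
    (h : ∀ {m : Type} [Fintype m] [DecidableEq m] {f : m → Fin n}, Function.Injective f →
      (M.submatrix f f).det ≠ 0) :
    ∃ N : Matrix (Fin n) (Fin n) k, IsLowerUni N ∧ ∀ i j, j < i → (N * M) i j = 0 := by
  obtain ⟨N, h₁, h₂, h₃⟩ := exists_unipotent_mul_lower (ι := (Fin n)ᵒᵈ) M
    fun i => h (f := fun p : {p : (Fin n)ᵒᵈ // i < p} => OrderDual.ofDual p.1)
      fun a b hab => Subtype.ext hab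
  exact ⟨N, ⟨fun i j hij => h₁ i j hij, h₂⟩, fun i j hij => h₃ i j hij⟩

theorem exists_mul_lowerUni_upper {k : Type*} [Field k] (M : Matrix (Fin n) (Fin n) k)
    (h : ∀ {m : Type} [Fintype m] [DecidableEq m] {f : m → Fin n}, Function.Injective f →
      (M.submatrix f f).det ≠ 0) :
    ∃ N : Matrix (Fin n) (Fin n) k, IsLowerUni N ∧ ∀ i j, j < i → (M * N) i j = 0 := by
  obtain ⟨N, h₁, h₂, h₃⟩ := exists_unipotent_mul_lower Mᵀ fun i => by
    rw [← transpose_submatrix, det_transpose]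
    exact h (f := fun p : {p : Fin n // i < p} => p.1) Subtype.val_injective
  refine ⟨Nᵀ, ⟨fun i j hij => h₁ j i hij, h₂⟩, fun i j hij => ?_⟩
  have := h₃ j i hij
  rwa [← transpose_transpose N, ← transpose_mul, transpose_apply] at this

end

/-! ### Matrices with entries in a subfield -/

section
variable {L : Type*} [Field L] (K : Subfield L)

theorem det_mem_subfield {m : Type*} [Fintype m] [DecidableEq m] {M : Matrix m m L}
    (h : ∀ i j, M i j ∈ K) : M.det ∈ K := by
  rw [det_apply]
  exact K.sum_mem fun σ _ => by
    rw [Units.smul_def]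
    exact zsmul_mem (K.prod_mem fun i _ => h _ _) _

theorem mul_mem_subfield {l m o : Type*} [Fintype m] {M : Matrix l m L} {N : Matrix m o L}
    (hM : ∀ i j, M i j ∈ K) (hN : ∀ i j, N i j ∈ K) (i : l) (j : o) : (M * N) i j ∈ K := by
  rw [mul_apply]
  exact K.sum_mem fun p _ => K.mul_mem (hM _ _) (hN _ _)

theorem inv_mem_subfield {m : Type*} [Fintype m] [DecidableEq m] {M : Matrix m m L}
    (h : ∀ i j, M i j ∈ K) (i j : m) : M⁻¹ i j ∈ K := by
  rw [inv_def, Matrix.smul_apply, Ring.inverse_eq_inv', smul_eq_mul]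
  refine K.mul_mem (K.inv_mem (det_mem_subfield K h)) ?_
  rw [adjugate_apply]
  refine det_mem_subfield K fun a b => ?_
  rw [updateRow_apply]
  split_ifs
  · rw [Pi.single_apply]
    split_ifs
    exacts [K.one_mem, K.zero_mem]
  · exact h _ _

/-- An entry in the first row of a matrix can be recovered from the determinant and the other
entries if its cofactor is nonzero. -/
theorem entry_mem_of_det_mem {N : ℕ} {M : Matrix (Fin (N + 1)) (Fin (N + 1)) L} (p : Fin (N + 1))
    (hdet : M.det ∈ K) (hrow : ∀ j, j ≠ p → M 0 j ∈ K) (hM : ∀ (i : Fin N) j, M i.succ j ∈ K)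
    (hc : (M.submatrix Fin.succ p.succAbove).det ≠ 0) : M 0 p ∈ K := by
  have hcof : ∀ j : Fin (N + 1), (M.submatrix Fin.succ j.succAbove).det ∈ K := fun j =>
    det_mem_subfield K fun a b => hM _ _
  have hsign : ∀ j : ℕ, ((-1 : L) ^ j) ∈ K := fun j => pow_mem (K.neg_mem K.one_mem) _
  rw [det_succ_row_zero, ← Finset.add_sum_erase _ _ (Finset.mem_univ p)] at hdet
  have hrest : ∑ x ∈ Finset.univ.erase p,
      (-1) ^ (x : ℕ) * M 0 x * (M.submatrix Fin.succ x.succAbove).det ∈ K :=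
    K.sum_mem fun x hx => K.mul_mem (K.mul_mem (hsign _) (hrow x (Finset.ne_of_mem_erase hx)))
      (hcof x)
  have h₁ : (-1) ^ (p : ℕ) * M 0 p * (M.submatrix Fin.succ p.succAbove).det ∈ K := by
    have := K.sub_mem hdet hrest
    rwa [add_sub_cancel_right] at this
  have h₂ := K.mul_mem (K.mul_mem (hsign p) h₁) (K.inv_mem (hcof p))
  have e : (-1) ^ (p : ℕ) * ((-1) ^ (p : ℕ) * M 0 p * (M.submatrix Fin.succ p.succAbove).det) *
      (M.submatrix Fin.succ p.succAbove).det⁻¹ = M 0 p := by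
    have hs : ((-1 : L) ^ (p : ℕ)) * (-1) ^ (p : ℕ) = 1 := by
      rw [← mul_pow, neg_one_mul, neg_neg, one_pow]
    rw [mul_assoc, mul_assoc, mul_assoc, mul_inv_cancel₀ hc, mul_one, ← mul_assoc, hs, one_mul]
  rwa [e] at h₂

/-- Induction on the entries of a matrix, from the last row to the first and from right to left. -/
theorem forall_of_bottom_right {n : ℕ} {P : Fin n → Fin n → Prop}
    (h : ∀ i j, (∀ i' j', i < i' → P i' j') → (∀ j', j < j' → P i j') → P i j) (i j : Fin n) :
    P i j := by
  induction i using WellFoundedGT.induction generalizing j with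
  | ind i ih =>
    induction j using WellFoundedGT.induction with
    | ind j ih' => exact h i j (fun i' j' hi => ih i' hi j') ih'

/-! ### Minors with columns from two matrices -/

/-- The entries of a square matrix, extended by zero. -/
def natEntry {n : ℕ} (M : Matrix (Fin n) (Fin n) L) (i j : ℕ) : L :=
  if h : i < n ∧ j < n then M ⟨i, h.1⟩ ⟨j, h.2⟩ else 0

theorem natEntry_of_lt {n : ℕ} (M : Matrix (Fin n) (Fin n) L) {i j : ℕ} (hi : i < n) (hj : j < n) :
    natEntry M i j = M ⟨i, hi⟩ ⟨j, hj⟩ := dif_pos ⟨hi, hj⟩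

theorem natEntry_mem {n : ℕ} {M : Matrix (Fin n) (Fin n) L} {i j : ℕ}
    (h : ∀ hi : i < n, ∀ hj : j < n, M ⟨i, hi⟩ ⟨j, hj⟩ ∈ K) : natEntry M i j ∈ K := by
  rw [natEntry]
  split_ifs with hij
  exacts [h _ _, K.zero_mem]

end

section
variable {α : Type*}

/-- The square matrix of size `N` on the rows `r, r + 1, …` whose first `k` columns are the last `k`
of the columns `0, …, n - 1` of `x` and whose other columns are the last `N - k` of those of `y`. -/
def corner (x y : ℕ → ℕ → α) (n r k N : ℕ) : Matrix (Fin N) (Fin N) α :=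
  of fun a b => if (b : ℕ) < k then x (r + a) (n - k + b) else y (r + a) (n - N + b)

theorem corner_submatrix_zero (x y : ℕ → ℕ → α) {n r k N : ℕ} (hk : k + 1 ≤ n) (hN : N + 1 ≤ n) :
    (corner x y n r (k + 1) (N + 1)).submatrix Fin.succ (Fin.succAbove 0) =
      corner x y n (r + 1) k N := by
  ext a b
  simp only [corner, submatrix_apply, of_apply, Fin.zero_succAbove, Fin.val_succ,
    Nat.add_lt_add_iff_right]
  rw [show r + (a + 1) = r + 1 + (a : ℕ) by omega,
    show n - (k + 1) + (b + 1) = n - k + (b : ℕ) by omega,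
    show n - (N + 1) + (b + 1) = n - N + (b : ℕ) by omega]

theorem corner_submatrix_middle (x y : ℕ → ℕ → α) {n r k N : ℕ} (hk : k < N + 1) (hN : N + 1 ≤ n) :
    (corner x y n r k (N + 1)).submatrix Fin.succ (Fin.succAbove ⟨k, hk⟩) =
      corner x y n (r + 1) k N := by
  ext a b
  simp only [corner, submatrix_apply, of_apply, Fin.val_succ]
  rw [show r + (a + 1) = r + 1 + (a : ℕ) by omega]
  by_cases hb : (b : ℕ) < k
  · rw [Fin.succAbove_of_castSucc_lt _ _ (by simpa [Fin.lt_def] using hb)]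
    simp [hb]
  · rw [Fin.succAbove_of_le_castSucc _ _ (by simpa [Fin.le_def] using hb)]
    have : ¬ (b : ℕ) + 1 < k := by omega
    simp only [Fin.val_succ, this, hb, if_false]
    rw [show n - (N + 1) + (b + 1) = n - N + (b : ℕ) by omega]

end

section
variable {L : Type*} [Field L] (K : Subfield L)

/-- The top left entry of a corner minor is determined by the minor and the other entries. -/
theorem entry_mem_of_corner_left {x y : ℕ → ℕ → L} {n r k N : ℕ} (hk : k + 1 ≤ n) (hN : N + 1 ≤ n)
    (hdet : (corner x y n r (k + 1) (N + 1)).det ∈ K) (hc : (corner x y n (r + 1) k N).det ≠ 0)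
    (hx : ∀ i j, r < i → x i j ∈ K) (hx' : ∀ j, n - (k + 1) < j → x r j ∈ K)
    (hy : ∀ i j, r ≤ i → y i j ∈ K) : x r (n - (k + 1)) ∈ K := by
  have h := entry_mem_of_det_mem K 0 hdet (fun j hj => ?_) (fun i j => ?_)
    (by rwa [corner_submatrix_zero x y hk hN])
  · simpa [corner] using h
  · have hj : (j : ℕ) ≠ 0 := fun h => hj (Fin.ext h)
    simp only [corner, of_apply]
    split_ifs
    · exact hx' _ (by omega)
    · exact hy _ _ (by omega)
  · simp only [corner, of_apply, Fin.val_succ]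
    split_ifs
    · exact hx _ _ (by omega)
    · exact hy _ _ (by omega)

/-- The first entry of the second matrix in a corner minor is determined by the minor and the other
entries. -/
theorem entry_mem_of_corner_right {x y : ℕ → ℕ → L} {n r k N : ℕ} (hk : k ≤ N) (hN : N + 1 ≤ n)
    (hdet : (corner x y n r k (N + 1)).det ∈ K) (hc : (corner x y n (r + 1) k N).det ≠ 0)
    (hx : ∀ i j, r ≤ i → x i j ∈ K) (hy : ∀ i j, r < i → y i j ∈ K)
    (hy' : ∀ j, n - (N + 1) + k < j → y r j ∈ K) : y r (n - (N + 1) + k) ∈ K := by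
  have h := entry_mem_of_det_mem K ⟨k, by omega⟩ hdet (fun j hj => ?_) (fun i j => ?_)
    (by rwa [corner_submatrix_middle x y (by omega) hN])
  · simpa [corner] using h
  · have hj : (j : ℕ) ≠ k := fun h => hj (Fin.ext h)
    simp only [corner, of_apply]
    split_ifs
    · exact hx _ _ (by omega)
    · exact hy' _ (by omega)
  · simp only [corner, of_apply, Fin.val_succ]
    split_ifs
    · exact hx _ _ (by omega)
    · exact hy _ _ (by omega)

end

section
variable {L : Type*} [Field L] {n : ℕ}

theorem IsLowerUni.det_eq_one {R : Matrix (Fin n) (Fin n) L} (hR : IsLowerUni R) : R.det = 1 := by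
  rw [det_of_isLowerTriangular R fun i j hij => hR.1 i j hij]
  exact Finset.prod_eq_one fun i _ => hR.2 i

/-- Multiplying `Y` on the right by a unipotent lower triangular matrix does not change the minors
with columns from the right ends of `X` and `Y`. -/
theorem det_corner_mul (x : ℕ → ℕ → L) (Y : Matrix (Fin n) (Fin n) L)
    {R : Matrix (Fin n) (Fin n) L} (hR : IsLowerUni R) {r k N : ℕ} (hN : N ≤ n) :
    (corner x (natEntry (Y * R)) n r k N).det = (corner x (natEntry Y) n r k N).det := by
  set G : Matrix (Fin N) (Fin N) L := of fun a b =>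
    if (b : ℕ) < k then (if a = b then 1 else 0)
    else R ⟨n - N + a, by omega⟩ ⟨n - N + b, by omega⟩ with hG
  have hGl : IsLowerUni G := by
    refine ⟨fun a b hab => ?_, fun a => ?_⟩
    · simp only [hG, of_apply, if_neg hab.ne]
      split_ifs
      · rfl
      · exact hR.1 _ _ (Nat.add_lt_add_left (Fin.lt_def.1 hab) _)
    · simp only [hG, of_apply, hR.2, if_true, ite_self]
  have e : corner x (natEntry (Y * R)) n r k N = corner x (natEntry Y) n r k N * G := by
    ext a b
    rw [mul_apply]
    by_cases hb : (b : ℕ) < k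
    · rw [Finset.sum_eq_single b]
      · simp only [hG, of_apply, if_pos hb, if_true, _root_.mul_one]
        simp only [corner, of_apply, if_pos hb]
      · intro c _ hc
        simp only [hG, of_apply, if_pos hb, if_neg hc, MulZeroClass.mul_zero]
      · exact fun h => absurd (Finset.mem_univ b) h
    · simp only [hG, hb, of_apply, if_false, corner]
      by_cases ha : r + (a : ℕ) < n
      · rw [natEntry_of_lt _ ha (by omega), mul_apply]
        symm
        refine Finset.sum_of_injOn (fun c : Fin N => (⟨n - N + c, by omega⟩ : Fin n)) ?_ ?_ ?_ ?_
        · intro c _ c' _ h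
          simpa [Fin.ext_iff] using h
        · simp
        · intro c _ hc
          rw [hR.1 _ _ ?_, mul_zero]
          rw [Fin.lt_def]
          by_contra hlt
          simp only [not_lt] at hlt
          exact hc ⟨⟨c - (n - N), by omega⟩, by simp, Fin.ext (by simp only; omega)⟩
        · intro c _
          by_cases hc : (c : ℕ) < k
          · rw [hR.1 _ _ (by rw [Fin.lt_def]; simp only; omega), mul_zero, mul_zero]
          · rw [if_neg hc, natEntry_of_lt _ ha (by omega)]
      · have hz : ∀ (M : Matrix (Fin n) (Fin n) L) j, natEntry M (r + a) j = 0 := fun M j =>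
          dif_neg fun h => ha h.1
        rw [hz]
        refine (Finset.sum_eq_zero fun c _ => ?_).symm
        by_cases hc : (c : ℕ) < k
        · rw [hR.1 _ _ (by rw [Fin.lt_def]; simp only; omega), mul_zero]
        · rw [if_neg hc, hz, zero_mul]
  rw [e, det_mul, hGl.det_eq_one, mul_one]

theorem funH_eq_det_corner (x : ℕ → ℕ → L) (Y : Matrix (Fin n) (Fin n) L) (i j : Fin n)
    (hij : i ≤ j) : funH Y i j hij = (corner x (natEntry Y) n i 0 (n - j)).det := by
  have := Fin.le_def.1 hij
  rw [funH]
  congr 1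
  ext a b
  simp only [corner, of_apply, Nat.not_lt_zero, if_false]
  rw [natEntry_of_lt _ (by omega) (by omega)]
  congr 2
  omega

theorem funG_eq_det_corner (y : ℕ → ℕ → L) (X : Matrix (Fin n) (Fin n) L) (i j : Fin n)
    (hij : j ≤ i) : funG X i j hij =
      (corner (fun a c => natEntry X a (c - i + j)) y n i (n - i) (n - i)).det := by
  have := Fin.le_def.1 hij
  rw [funG]
  congr 1
  ext a b
  simp only [corner, of_apply, b.2, if_true]
  rw [natEntry_of_lt _ (by omega) (by omega)]
  congr 2
  omega

theorem funF_eq_det_corner (X Y : Matrix (Fin n) (Fin n) L) (p q : ℕ) (hpq : p + q < n) :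
    funF X Y p q hpq = (corner (natEntry X) (natEntry Y) n (n - (p + q)) p (p + q)).det := by
  rw [funF]
  congr 1
  ext a b
  simp only [corner, of_apply]
  split_ifs with h
  · rw [natEntry_of_lt _ (by omega) (by omega)]
    congr 2
    omega
  · rw [natEntry_of_lt _ (by omega) (by omega)]
    congr 2 <;> omega

theorem funPhi_eq_det_corner {X : Matrix (Fin n) (Fin n) L} (hX : X.det ≠ 0)
    (Y : Matrix (Fin n) (Fin n) L) (p q : ℕ) (hpq : p + q ≤ n) (h : p + q = n) :
    funPhi X Y p q hpq = (signS n p q : L) * (corner (natEntry X) (natEntry Y) n 0 p n).det := by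
  rw [funPhi, show n - p - q + 1 = 1 by omega, pow_one, mul_assoc, ← det_mul]
  congr 2
  ext a b
  have hm : ∀ c, ∑ x, X a x * (X⁻¹ * Y) x c = Y a c := fun c => by
    rw [← mul_apply, mul_nonsing_inv_cancel_left _ _ (isUnit_iff_ne_zero.2 hX)]
  have hm' : ∀ c, ∑ x, X a x * (1 : Matrix (Fin n) (Fin n) L) x c = X a c := fun c => by
    rw [← mul_apply, mul_one]
  rw [mul_apply]
  simp only [corner, of_apply, matPhi, zero_add]
  by_cases hb : (b : ℕ) < p
  · simp only [hb, dif_pos, if_true]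
    rw [hm', natEntry_of_lt _ a.2 (by omega)]
  · have hb' : (b : ℕ) < p + q := by omega
    simp only [hb, hb', dif_pos, dif_neg, if_false, not_false_eq_true]
    rw [hm, natEntry_of_lt _ a.2 (by omega)]
    congr 1
    exact Fin.ext (by simp only; omega)

end

/-! ### Recovering `X` and the upper triangular factor of `Y` -/

section
variable {n : ℕ} (K : Subfield (RatFun n))

/-- The `h_{ij}` are also minors of the upper triangular matrix `Y R`, and determine its entries one
by one. -/
theorem mul_lowerUni_mem {R : Matrix (Fin n) (Fin n) (RatFun n)} (hR : IsLowerUni R)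
    (hup : ∀ i j, j < i → (genY n * R) i j = 0)
    (hH : ∀ i j hij, funH (genY n) i j hij ∈ K) (i j : Fin n) : (genY n * R) i j ∈ K := by
  refine forall_of_bottom_right (P := fun i j => (genY n * R) i j ∈ K) (fun i j h₁ h₂ => ?_) i j
  rcases lt_or_ge j i with hij | hij
  · rw [hup i j hij]
    exact K.zero_mem
  have hle := Fin.le_def.1 hij
  obtain ⟨N, hN⟩ : ∃ N, n - j = N + 1 := ⟨n - j - 1, by omega⟩
  have h := entry_mem_of_corner_right K (x := 0) (y := natEntry (genY n * R)) (n := n) (r := i)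
    (k := 0) (N := N) (Nat.zero_le _) (by omega) ?_ ?_ (fun _ _ _ => K.zero_mem) ?_ ?_
  · rw [natEntry_of_lt _ i.2 (by omega)] at h
    have e : (⟨n - (N + 1) + 0, by omega⟩ : Fin n) = j := Fin.ext (by simp only; omega)
    rwa [e] at h
  · rw [det_corner_mul _ _ hR (by omega), ← hN, ← funH_eq_det_corner 0 _ i j hij]
    exact hH _ _ _
  · rw [det_corner_mul _ _ hR (by omega)]
    rcases N with _ | N
    · simp
    · have := funH_eq_det_corner 0 (genY n) ⟨i + 1, by omega⟩ ⟨j + 1, by omega⟩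
        (by rw [Fin.le_def]; simp only; omega)
      simp only at this
      rw [show n - ((j : ℕ) + 1) = N + 1 by omega] at this
      rw [← this]
      exact funH_genY_ne_zero _ _ _
  · exact fun i' j' hi => natEntry_mem K fun _ _ => h₁ _ _ hi
  · exact fun j' hj => natEntry_mem K fun _ _ => h₂ _ (by rw [Fin.lt_def]; simp only; omega)

/-- Below and on the diagonal the entries of `X` are recovered from the `g_{ij}`, above it from the
`f_{kl}` and, in the first row, from the `φ_{kl}` with `k + l = n`. -/
theorem genX_mem {R : Matrix (Fin n) (Fin n) (RatFun n)} (hR : IsLowerUni R)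
    (hB : ∀ i j, (genY n * R) i j ∈ K)
    (hG : ∀ i j hij, funG (genX n) i j hij ∈ K)
    (hF : ∀ p q (_ : 1 ≤ p) (_ : 1 ≤ q) hpq, funF (genX n) (genY n) p q hpq ∈ K)
    (hP : ∀ p q (_ : 1 ≤ p) (_ : 1 ≤ q) hpq, funPhi (genX n) (genY n) p q hpq ∈ K)
    (i j : Fin n) : genX n i j ∈ K := by
  refine forall_of_bottom_right (P := fun i j => genX n i j ∈ K) (fun i j h₁ h₂ => ?_) i j
  rcases le_or_gt j i with hij | hij
  · have hle := Fin.le_def.1 hij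
    obtain ⟨N, hN⟩ : ∃ N, n - i = N + 1 := ⟨n - i - 1, by omega⟩
    have h := entry_mem_of_corner_left K (x := fun a c => natEntry (genX n) a (c - i + j))
      (y := 0) (n := n) (r := i) (k := N) (N := N) (by omega) (by omega) ?_ ?_ ?_ ?_
      (fun _ _ _ => K.zero_mem)
    · rw [natEntry_of_lt _ i.2 (by omega)] at h
      have e : (⟨n - (N + 1) - i + j, by omega⟩ : Fin n) = j := Fin.ext (by simp only; omega)
      rwa [e] at h
    · rw [← hN, ← funG_eq_det_corner 0 _ i j hij]
      exact hG _ _ _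
    · rcases N with _ | N
      · simp
      · have := funG_eq_det_corner 0 (genX n) ⟨i + 1, by omega⟩ ⟨j + 1, by omega⟩
          (by rw [Fin.le_def]; simp only; omega)
        simp only at this
        rw [show n - ((i : ℕ) + 1) = N + 1 by omega] at this
        have e : corner (fun a c => natEntry (genX n) a (c - i + j)) 0 n (i + 1) (N + 1) (N + 1) =
            corner (fun a c => natEntry (genX n) a (c - (i + 1) + (j + 1))) 0 n (i + 1)
              (N + 1) (N + 1) := by
          ext a b
          simp only [corner, of_apply, b.2, if_true]
          congr 1
          omega
        rw [e, ← this]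
        exact funG_genX_ne_zero _ _ _
    · exact fun i' j' hi => natEntry_mem K fun _ _ => h₁ _ _ hi
    · exact fun j' hj => natEntry_mem K fun _ _ => h₂ _ (by rw [Fin.lt_def]; simp only; omega)
  · have hlt := Fin.lt_def.1 hij
    obtain ⟨k, hk⟩ : ∃ k, n - j = k + 1 := ⟨n - j - 1, by omega⟩
    obtain ⟨N, hN⟩ : ∃ N, n - i = N + 1 := ⟨n - i - 1, by omega⟩
    have h := entry_mem_of_corner_left K (x := natEntry (genX n)) (y := natEntry (genY n * R))
      (n := n) (r := i) (k := k) (N := N) (by omega) (by omega) ?_ ?_ ?_ ?_ ?_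
    · rw [natEntry_of_lt _ i.2 (by omega)] at h
      have e : (⟨n - (k + 1), by omega⟩ : Fin n) = j := Fin.ext (by simp only; omega)
      rwa [e] at h
    · rw [det_corner_mul _ _ hR (by omega)]
      rcases Nat.eq_zero_or_pos (i : ℕ) with hi | hi
      · have := hP (k + 1) (N - k) (by omega) (by omega) (by omega)
        rw [funPhi_eq_det_corner det_genX_ne_zero _ _ _ _ (by omega)] at this
        have hs : (signS n (k + 1) (N - k) : RatFun n) ≠ 0 := by
          rw [signS]
          split_ifs <;> simp
        have := K.mul_mem (K.inv_mem (K.intCast_mem (signS n (k + 1) (N - k)))) this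
        rw [inv_mul_cancel_left₀ hs] at this
        rw [hi]
        rwa [show N + 1 = n by omega]
      · have := hF (k + 1) (N - k) (by omega) (by omega) (by omega)
        rw [funF_eq_det_corner] at this
        rw [show k + 1 + (N - k) = N + 1 by omega, show n - (N + 1) = i by omega] at this
        exact this
    · rw [det_corner_mul _ _ hR (by omega)]
      have := funF_ne_zero (n := n) k (N - k) (by omega)
      rw [funF_eq_det_corner] at this
      rw [show k + (N - k) = N by omega, show n - N = i + 1 by omega] at this
      exact this
    · exact fun i' j' hi => natEntry_mem K fun _ _ => h₁ _ _ hi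
    · exact fun j' hj => natEntry_mem K fun _ _ => h₂ _ (by rw [Fin.lt_def]; simp only; omega)
    · exact fun i' j' _ => natEntry_mem K fun _ _ => hB _ _

end

/-! ### A Krylov basis and its companion matrix -/

section
variable {L : Type*} [Field L] {n : ℕ}

/-- The matrix with columns `U eₙ, U² eₙ, …, Uⁿ eₙ`. -/
def krylovLast (U : Matrix (Fin n) (Fin n) L) : Matrix (Fin n) (Fin n) L :=
  krylovMat U (fun s => ⟨n - 1, by have := s.2; omega⟩) fun s => s + 1

/-- The companion matrix that expresses multiplication by `U` in the basis `U eₙ, …, Uⁿ eₙ`; its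
last column is written through the characteristic polynomial of `-U`. -/
noncomputable def krylovComp (U : Matrix (Fin n) (Fin n) L) : Matrix (Fin n) (Fin n) L :=
  of fun i s => if (s : ℕ) + 1 < n then (if (i : ℕ) = s + 1 then 1 else 0)
    else -((-1) ^ (i + n : ℕ) * (-U).charpoly.coeff i)

/-- The Cayley–Hamilton theorem for `-U`. -/
theorem pow_card_eq_sum (U : Matrix (Fin n) (Fin n) L) :
    U ^ n = ∑ a : Fin n, (-((-1) ^ (a + n : ℕ) * (-U).charpoly.coeff a)) • U ^ (a : ℕ) := by
  have hpow : ∀ a : ℕ, (-U) ^ a = ((-1 : L) ^ a) • U ^ a := fun a => by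
    rw [← smul_pow, neg_one_smul]
  have h := aeval_self_charpoly (-U)
  have hm : (-U).charpoly.coeff n = 1 := by
    have := (charpoly_monic (-U)).coeff_natDegree
    rwa [charpoly_natDegree_eq_dim, Fintype.card_fin] at this
  rw [Polynomial.aeval_eq_sum_range, charpoly_natDegree_eq_dim, Fintype.card_fin,
    Finset.sum_range_succ, hm, one_smul, hpow, add_comm, ← eq_neg_iff_add_eq_zero] at h
  have hs : ((-1 : L) ^ n) * (-1) ^ n = 1 := by
    rw [← mul_pow, neg_one_mul, neg_neg, one_pow]
  have h' := congrArg (fun M => ((-1 : L) ^ n) • M) h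
  simp only [smul_smul, hs, one_smul] at h'
  rw [h', Finset.sum_range, smul_neg, Finset.smul_sum, ← Finset.sum_neg_distrib]
  refine Finset.sum_congr rfl fun a _ => ?_
  rw [hpow, smul_smul, smul_smul, ← neg_smul]
  congr 2
  rw [pow_add]
  ring

theorem mul_krylovLast (U : Matrix (Fin n) (Fin n) L) :
    U * krylovLast U = krylovLast U * krylovComp U := by
  ext i s
  have hl : (U * krylovLast U) i s = (U ^ (s + 2 : ℕ)) i ⟨n - 1, by have := s.2; omega⟩ := by
    rw [pow_succ', mul_apply, mul_apply]
    rfl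
  rw [hl, mul_apply]
  simp only [krylovLast, krylovComp, krylovMat, of_apply]
  by_cases hs : (s : ℕ) + 1 < n
  · simp only [if_pos hs]
    rw [Finset.sum_eq_single ⟨s + 1, hs⟩]
    · rw [if_pos rfl, _root_.mul_one]
    · intro b _ hb
      rw [if_neg fun h => hb (Fin.ext h), MulZeroClass.mul_zero]
    · exact fun h => absurd (Finset.mem_univ _) h
  · simp only [if_neg hs]
    have hs' : (s : ℕ) + 2 = n + 1 := by omega
    rw [hs', pow_succ, pow_card_eq_sum, Finset.sum_mul, Matrix.sum_apply]
    refine Finset.sum_congr rfl fun a _ => ?_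
    rw [Matrix.smul_mul, Matrix.smul_apply, ← pow_succ, smul_eq_mul, mul_comm]

/-- The characteristic polynomial of `-X⁻¹ Y` is, up to a factor, the reverse of `det (X + λ Y)`. -/
theorem coeff_charpoly_neg_inv_mul {X : Matrix (Fin n) (Fin n) L} (hX : X.det ≠ 0)
    (Y : Matrix (Fin n) (Fin n) L) {i : ℕ} (hi : i ≤ n) :
    (-(X⁻¹ * Y)).charpoly.coeff i = X.det⁻¹ * (pencil X Y).det.coeff (n - i) := by
  have hXX : X.map Polynomial.C * (X⁻¹ * Y).map Polynomial.C = Y.map Polynomial.C := by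
    rw [← Matrix.map_mul, mul_nonsing_inv_cancel_left _ _ (isUnit_iff_ne_zero.2 hX)]
  have hp : pencil X Y = X.map Polynomial.C *
      (1 - (Polynomial.X : Polynomial L) • (-(X⁻¹ * Y)).map Polynomial.C) := by
    rw [Matrix.mul_sub, Matrix.mul_one, Matrix.mul_smul, Matrix.map_neg _ (fun a => by simp),
      Matrix.mul_neg, hXX, smul_neg, sub_neg_eq_add]
    rfl
  have hd : (X.map Polynomial.C).det = Polynomial.C X.det := by
    rw [RingHom.map_det]; rfl
  rw [hp, det_mul, hd, Polynomial.coeff_C_mul, inv_mul_cancel_left₀ hX]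
  have h := reverse_charpoly (-(X⁻¹ * Y))
  rw [charpolyRev] at h
  rw [← h, Polynomial.coeff_reverse, charpoly_natDegree_eq_dim, Fintype.card_fin,
    Polynomial.revAt_le (Nat.sub_le _ _), Nat.sub_sub_self hi]

theorem krylovComp_mem (K : Subfield L) {U : Matrix (Fin n) (Fin n) L}
    (h : ∀ i < n, (-U).charpoly.coeff i ∈ K) (i s : Fin n) : krylovComp U i s ∈ K := by
  simp only [krylovComp, of_apply]
  split_ifs
  · exact K.one_mem
  · exact K.zero_mem
  · exact K.neg_mem (K.mul_mem (pow_mem (K.neg_mem K.one_mem) _) (h _ i.2))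

/-! ### Unipotent lower triangular matrices -/

theorem IsLowerUni.blockTriangular {N : Matrix (Fin n) (Fin n) L} (hN : IsLowerUni N) :
    BlockTriangular N OrderDual.toDual := fun i j hij => hN.1 i j hij

theorem IsLowerUni.inv {N : Matrix (Fin n) (Fin n) L} (hN : IsLowerUni N) : IsLowerUni N⁻¹ := by
  have hu : IsUnit N.det := by rw [hN.det_eq_one]; exact isUnit_one
  have : Invertible N := invertibleOfIsUnitDet N hu
  have hb := hN.blockTriangular
  have hb' := blockTriangular_inv_of_blockTriangular hb
  refine ⟨fun i j hij => hb' hij, fun i => ?_⟩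
  have h := congrFun₂ (mul_nonsing_inv N hu) i i
  rw [mul_apply, one_apply_eq, Finset.sum_eq_single i, hN.2, _root_.one_mul] at h
  · exact h
  · intro j _ hj
    rcases lt_or_gt_of_ne hj with hj | hj
    · rw [hb' (i := j) (j := i) hj, MulZeroClass.mul_zero]
    · rw [hN.1 _ _ hj, MulZeroClass.zero_mul]
  · exact fun h => absurd (Finset.mem_univ _) h

theorem inv_upper {M : Matrix (Fin n) (Fin n) L} (hM : M.det ≠ 0)
    (h : ∀ i j, j < i → M i j = 0) (i j : Fin n) (hij : j < i) : M⁻¹ i j = 0 := by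
  have : Invertible M := invertibleOfIsUnitDet M (isUnit_iff_ne_zero.2 hM)
  have hb : BlockTriangular M id := fun i j hij => h i j hij
  exact blockTriangular_inv_of_blockTriangular hb hij

/-- A product with a unipotent lower triangular matrix, when only a window of `w` columns
contributes. -/
theorem sum_window (M : Matrix (Fin n) (Fin n) L) {H : Matrix (Fin n) (Fin n) L}
    (hH : IsLowerUni H) {s w : ℕ} (hs : s + w ≤ n) {f : Fin n → L} {i j : Fin n}
    (hj : n - w ≤ (j : ℕ))
    (hf : ∀ d (hd : d < w), f ⟨s + d, by omega⟩ =
      M i ⟨n - w + d, by omega⟩ * H ⟨n - w + d, by omega⟩ j)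
    (hf0 : ∀ a : Fin n, ¬((s : ℕ) ≤ a ∧ (a : ℕ) < s + w) → f a = 0) :
    ∑ a, f a = (M * H) i j := by
  rw [mul_apply]
  trans ∑ d : Fin w, M i ⟨n - w + d, by omega⟩ * H ⟨n - w + d, by omega⟩ j
  · symm
    refine Finset.sum_of_injOn (fun d : Fin w => (⟨s + d, by omega⟩ : Fin n)) ?_ (by simp) ?_ ?_
    · intro c _ c' _ h
      simpa [Fin.ext_iff] using h
    · intro a _ ha
      refine hf0 a fun h => ha ⟨⟨a - s, by omega⟩, by simp, Fin.ext (by simp only; omega)⟩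
    · exact fun d _ => (hf d d.2).symm
  · refine Finset.sum_of_injOn (fun d : Fin w => (⟨n - w + d, by omega⟩ : Fin n)) ?_ (by simp) ?_
      fun _ _ => rfl
    · intro c _ c' _ h
      simpa [Fin.ext_iff] using h
    · intro a _ ha
      rw [hH.1 a j, MulZeroClass.mul_zero]
      rw [Fin.lt_def]
      by_contra hlt
      exact ha ⟨⟨a - (n - w), by omega⟩, by simp, Fin.ext (by simp only; omega)⟩

/-! ### The functions `φ_{kl}` as minors of a triangular matrix -/

/-- The matrix whose determinant is that of `Φ_{kl}` in the Krylov basis: the last `k` columns of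
`T`, then `l - 1` columns of `C T`, then `e_1, …, e_{n-k-l+1}`. -/
def phiReduced (C T : Matrix (Fin n) (Fin n) L) (k l : ℕ) (hkl : k + l ≤ n) :
    Matrix (Fin n) (Fin n) L :=
  of fun a b => if h₁ : (b : ℕ) < k then T a ⟨n - k + b, by omega⟩
    else if h₂ : (b : ℕ) < k + l - 1 then (C * T) a ⟨n - l + (b - k), by omega⟩
    else if (a : ℕ) = b - (k + l - 1) then 1 else 0

/-- `Φ_{kl}` times a unipotent lower triangular matrix is the Krylov matrix times `phiReduced`. -/
theorem det_matPhi {U C T H : Matrix (Fin n) (Fin n) L} (hH : IsLowerUni H)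
    (hQT : H = krylovLast U * T) (hC : U * krylovLast U = krylovLast U * C)
    {k l : ℕ} (hl : 1 ≤ l) (hkl : k + l ≤ n) :
    (matPhi U k l hkl).det = (krylovLast U).det * (phiReduced C T k l hkl).det := by
  set G : Matrix (Fin n) (Fin n) L := of fun a b =>
    if h₁ : (b : ℕ) < k then
      (if h : (a : ℕ) < k then H ⟨n - k + a, by omega⟩ ⟨n - k + b, by omega⟩ else 0)
    else if h₂ : (b : ℕ) < k + l - 1 then
      (if h : k ≤ (a : ℕ) ∧ (a : ℕ) < k + l then
        H ⟨n - l + (a - k), by omega⟩ ⟨n - l + (b - k), by omega⟩ else 0)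
    else if a = b then 1 else 0 with hG
  have hGl : IsLowerUni G := by
    refine ⟨fun a b hab => ?_, fun a => ?_⟩
    · have hab' := Fin.lt_def.1 hab
      simp only [hG, of_apply]
      split_ifs with h₁ h₂ h₃ h₄ h₅
      · exact hH.1 _ _ (by rw [Fin.lt_def]; simp only; omega)
      · rfl
      · exact hH.1 _ _ (by rw [Fin.lt_def]; simp only; omega)
      · rfl
      · exact absurd h₅ hab.ne
      · rfl
    · simp only [hG, of_apply]
      split_ifs with h₁ h₂ h₃
      · exact hH.2 _
      · exact hH.2 _
      · omega
      · rfl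
  have hUH : U * H = krylovLast U * (C * T) := by
    rw [hQT, ← Matrix.mul_assoc, hC, Matrix.mul_assoc]
  have e : matPhi U k l hkl * G = krylovLast U * phiReduced C T k l hkl := by
    ext i b
    rw [mul_apply]
    by_cases h₁ : (b : ℕ) < k
    · rw [sum_window (1 : Matrix (Fin n) (Fin n) L) hH (s := 0) (w := k) (i := i)
        (j := ⟨n - k + b, by omega⟩) (by omega) (by simp)]
      · rw [Matrix.one_mul, hQT, mul_apply, mul_apply]
        refine Finset.sum_congr rfl fun a _ => ?_
        rw [phiReduced, of_apply, dif_pos h₁]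
      · intro d hd
        simp only [matPhi, hG, of_apply, zero_add, hd, h₁, dif_pos]
      · intro a ha
        have ha' : ¬ (a : ℕ) < k := by omega
        simp only [hG, of_apply, h₁, ha', dif_pos, dif_neg, not_false_eq_true,
          MulZeroClass.mul_zero]
    · by_cases h₂ : (b : ℕ) < k + l - 1
      · rw [sum_window U hH (s := k) (w := l) (i := i)
          (j := ⟨n - l + (b - k), by omega⟩) (by omega) (by simp)]
        · rw [hUH, mul_apply, mul_apply]
          refine Finset.sum_congr rfl fun a _ => ?_
          rw [phiReduced, of_apply, dif_neg h₁, dif_pos h₂]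
        · intro d hd
          have hd₁ : ¬ k + d < k := by omega
          have hd₂ : k + d < k + l := by omega
          simp only [matPhi, hG, of_apply, h₁, h₂, hd₁, hd₂, dif_pos, dif_neg, not_false_eq_true,
            Nat.add_sub_cancel_left, Nat.le_add_right, and_self]
        · intro a ha
          simp only [hG, of_apply, h₁, h₂, ha, dif_pos, dif_neg, not_false_eq_true,
            MulZeroClass.mul_zero]
      · have hr : (krylovLast U * phiReduced C T k l hkl) i b =
            krylovLast U i ⟨b - (k + l - 1), by omega⟩ := by
          rw [mul_apply, Finset.sum_eq_single ⟨b - (k + l - 1), by omega⟩]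
          · simp only [phiReduced, of_apply, h₁, h₂, dif_neg, not_false_eq_true, if_true,
              _root_.mul_one]
          · intro a _ ha
            have : ¬ (a : ℕ) = b - (k + l - 1) := fun h => ha (Fin.ext h)
            simp only [phiReduced, of_apply, h₁, h₂, this, dif_neg, not_false_eq_true, if_false,
              MulZeroClass.mul_zero]
          · exact fun h => absurd (Finset.mem_univ _) h
        rw [hr, Finset.sum_eq_single b]
        · simp only [hG, of_apply, h₁, h₂, dif_neg, not_false_eq_true, if_true, _root_.mul_one,
            matPhi, krylovLast, krylovMat]
          split_ifs with h₃
          · rw [show (b : ℕ) - (k + l - 1) + 1 = 1 by omega, pow_one]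
            congr 1
            exact Fin.ext (by simp only; omega)
          · rw [show (b : ℕ) - (k + l - 1) + 1 = b - (k + l) + 2 by omega]
        · intro a _ ha
          simp only [hG, of_apply, h₁, h₂, ha, dif_neg, not_false_eq_true, if_false,
            MulZeroClass.mul_zero]
        · exact fun h => absurd (Finset.mem_univ _) h
  have := congrArg det e
  rwa [det_mul, det_mul, hGl.det_eq_one, _root_.mul_one] at this

/-- If the last columns of `M` are the first basis vectors, then its determinant is, up to sign,
the complementary minor. -/
theorem det_eq_sign_mul_det_corner {M : Matrix (Fin n) (Fin n) L} {N : ℕ} (hN : N ≤ n)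
    (h : ∀ a b : Fin n, N ≤ (b : ℕ) → M a b = if (a : ℕ) = b - N then 1 else 0) :
    ∃ ε : ℤˣ, M.det = ((ε : ℤ) : L) *
      (of fun a b : Fin N => M ⟨n - N + a, by omega⟩ ⟨b, by omega⟩).det := by
  obtain ⟨m, rfl⟩ : ∃ m, n = m + N := ⟨n - N, by omega⟩
  -- reorder the columns so that the matrix becomes block triangular
  set e₁ : Fin m ⊕ Fin N ≃ Fin (m + N) := finSumFinEquiv
  set e₂ : Fin m ⊕ Fin N ≃ Fin (m + N) :=
    ((Equiv.sumComm _ _).trans finSumFinEquiv).trans (finCongr (add_comm N m))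
  have hv₁ : ∀ a : Fin m, (e₁ (.inl a) : ℕ) = a := fun a => by simp [e₁]
  have hv₂ : ∀ a : Fin N, (e₁ (.inr a) : ℕ) = m + a := fun a => by simp [e₁]
  have hv₃ : ∀ a : Fin m, (e₂ (.inl a) : ℕ) = N + a := fun a => by simp [e₂, add_comm]
  have hv₄ : ∀ a : Fin N, (e₂ (.inr a) : ℕ) = a := fun a => by simp [e₂]
  have hb : M.submatrix e₁ e₂ = fromBlocks 1 (of fun a b => M (e₁ (.inl a)) (e₂ (.inr b))) 0
      (of fun a b : Fin N => M ⟨m + N - N + a, by omega⟩ ⟨b, by omega⟩) := by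
    ext a b
    rcases a with a | a <;> rcases b with b | b
    · rw [submatrix_apply, h _ _ (by rw [hv₃]; omega), hv₁, hv₃, fromBlocks_apply₁₁, one_apply]
      simp [Fin.ext_iff]
    · rfl
    · rw [submatrix_apply, h _ _ (by rw [hv₃]; omega), hv₂, hv₃, fromBlocks_apply₂₁,
        Matrix.zero_apply, if_neg (by omega)]
    · rw [submatrix_apply, fromBlocks_apply₂₂, of_apply]
      congr 1
      · exact Fin.ext (by rw [hv₂]; simp only; omega)
  have hd := congrArg det hb
  rw [det_fromBlocks_zero₂₁, det_one, _root_.one_mul] at hd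
  have hs : M.submatrix e₁ e₂ = (M.submatrix id (e₁.symm.trans e₂)).submatrix e₁ e₁ := by
    ext a b
    simp
  rw [hs, det_submatrix_equiv_self, det_permute'] at hd
  refine ⟨Equiv.Perm.sign (e₁.symm.trans e₂), ?_⟩
  rw [← hd, ← mul_assoc, ← Int.cast_mul, ← Units.val_mul, Int.units_mul_self, Units.val_one,
    Int.cast_one, _root_.one_mul]

/-- The entries of `C T` used in `phiReduced` are those of `T` moved down by one row, since `C`
sends each basis vector but the last to the next one. -/
theorem det_phiReduced {C T : Matrix (Fin n) (Fin n) L}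
    (hC : ∀ a s : Fin n, (s : ℕ) + 1 < n → C a s = if (a : ℕ) = s + 1 then 1 else 0)
    (hT : ∀ i j, j < i → T i j = 0) {k l : ℕ} (hl : 1 ≤ l) (hkl : k + l ≤ n) :
    ∃ ε : ℤˣ, (phiReduced C T k l hkl).det = ((ε : ℤ) : L) *
      (corner (natEntry T) (fun i j => natEntry T (i - 1) (j - 1)) n (n - (k + l - 1)) k
        (k + l - 1)).det := by
  obtain ⟨ε, hε⟩ := det_eq_sign_mul_det_corner (M := phiReduced C T k l hkl) (N := k + l - 1)
    (by omega) fun a b hb => by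
      rw [phiReduced, of_apply, dif_neg (by omega), dif_neg (by omega)]
  refine ⟨ε, hε.trans ?_⟩
  congr 2
  ext a b
  simp only [of_apply, phiReduced, corner]
  by_cases hb : (b : ℕ) < k
  · simp only [hb, dif_pos, if_true]
    rw [natEntry_of_lt _ (by omega) (by omega)]
  · have hb' : (b : ℕ) < k + l - 1 := b.2
    simp only [hb, hb', dif_pos, dif_neg, if_false, not_false_eq_true]
    rw [natEntry_of_lt _ (by omega) (by omega), mul_apply,
      Finset.sum_eq_single ⟨n - (k + l - 1) + a - 1, by omega⟩]
    · rw [hC _ _ (by simp only; omega), if_pos (by simp only; omega), _root_.one_mul]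
      congr 1
      exact Fin.ext (by simp only; omega)
    · intro c _ hc
      by_cases hc' : (c : ℕ) + 1 < n
      · rw [hC _ _ hc', if_neg, MulZeroClass.zero_mul]
        exact fun h => hc (Fin.ext (by simp only at h ⊢; omega))
      · rw [hT _ _ (by rw [Fin.lt_def]; simp only; omega), MulZeroClass.mul_zero]
    · exact fun h => absurd (Finset.mem_univ _) h

end

/-! ### Recovering the triangular factor of the Krylov matrix -/

section
variable {n : ℕ} (K : Subfield (RatFun n))

/-- Each `φ_{kl}` is, up to a factor in `K`, the determinant of the Krylov matrix times a minor of
the triangular factor `T`. -/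
theorem exists_funPhi_eq {C T H : Matrix (Fin n) (Fin n) (RatFun n)} (hH : IsLowerUni H)
    (hT : ∀ i j, j < i → T i j = 0)
    (hQT : H = krylovLast ((genX n)⁻¹ * genY n) * T)
    (hC : (genX n)⁻¹ * genY n * krylovLast ((genX n)⁻¹ * genY n) =
      krylovLast ((genX n)⁻¹ * genY n) * C)
    (hC' : ∀ a s : Fin n, (s : ℕ) + 1 < n → C a s = if (a : ℕ) = s + 1 then 1 else 0)
    (hX : (genX n).det ∈ K) {k l : ℕ} (hl : 1 ≤ l) (hkl : k + l ≤ n) :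
    ∃ u ∈ K, u ≠ 0 ∧ funPhi (genX n) (genY n) k l hkl =
      u * ((krylovLast ((genX n)⁻¹ * genY n)).det *
        (corner (natEntry T) (fun i j => natEntry T (i - 1) (j - 1)) n (n - (k + l - 1)) k
          (k + l - 1)).det) := by
  obtain ⟨ε, hε⟩ := det_phiReduced hC' hT hl hkl
  have hs : (signS n k l : RatFun n) ≠ 0 := by
    rw [signS]
    split_ifs <;> simp
  have hε' : ((ε : ℤ) : RatFun n) ≠ 0 := by
    rcases Int.units_eq_one_or ε with rfl | rfl <;> simp
  refine ⟨(signS n k l : RatFun n) * (genX n).det ^ (n - k - l + 1) * ((ε : ℤ) : RatFun n),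
    K.mul_mem (K.mul_mem (K.intCast_mem _) (pow_mem hX _)) (K.intCast_mem _),
    mul_ne_zero (mul_ne_zero hs (pow_ne_zero _ det_genX_ne_zero)) hε', ?_⟩
  rw [funPhi, det_matPhi hH hQT hC hl hkl, hε]
  ring

/-- The entries of the triangular factor `T` are recovered one by one: the last column from `C`, the
diagonal from the `φ_{k1}` and from `det Q * det T = 1`, the other entries from the `φ_{kl}` with
`l ≥ 2`. -/
theorem triangularFactor_mem {C T H : Matrix (Fin n) (Fin n) (RatFun n)} (hH : IsLowerUni H)
    (hT : ∀ i j, j < i → T i j = 0)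
    (hQT : H = krylovLast ((genX n)⁻¹ * genY n) * T)
    (hC : (genX n)⁻¹ * genY n * krylovLast ((genX n)⁻¹ * genY n) =
      krylovLast ((genX n)⁻¹ * genY n) * C)
    (hC' : ∀ a s : Fin n, (s : ℕ) + 1 < n → C a s = if (a : ℕ) = s + 1 then 1 else 0)
    (hCK : ∀ i j, C i j ∈ K) (hX : (genX n).det ∈ K)
    (hP : ∀ p q (_ : 1 ≤ p) (_ : 1 ≤ q) hpq, funPhi (genX n) (genY n) p q hpq ∈ K)
    (i j : Fin n) : T i j ∈ K := by
  set U := (genX n)⁻¹ * genY n with hU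
  set Q := krylovLast U with hQ
  have hUdet : U.det ≠ 0 := by
    rw [hU, det_mul, det_nonsing_inv, Ring.inverse_eq_inv']
    exact mul_ne_zero (inv_ne_zero det_genX_ne_zero) det_genY_ne_zero
  have hQT' : Q.det * T.det = 1 := by rw [← det_mul, ← hQT, hH.det_eq_one]
  have hQdet : Q.det ≠ 0 := left_ne_zero_of_mul_eq_one hQT'
  have hCdet : C.det ≠ 0 := by
    intro h0
    have h := congrArg det hC
    rw [det_mul _ C, h0, MulZeroClass.mul_zero, det_mul] at h
    exact mul_ne_zero hUdet hQdet h
  -- the last column of `H` is the last basis vector, so `C` sends that of `T` to the first one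
  have hlast : ∀ i j : Fin n, (j : ℕ) = n - 1 → T i j ∈ K := by
    intro i j hj
    have hCT : ∀ a, (C * T) a j = if (a : ℕ) = 0 then 1 else 0 := by
      have h₁ : Q * (C * T) = U * H := by
        rw [← Matrix.mul_assoc, ← hC, hQT, Matrix.mul_assoc]
      have h₂ : C * T = Q⁻¹ * (U * H) := by
        rw [← h₁, nonsing_inv_mul_cancel_left _ _ (isUnit_iff_ne_zero.2 hQdet)]
      intro a
      have h₃ : ∀ c, (U * H) c j = Q c ⟨0, by omega⟩ := by
        intro c
        rw [mul_apply, Finset.sum_eq_single j]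
        · rw [hH.2, _root_.mul_one]
          simp only [hQ, krylovLast, krylovMat, of_apply, zero_add, pow_one]
          congr 1
          exact Fin.ext hj
        · intro b _ hb
          rw [hH.1 b j, MulZeroClass.mul_zero]
          have : (b : ℕ) ≠ j := fun h => hb (Fin.ext h)
          rw [Fin.lt_def]
          omega
        · exact fun h => absurd (Finset.mem_univ _) h
      rw [h₂, mul_apply]
      simp only [h₃]
      rw [← mul_apply, nonsing_inv_mul _ (isUnit_iff_ne_zero.2 hQdet), one_apply]
      simp only [Fin.ext_iff]
    have h₄ : T = C⁻¹ * (C * T) := by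
      rw [nonsing_inv_mul_cancel_left _ _ (isUnit_iff_ne_zero.2 hCdet)]
    rw [h₄, mul_apply]
    refine K.sum_mem fun a _ => K.mul_mem (inv_mem_subfield K hCK _ _) ?_
    rw [hCT]
    split_ifs
    exacts [K.one_mem, K.zero_mem]
  have hcne : ∀ k l (_ : 1 ≤ k) (_ : 1 ≤ l) (_ : k + l ≤ n),
      (corner (natEntry T) (fun i j => natEntry T (i - 1) (j - 1)) n (n - (k + l - 1)) k
          (k + l - 1)).det ≠ 0 := by
    intro k l hk hl hkl
    obtain ⟨u, -, -, h⟩ := exists_funPhi_eq K hH hT hQT hC hC' hX hl hkl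
    intro h0
    refine funPhi_ne_zero hkl hk hl ?_
    rw [h, h0, MulZeroClass.mul_zero, MulZeroClass.mul_zero]
  have hQK : 2 ≤ n → Q.det ∈ K := by
    intro hn
    obtain ⟨u, hu, hu0, h⟩ := exists_funPhi_eq K hH hT hQT hC hC' hX (k := 1) (l := 1) le_rfl hn
    have hc : (corner (natEntry T) (fun i j => natEntry T (i - 1) (j - 1)) n (n - (1 + 1 - 1)) 1
          (1 + 1 - 1)).det ∈ K := by
      refine det_mem_subfield K fun a b => ?_
      have hb : (b : ℕ) < 1 := by omega
      simp only [corner, of_apply, hb, if_true]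
      exact natEntry_mem K fun _ _ => hlast _ _ (by simp only; omega)
    have hc0 := hcne 1 1 le_rfl le_rfl hn
    have := K.mul_mem (hP 1 1 le_rfl le_rfl hn) (K.inv_mem (K.mul_mem hu hc))
    rw [h, mul_left_comm, mul_assoc, mul_inv_cancel₀ (mul_ne_zero hu0 hc0),
      _root_.mul_one] at this
    exact this
  have hcK : 2 ≤ n → ∀ k l (_ : 1 ≤ k) (_ : 1 ≤ l) (_ : k + l ≤ n),
      (corner (natEntry T) (fun i j => natEntry T (i - 1) (j - 1)) n (n - (k + l - 1)) k
          (k + l - 1)).det ∈ K := by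
    intro hn k l hk hl hkl
    obtain ⟨u, hu, hu0, h⟩ := exists_funPhi_eq K hH hT hQT hC hC' hX hl hkl
    have := K.mul_mem (K.inv_mem (K.mul_mem hu (hQK hn))) (hP k l hk hl hkl)
    rwa [h, ← mul_assoc u, inv_mul_cancel_left₀ (mul_ne_zero hu0 hQdet)] at this
  refine forall_of_bottom_right (P := fun i j => T i j ∈ K) (fun i j h₁ h₂ => ?_) i j
  by_cases hj : (j : ℕ) = n - 1
  · exact hlast i j hj
  rcases lt_trichotomy j i with hij | hij | hij
  · rw [hT i j hij]
    exact K.zero_mem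
  · subst hij
    obtain ⟨N, hN⟩ : ∃ N, n - j = N + 1 := ⟨n - j - 1, by omega⟩
    -- the second matrix does not enter these minors
    have h0 : ∀ r k, corner (natEntry T) (fun i j => natEntry T (i - 1) (j - 1)) n r k k =
        corner (natEntry T) 0 n r k k := fun r k => by
      ext a b
      simp only [corner, of_apply, b.2, if_true]
    have h := entry_mem_of_corner_left K (x := natEntry T) (y := 0)
      (n := n) (r := j) (k := N) (N := N) (by omega) (by omega) ?_ ?_ ?_ ?_
      fun _ _ _ => K.zero_mem
    · rw [natEntry_of_lt _ j.2 (by omega)] at h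
      have e : (⟨n - (N + 1), by omega⟩ : Fin n) = j := Fin.ext (by simp only; omega)
      rwa [e] at h
    · rw [← h0]
      rcases Nat.eq_zero_or_pos (j : ℕ) with hj0 | hj0
      · have e : (corner (natEntry T) (fun i j => natEntry T (i - 1) (j - 1)) n 0 n n).det =
            T.det := by
          congr 1
          ext a b
          simp only [corner, of_apply, b.2, if_true]
          rw [natEntry_of_lt _ (by omega) (by omega)]
          congr 1 <;> exact Fin.ext (by simp only; omega)
        rw [hj0, show N + 1 = n by omega, e, ← inv_eq_of_mul_eq_one_right hQT']
        exact K.inv_mem (hQK (by omega))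
      · have := hcK (by omega) (N + 1) 1 (by omega) le_rfl (by omega)
        rwa [show n - (N + 1 + 1 - 1) = j by omega, show N + 1 + 1 - 1 = N + 1 by omega] at this
    · rw [← h0]
      have := hcne N 1 (by omega) le_rfl (by omega)
      rwa [show n - (N + 1 - 1) = j + 1 by omega, show N + 1 - 1 = N by omega] at this
    · exact fun i' j' hi => natEntry_mem K fun _ _ => h₁ _ _ hi
    · exact fun j' hj => natEntry_mem K fun _ _ => h₂ _ (by rw [Fin.lt_def]; simp only; omega)
  · have hlt := Fin.lt_def.1 hij
    obtain ⟨N, hN⟩ : ∃ N, n - (i + 1) = N + 1 := ⟨n - i - 2, by omega⟩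
    have h := entry_mem_of_corner_right K (x := natEntry T)
      (y := fun i j => natEntry T (i - 1) (j - 1))
      (n := n) (r := i + 1) (k := j - i) (N := N) (by omega) (by omega) ?_ ?_ ?_ ?_ ?_
    · rw [natEntry_of_lt _ (by omega) (by omega)] at h
      have e : (⟨n - (N + 1) + (j - i) - 1, by omega⟩ : Fin n) = j := Fin.ext (by simp only; omega)
      rw [e] at h
      exact h
    · have := hcK (by omega) (j - i) (n - j) (by omega) (by omega) (by omega)
      rwa [show n - (j - i + (n - j) - 1) = (i : ℕ) + 1 by omega,
        show (j - i + (n - j) - 1 : ℕ) = N + 1 by omega] at this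
    · have := hcne (j - i) (n - j - 1) (by omega) (by omega) (by omega)
      rwa [show n - (j - i + (n - j - 1) - 1) = (i : ℕ) + 1 + 1 by omega,
        show (j - i + (n - j - 1) - 1 : ℕ) = N by omega] at this
    · exact fun i' j' hi => natEntry_mem K fun _ _ => h₁ _ _ hi
    · exact fun i' j' hi => natEntry_mem K fun _ _ => h₁ _ _ (by rw [Fin.lt_def]; simp only; omega)
    · intro j' hj'
      refine natEntry_mem K fun _ _ => ?_
      exact h₂ ⟨j' - 1, by omega⟩ (by rw [Fin.lt_def]; simp only; omega)

end

/-! ### A linear system over a subfield -/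

section
variable {L : Type*} [Field L]

theorem strictLower_mul {ι : Type*} [Fintype ι] [LinearOrder ι] {A B : Matrix ι ι L}
    (hA : ∀ i j, i < j → A i j = 0) (hB : ∀ i j, i ≤ j → B i j = 0) (i j : ι) (hij : i ≤ j) :
    (A * B) i j = 0 := by
  rw [mul_apply]
  refine Finset.sum_eq_zero fun p _ => ?_
  rcases lt_or_ge i p with h | h
  · rw [hA _ _ h, MulZeroClass.zero_mul]
  · rw [hB _ _ (h.trans hij), MulZeroClass.mul_zero]

theorem mul_strictLower {ι : Type*} [Fintype ι] [LinearOrder ι] {A B : Matrix ι ι L}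
    (hA : ∀ i j, i < j → A i j = 0) (hB : ∀ i j, i ≤ j → B i j = 0) (i j : ι) (hij : i ≤ j) :
    (B * A) i j = 0 := by
  rw [mul_apply]
  refine Finset.sum_eq_zero fun p _ => ?_
  rcases lt_or_ge p j with h | h
  · rw [hA _ _ h, MulZeroClass.mul_zero]
  · rw [hB _ _ (hij.trans h), MulZeroClass.zero_mul]

variable {n : ℕ}

/-- If `U w₀` is a product of a lower and an upper triangular matrix, with `w₀` the longest
permutation, then conjugation by `U` takes no nonzero strictly lower triangular matrix to a strictly
lower triangular one: it is conjugation by `w₀` up to triangular factors. -/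
theorem strictLower_eq_zero {U N π ν : Matrix (Fin n) (Fin n) L} (hU : U.det ≠ 0)
    (hN : IsLowerUni N) (hup : ∀ i j, j < i → (N * U.submatrix id Fin.rev) i j = 0)
    (hπ : ∀ i j, i ≤ j → π i j = 0) (hν : ∀ i j, i ≤ j → ν i j = 0) (h : U * π = ν * U) :
    π = 0 ∧ ν = 0 := by
  have hNu : IsUnit N.det := by rw [hN.det_eq_one]; exact isUnit_one
  set A := N * U.submatrix id Fin.rev with hA
  have hJ : ∀ M : Matrix (Fin n) (Fin n) L, U.submatrix id Fin.rev * M.submatrix Fin.rev Fin.rev =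
      (U * M).submatrix id Fin.rev := fun M =>
    submatrix_mul_equiv U M id Fin.revPerm Fin.rev
  have hAdet : A.det ≠ 0 := by
    rw [hA, det_mul, hN.det_eq_one, _root_.one_mul]
    have := det_permute' Fin.revPerm U
    rw [show U.submatrix id Fin.rev = U.submatrix id Fin.revPerm from rfl, this]
    rcases Int.units_eq_one_or (Equiv.Perm.sign (Fin.revPerm (n := n))) with h | h <;>
      rw [h] <;> simpa using hU
  have e : A * π.submatrix Fin.rev Fin.rev = N * ν * N⁻¹ * A := by
    rw [hA, Matrix.mul_assoc, hJ, h, Matrix.mul_assoc (N * ν), nonsing_inv_mul_cancel_left _ _ hNu,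
      Matrix.mul_assoc]
    congr 1
  have e' : N * ν * N⁻¹ = A * π.submatrix Fin.rev Fin.rev * A⁻¹ := by
    rw [e, mul_nonsing_inv_cancel_right _ _ (isUnit_iff_ne_zero.2 hAdet)]
  have hl : ∀ i j : Fin n, i ≤ j → (N * ν * N⁻¹) i j = 0 :=
    mul_strictLower hN.inv.1 (strictLower_mul hN.1 hν)
  have hu : ∀ i j : Fin n, j ≤ i → (A * π.submatrix Fin.rev Fin.rev * A⁻¹) i j = 0 :=
    mul_strictLower (ι := (Fin n)ᵒᵈ) (fun i j hij => inv_upper hAdet hup i j hij)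
      (strictLower_mul (ι := (Fin n)ᵒᵈ) (fun i j hij => hup i j hij)
        fun i j hij => hπ _ _ (Fin.rev_le_rev.2 hij))
  have h0 : N * ν * N⁻¹ = 0 := by
    ext i j
    rcases le_total i j with hij | hij
    · exact hl i j hij
    · rw [e']
      exact hu i j hij
  have hν0 : ν = 0 := by
    have h₁ : ν = N⁻¹ * (N * ν * N⁻¹) * N := by
      rw [Matrix.mul_assoc N, nonsing_inv_mul_cancel_left _ _ hNu,
        nonsing_inv_mul_cancel_right _ _ hNu]
    rw [h₁, h0, Matrix.mul_zero, Matrix.zero_mul]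
  refine ⟨?_, hν0⟩
  have h₁ : π = U⁻¹ * (U * π) := by
    rw [nonsing_inv_mul_cancel_left _ _ (isUnit_iff_ne_zero.2 hU)]
  rw [h₁, h, hν0, Matrix.zero_mul, Matrix.mul_zero]

/-- A solution of `V P = H W` in unipotent lower triangular matrices, with `V` and `W` over a
subfield, has its entries in the subfield if it is unique: apply a linear retraction onto the
subfield. -/
theorem lowerUni_mem_of_mul_eq (K : Subfield L) {V W P H : Matrix (Fin n) (Fin n) L}
    (hV : ∀ i j, V i j ∈ K) (hW : ∀ i j, W i j ∈ K) (hP : IsLowerUni P) (hH : IsLowerUni H)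
    (h : V * P = H * W)
    (huniq : ∀ π ν : Matrix (Fin n) (Fin n) L, (∀ i j, i ≤ j → π i j = 0) →
      (∀ i j, i ≤ j → ν i j = 0) → V * π = ν * W → π = 0 ∧ ν = 0) :
    (∀ i j, P i j ∈ K) ∧ ∀ i j, H i j ∈ K := by
  obtain ⟨ρ, hρ⟩ := LinearMap.exists_leftInverse_of_injective (Algebra.linearMap K L)
    (LinearMap.ker_eq_bot.2 (algebraMap K L).injective)
  have hρ' : ∀ x : K, ρ (x : L) = x := fun x => LinearMap.congr_fun hρ x
  have hmul : ∀ x ∈ K, ∀ y, (ρ (x * y) : L) = x * ρ y := by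
    intro x hx y
    have := ρ.map_smul (⟨x, hx⟩ : K) y
    rw [show (⟨x, hx⟩ : K) • y = x * y from rfl] at this
    rw [this]
    rfl
  have h1 : (ρ 1 : L) = 1 := by
    have := hρ' 1
    rw [show ((1 : K) : L) = 1 from rfl] at this
    rw [this]
    rfl
  have hr : ∀ M : Matrix (Fin n) (Fin n) L, IsLowerUni M →
      ∀ i j, i ≤ j → (M - M.map fun x => (ρ x : L)) i j = 0 := by
    intro M hM i j hij
    rw [Matrix.sub_apply, map_apply]
    rcases hij.lt_or_eq with hij | rfl
    · rw [hM.1 _ _ hij, map_zero]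
      simp
    · rw [hM.2, h1, sub_self]
  have he : V * (P.map fun x => (ρ x : L)) = (H.map fun x => (ρ x : L)) * W := by
    ext i j
    have h₁ := congrArg (fun x => (ρ x : L)) (congrFun₂ h i j)
    simp only [mul_apply, map_sum, AddSubmonoidClass.coe_finsetSum] at h₁ ⊢
    refine Eq.trans (Finset.sum_congr rfl fun p _ => ?_)
      (h₁.trans (Finset.sum_congr rfl fun p _ => ?_))
    · rw [hmul _ (hV _ _)]
      rfl
    · rw [mul_comm, hmul _ (hW _ _), mul_comm]
      rfl
  obtain ⟨h₁, h₂⟩ := huniq _ _ (hr P hP) (hr H hH) (by rw [Matrix.mul_sub, Matrix.sub_mul, h, he])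
  constructor
  · intro i j
    have := congrFun₂ (sub_eq_zero.1 h₁) i j
    rw [this]
    exact (ρ (P i j)).2
  · intro i j
    have := congrFun₂ (sub_eq_zero.1 h₂) i j
    rw [this]
    exact (ρ (H i j)).2

end

/-! ### Generation of the field of rational functions -/

section
variable {n : ℕ} (K : Subfield (RatFun n))

/-- The Casimir functions, together with `det X` and `det Y`, give the characteristic polynomial of
`-U`. -/
theorem coeff_charpoly_mem (hX : (genX n).det ∈ K) (hY : (genY n).det ∈ K)
    (hC : ∀ i, 1 ≤ i → i < n → casimirFun (n := n) i ∈ K) (i : ℕ) (hi : i < n) :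
    (-((genX n)⁻¹ * genY n)).charpoly.coeff i ∈ K := by
  rcases Nat.eq_zero_or_pos i with rfl | hi0
  · have h := det_eq_sign_charpoly_coeff (-((genX n)⁻¹ * genY n))
    have hs : ((-1 : RatFun n) ^ n) * (-1) ^ n = 1 := by
      rw [← mul_pow, neg_one_mul, neg_neg, one_pow]
    rw [det_neg, Fintype.card_fin, det_mul, det_nonsing_inv, Ring.inverse_eq_inv'] at h
    have h' := mul_left_cancel₀ (left_ne_zero_of_mul_eq_one hs) h
    rw [← h']
    exact K.mul_mem (K.inv_mem hX) hY
  · rw [coeff_charpoly_neg_inv_mul det_genX_ne_zero _ hi.le]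
    refine K.mul_mem (K.inv_mem hX) ?_
    have h := hC (n - i) (by omega) (by omega)
    set s : RatFun n := if Even n then (-1) ^ (n - i) else 1 with hs
    have hsK : s ∈ K := by
      rw [hs]
      split_ifs
      exacts [pow_mem (K.neg_mem K.one_mem) _, K.one_mem]
    have hs2 : s * s = 1 := by
      rw [hs]
      split_ifs
      · rw [← mul_pow, neg_one_mul, neg_neg, one_pow]
      · exact _root_.one_mul 1
    have h' := K.mul_mem hsK h
    rw [casimirFun, funC, ← hs, ← mul_assoc, hs2, _root_.one_mul] at h'
    exact h'

/-- With `Y R` upper triangular, `U = X⁻¹ Y` and `Q = H T⁻¹` the triangular decomposition of the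
Krylov matrix, `K` contains the entries of `X`, `Y R` and `T`, and then those of `R⁻¹ H` and `H`, which
solve a linear system over `K` with a single solution. -/
theorem coordFun_mem
    (hG : ∀ i j hij, funG (genX n) i j hij ∈ K)
    (hH : ∀ i j hij, funH (genY n) i j hij ∈ K)
    (hF : ∀ p q (_ : 1 ≤ p) (_ : 1 ≤ q) hpq, funF (genX n) (genY n) p q hpq ∈ K)
    (hP : ∀ p q (_ : 1 ≤ p) (_ : 1 ≤ q) hpq, funPhi (genX n) (genY n) p q hpq ∈ K)
    (hC : ∀ i, 1 ≤ i → i < n → casimirFun (n := n) i ∈ K) (v : Coord n) : coordFun v ∈ K := by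
  obtain ⟨R, hR, hB⟩ := exists_mul_lowerUni_upper (genY n) fun hf => det_submatrix_genY_ne_zero hf
  have hBK := mul_lowerUni_mem K hR hB hH
  have hXK := genX_mem K hR hBK hG hF hP
  have hXdet := det_mem_subfield K hXK
  have hYdet : (genY n).det ∈ K := by
    have := det_mem_subfield K hBK
    rwa [det_mul, hR.det_eq_one, _root_.mul_one] at this
  have hRu : IsUnit R.det := by rw [hR.det_eq_one]; exact isUnit_one
  set U := (genX n)⁻¹ * genY n with hU
  have hUdet : U.det ≠ 0 := by
    rw [hU, det_mul, det_nonsing_inv, Ring.inverse_eq_inv']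
    exact mul_ne_zero (inv_ne_zero det_genX_ne_zero) det_genY_ne_zero
  set Q := krylovLast U with hQ
  set C := krylovComp U
  have hCK : ∀ i j, C i j ∈ K := krylovComp_mem K (coeff_charpoly_mem K hXdet hYdet hC)
  have hUQ : U * Q = Q * C := mul_krylovLast U
  have hminor : ∀ {m : Type} [Fintype m] [DecidableEq m] {f : m → Fin n}, Function.Injective f →
      (Q.submatrix f f).det ≠ 0 := by
    intro m _ _ f hf
    refine det_submatrix_krylovMat_ne_zero hf
      (fun c => if h : (c : ℕ) + 1 < n then ⟨c + 1, h⟩ else ⟨0, by have := c.2; omega⟩) _ _ ?_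
    rintro ⟨b, hb⟩
    induction b with
    | zero => simp [show ¬ n - 1 + 1 < n by omega]
    | succ b ih =>
      have := ih (by omega)
      simp only at this ⊢
      rw [Function.iterate_succ_apply', this]
      simp [hb]
  obtain ⟨N, hN, hNQ⟩ := exists_lowerUni_mul_upper Q hminor
  have hNu : IsUnit N.det := by rw [hN.det_eq_one]; exact isUnit_one
  have hQdet : Q.det ≠ 0 := by
    have := hminor (f := id) Function.injective_id
    rwa [submatrix_id_id] at this
  have hNQdet : (N * Q).det ≠ 0 := by rwa [det_mul, hN.det_eq_one, _root_.one_mul]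
  set T := (N * Q)⁻¹ with hT
  set H := N⁻¹ with hHdef
  have hHl : IsLowerUni H := hN.inv
  have hHu : IsUnit H.det := by rw [hHl.det_eq_one]; exact isUnit_one
  have hTup : ∀ i j, j < i → T i j = 0 := inv_upper hNQdet hNQ
  have hQT : H = Q * T := by
    have : N * (Q * T) = 1 := by
      rw [← Matrix.mul_assoc, hT, mul_nonsing_inv _ (isUnit_iff_ne_zero.2 hNQdet)]
    exact inv_eq_right_inv this
  have hTK := triangularFactor_mem K hHl hTup hQT hUQ
    (fun a s hs => by simp only [C, krylovComp, of_apply, if_pos hs]) hCK hXdet hP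
  have hTu : IsUnit T.det := by
    rw [hT]
    exact isUnit_nonsing_inv_det _ (isUnit_iff_ne_zero.2 hNQdet)
  -- the matrices `P = R⁻¹ H` and `H` are determined by `(U R) P = H W`
  set W := T⁻¹ * C * T
  have hWK : ∀ i j, W i j ∈ K :=
    mul_mem_subfield K (mul_mem_subfield K (inv_mem_subfield K hTK) hCK) hTK
  have hUH : U * H = H * W := by
    rw [hQT, ← Matrix.mul_assoc, hUQ]
    simp only [W, Matrix.mul_assoc]
    rw [mul_nonsing_inv_cancel_left _ _ hTu]
  have hVK : ∀ i j, (U * R) i j ∈ K := by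
    rw [hU, Matrix.mul_assoc]
    exact mul_mem_subfield K (inv_mem_subfield K hXK) hBK
  have hRH : IsLowerUni (R⁻¹ * H) := by
    have hR' := hR.inv
    have hl : ∀ i j : Fin n, i < j → (R⁻¹ * H) i j = 0 := fun i j hij =>
      (hR'.blockTriangular.mul hHl.blockTriangular) (show OrderDual.toDual j < OrderDual.toDual i
        from hij)
    refine ⟨hl, fun i => ?_⟩
    rw [mul_apply, Finset.sum_eq_single i, hR'.2, hHl.2, _root_.one_mul]
    · intro j _ hj
      rcases lt_or_gt_of_ne hj with hj | hj
      · rw [hHl.1 _ _ hj, MulZeroClass.mul_zero]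
      · rw [hR'.1 _ _ hj, MulZeroClass.zero_mul]
    · exact fun h => absurd (Finset.mem_univ _) h
  obtain ⟨N', hN', hup⟩ := exists_lowerUni_mul_upper (U.submatrix id Fin.rev)
    fun hf => det_submatrix_rev_ne_zero hf
  obtain ⟨hPK, hHK⟩ := lowerUni_mem_of_mul_eq K hVK hWK hRH hHl
    (by rw [Matrix.mul_assoc, mul_nonsing_inv_cancel_left _ _ hRu, hUH])
    (fun π ν hπ hν h => by
      have hstrict := strictLower_eq_zero hUdet hN' hup (π := R * π * H⁻¹) (ν := ν * H⁻¹)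
        (mul_strictLower hHl.inv.1 (strictLower_mul hR.1 hπ)) (mul_strictLower hHl.inv.1 hν)
        (by
          have hW : W = H⁻¹ * (U * H) := by rw [hUH, nonsing_inv_mul_cancel_left _ _ hHu]
          rw [← Matrix.mul_assoc, ← Matrix.mul_assoc, h, hW, ← Matrix.mul_assoc ν,
            ← Matrix.mul_assoc, mul_nonsing_inv_cancel_right _ _ hHu])
      constructor
      · have e : π = R⁻¹ * (R * π * H⁻¹) * H := by
          rw [Matrix.mul_assoc R, nonsing_inv_mul_cancel_left _ _ hRu,
            nonsing_inv_mul_cancel_right _ _ hHu]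
        rw [e, hstrict.1, Matrix.mul_zero, Matrix.zero_mul]
      · have e : ν = ν * H⁻¹ * H := by rw [nonsing_inv_mul_cancel_right _ _ hHu]
        rw [e, hstrict.2, Matrix.zero_mul])
  have hYK : ∀ i j, genY n i j ∈ K := by
    have e : genY n = genY n * R * (R⁻¹ * H) * H⁻¹ := by
      rw [← Matrix.mul_assoc, mul_nonsing_inv_cancel_right _ _ hRu,
        mul_nonsing_inv_cancel_right _ _ hHu]
    rw [e]
    exact mul_mem_subfield K (mul_mem_subfield K hBK hPK) (inv_mem_subfield K hHK)
  rcases v with ⟨i, j⟩ | ⟨i, j⟩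
  · exact hXK i j
  · exact hYK i j

end

theorem eq_top_of_coordFun_mem (n : ℕ) (K : IntermediateField ℂ (RatFun n))
    (h : ∀ v, coordFun v ∈ K) : K = ⊤ := by
  refine eq_top_iff.2 fun x _ => ?_
  have hpoly : ∀ p : PolyFun n, algebraMap (PolyFun n) (RatFun n) p ∈ K := by
    intro p
    induction p using MvPolynomial.induction_on with
    | C a => exact K.algebraMap_mem a
    | add p q hp hq =>
      rw [map_add]
      exact K.add_mem hp hq
    | mul_X p v hp =>
      rw [map_mul]
      exact K.mul_mem hp (h v)
  obtain ⟨p, q, -, rfl⟩ := IsFractionRing.div_surjective (A := PolyFun n) x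
  exact K.div_mem (hpoly p) (hpoly q)

theorem adjoin_familyF (n : ℕ) : IntermediateField.adjoin ℂ (Set.range (familyF n)) = ⊤ := by
  have hF : ∀ a, familyF n a ∈ IntermediateField.adjoin ℂ (Set.range (familyF n)) := fun a =>
    IntermediateField.subset_adjoin _ _ ⟨a, rfl⟩
  exact eq_top_of_coordFun_mem n _ (coordFun_mem (IntermediateField.adjoin ℂ
    (Set.range (familyF n))).toSubfield (fun i j hij => hF (.inl (.g i j hij)))
    (fun i j hij => hF (.inl (.h i j hij))) (fun p q hp hq hpq => hF (.inl (.f p q hp hq hpq)))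
    (fun p q hp hq hpq => hF (.inl (.φ p q hp hq hpq))) fun i h₁ h₂ => hF (.inr ⟨i, h₁, h₂⟩))

/-! ### The number of functions -/

theorem sigma_fin_ext {m : ℕ} {f : Fin m → ℕ} {x y : Σ s : Fin m, Fin (f s)} (h₁ : x.1 = y.1)
    (h₂ : (x.2 : ℕ) = y.2) : x = y := by
  obtain ⟨s, t⟩ := x
  obtain ⟨s', t'⟩ := y
  obtain rfl : s = s' := h₁
  exact congrArg (Sigma.mk s) (Fin.ext h₂)

/-- The labels, with `φ_{kl}` and `f_{kl}` encoded by `k - 1 < k + l - 1`. -/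
def mainIndexEquiv (n : ℕ) : MainIndex n ≃
    ((Σ i : Fin n, Fin (i + 1)) ⊕ (Σ j : Fin n, Fin (j + 1))) ⊕
      ((Σ s : Fin (n - 1), Fin s) ⊕ (Σ s : Fin n, Fin s)) where
  toFun
    | .g i j hij => .inl (.inl ⟨i, j, by have := Fin.le_def.1 hij; omega⟩)
    | .h i j hij => .inl (.inr ⟨j, i, by have := Fin.le_def.1 hij; omega⟩)
    | .f k l hk hl hkl => .inr (.inl ⟨⟨k + l - 1, by omega⟩, ⟨k - 1, by simp only; omega⟩⟩)
    | .φ k l hk hl hkl => .inr (.inr ⟨⟨k + l - 1, by omega⟩, ⟨k - 1, by simp only; omega⟩⟩)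
  invFun
    | .inl (.inl ⟨i, j⟩) => .g i ⟨j, by omega⟩ (by rw [Fin.le_def]; simp only; omega)
    | .inl (.inr ⟨j, i⟩) => .h ⟨i, by omega⟩ j (by rw [Fin.le_def]; simp only; omega)
    | .inr (.inl ⟨s, t⟩) => .f (t + 1) (s - t) (by omega) (by omega) (by omega)
    | .inr (.inr ⟨s, t⟩) => .φ (t + 1) (s - t) (by omega) (by omega) (by omega)
  left_inv := by
    rintro (⟨i, j, hij⟩ | ⟨i, j, hij⟩ | ⟨k, l, hk, hl, hkl⟩ | ⟨k, l, hk, hl, hkl⟩)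
    · rfl
    · rfl
    · simp only [MainIndex.f.injEq]; omega
    · simp only [MainIndex.φ.injEq]; omega
  right_inv := by
    rintro ((⟨i, j⟩ | ⟨j, i⟩) | (⟨⟨s, hs⟩, ⟨t, ht⟩⟩ | ⟨⟨s, hs⟩, ⟨t, ht⟩⟩))
    · rfl
    · rfl
    · exact congrArg (fun x => Sum.inr (Sum.inl x)) (sigma_fin_ext
        (Fin.ext (by simp only at ht ⊢; omega)) (by simp only; omega))
    · exact congrArg (fun x => Sum.inr (Sum.inr x)) (sigma_fin_ext
        (Fin.ext (by simp only at ht ⊢; omega)) (by simp only; omega))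

instance finite_mainIndex (n : ℕ) : Finite (MainIndex n) :=
  Finite.of_equiv _ (mainIndexEquiv n).symm

theorem card_mainIndex {n : ℕ} (hn : 1 ≤ n) :
    Nat.card (MainIndex n) = 2 * n ^ 2 - n + 1 := by
  obtain ⟨m, rfl⟩ : ∃ m, n = m + 1 := ⟨n - 1, by omega⟩
  rw [Nat.card_congr (mainIndexEquiv (m + 1)), Nat.card_eq_fintype_card]
  simp only [Fintype.card_sum, Fintype.card_sigma, Fintype.card_fin]
  rw [Fin.sum_univ_eq_sum_range (fun i => i + 1), Fin.sum_univ_eq_sum_range (fun i => i),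
    Fin.sum_univ_eq_sum_range (fun i => i)]
  have h : ∀ m : ℕ, ∑ i ∈ Finset.range (m + 1), (i + 1) + ∑ i ∈ Finset.range (m + 1), (i + 1) +
      (∑ i ∈ Finset.range m, i + ∑ i ∈ Finset.range (m + 1), i) + m = 2 * (m + 1) ^ 2 := by
    intro m
    induction m with
    | zero => rfl
    | succ m ih =>
      rw [Finset.sum_range_succ _ (m + 1), Finset.sum_range_succ (fun i => i) (m + 1)]
      have := Finset.sum_range_succ (fun i => i) m
      nlinarith
  have := h m
  have : m + 1 ≤ (m + 1) ^ 2 := Nat.le_self_pow two_ne_zero _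
  rw [show m + 1 - 1 = m from rfl]
  omega

theorem card_casimirIndex (n : ℕ) : Nat.card (CasimirIndex n) = n - 1 := by
  have e : CasimirIndex n ≃ Fin (n - 1) :=
    { toFun := fun i => ⟨i.1 - 1, by have := i.2; omega⟩
      invFun := fun i => ⟨i + 1, by omega, by omega⟩
      left_inv := fun i => Subtype.ext (by have := i.2; simp only; omega)
      right_inv := fun i => Fin.ext (by simp only; omega) }
  rw [Nat.card_congr e, Nat.card_eq_fintype_card, Fintype.card_fin]

/-! ### Algebraic independence -/

theorem algebraicIndependent_coordFun (n : ℕ) :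
    AlgebraicIndependent ℂ (coordFun : Coord n → RatFun n) := by
  rw [algebraicIndependent_iff_injective_aeval]
  have e : (MvPolynomial.aeval (coordFun : Coord n → RatFun n)) =
      IsScalarTower.toAlgHom ℂ (PolyFun n) (RatFun n) := by
    ext v
    simp [coordFun]
  rw [e]
  exact IsFractionRing.injective (PolyFun n) (RatFun n)

/-- A generating family with as many members as there are coordinates is algebraically
independent, by comparison with the transcendence degree. -/
theorem algebraicIndependent_familyF {n : ℕ} (hn : 1 ≤ n) :
    AlgebraicIndependent ℂ (familyF n) := by
  have : Finite (CasimirIndex n) :=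
    (Set.finite_lt_nat n).subset (fun i (hi : 1 ≤ i ∧ i < n) => hi.2)
  have : Algebra.IsAlgebraic (Algebra.adjoin ℂ (Set.range (familyF n))) (RatFun n) := by
    refine ⟨fun x => ?_⟩
    have hx : x ∈ IntermediateField.adjoin ℂ (Set.range (familyF n)) := by
      rw [adjoin_familyF]
      trivial
    obtain ⟨a, ha, b, hb, rfl⟩ := IntermediateField.mem_adjoin_iff_div.1 hx
    have h₁ := isAlgebraic_algebraMap (R := Algebra.adjoin ℂ (Set.range (familyF n)))
      (A := RatFun n) ⟨a, ha⟩
    have h₂ := isAlgebraic_algebraMap (R := Algebra.adjoin ℂ (Set.range (familyF n)))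
      (A := RatFun n) ⟨b, hb⟩
    rw [div_eq_mul_inv]
    exact h₁.mul h₂.inv
  refine (Algebra.IsAlgebraic.isTranscendenceBasis_of_le_trdeg_of_finite ℂ (familyF n) ?_).1
  refine le_trans ?_ (algebraicIndependent_coordFun n).cardinalMk_le_trdeg
  rw [← Nat.cast_card, ← Nat.cast_card, Nat.cast_le, Nat.card_sum, card_mainIndex hn,
    card_casimirIndex, Nat.card_eq_fintype_card]
  simp only [Fintype.card_sum, Fintype.card_prod, Fintype.card_fin]
  have : n ≤ n ^ 2 := Nat.le_self_pow two_ne_zero n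
  rw [← sq]
  omega

end DrinfeldDouble

theorem theorem4p1 (n : ℕ) (hn : 1 ≤ n) :
    Nat.card (DrinfeldDouble.MainIndex n) = 2 * n ^ 2 - n + 1 ∧
    DrinfeldDouble.IsCoordinateSystem (DrinfeldDouble.familyF n) ∧
    DrinfeldDouble.IsLogCanonical (DrinfeldDouble.familyF n) ∧
    ∀ i : DrinfeldDouble.CasimirIndex n,
      DrinfeldDouble.IsCasimir (DrinfeldDouble.casimirFun (n := n) i.1) :=
  ⟨DrinfeldDouble.card_mainIndex hn,
    ⟨DrinfeldDouble.algebraicIndependent_familyF hn, DrinfeldDouble.adjoin_familyF n⟩,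
    DrinfeldDouble.isLogCanonical_familyF n,
    fun i => DrinfeldDouble.isCasimir_casimirFun i.2.1⟩
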